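/- **Conventions.** Manifolds are $C^\infty$, maps are smooth. Let $M^{n_1}$, $M^{n_2}$ be manifolds of dimensions $n_1,n_2\ge 1$, and let $\mathcal E=(E_1,E_2)$ be the product net of $M=M^{n_1}\times M^{n_2}$: $E_1$ and $E_2$ are the subbundles of $TM$ tangent to the leaves $M^{n_1}\times\{p_2\}$ and $\{p_1\}\times M^{n_2}$. A Riemannian metric on $M$ is a *twisted product metric* if it is $\rho_1^2\,\pi_1^*\langle\,,\rangle_1+\rho_2^2\,\pi_2^*\langle\,,\rangle_2$ with Riemannian metrics $\langle\,,\rangle_i$ on $M^{n_i}$ and smooth positive functions $\rho_1,\rho_2$ on $M$; it is a *product metric* if $\rho_1=\rho_2=1$. The second fundamental form of an immersion is *adapted* to $\mathcal E$ if $E_1$ and $E_2$ are invariant by all shape operators. A subbundle $D$ (or its leaves) is *spherical* if there is a vector field $\eta$ in $D^\perp$ with $(\nabla_XY)_{D^\perp}=\langle X,Y\rangle\eta$ and $(\nabla_X\eta)_{D^\perp}=0$ for all $X,Y\in\Gamma(D)$. For $c\ge0$, $N(d,c)$ is $\mathbb R^d$ if $c=0$ and the sphere $\{X\in\mathbb R^d:\langle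 X,X\rangle=1/c\}$, $d\ge2$, if $c>0$. An *extrinsic product* of $N(d_i,c_i)$, $i\in J$, in $\mathbb R^K$ is a map $\Psi(x)=\sum_{i\in J}\iota_i(x_i)+v$, where $\iota_i:\mathbb R^{d_i}\to\mathbb R^K$ are linear isometries with mutually orthogonal ranges and $v$ is a constant vector orthogonal to all these ranges. A *stereographic projection* of the unit sphere $\mathbb S^N\subset\mathbb R^{N+1}$ onto $\mathbb R^N$ is the central projection from a point $e\in\mathbb S^N$ onto some hyperplane not containing $e$ and parallel to $T_e\mathbb S^N$, followed by an isometry of that hyperplane onto $\mathbb R^N$. $\mathbb L^{m+1}$ is Minkowski space of signature $(+,\dots,+,-)$, $\mathbb H^m(-c)=\{X\in\mathbb L^{m+1}:\langle X,X\rangle=-1/c,\ X_{m+1}>0\}$ and $\mathbb S^{N-m}(c)=\{Y\in\mathbb R^{N-m+1}:\langle Y,Y\rangle=1/c\}$. For $1\le m\le N-1$, an orthogonal decomposition $\mathbb L^{N+2}=V\oplus W$, linear isometries $C:\mathbb L^{m+1}\to V$, $D:\mathbb R^{N-m+1}\to W$, light-like vectors $p_0,w\in\mathbb L^{N+2}$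 with $\langle p_0,w\rangle=1$, and a linear isometry $A:\mathbb R^N\to\{p_0,w\}^\perp$, let $\Theta:\mathbb H^m(-c)\times\mathbb S^{N-m}(c)\to\mathbb R^N$ be the conformal diffeomorphism onto an open subset given by $$p_0+A\,\Theta(X,Y)-\tfrac12\|\Theta(X,Y)\|^2w=\frac{C X+D Y}{\langle C X+D Y,w\rangle},$$ defined where $\langle C X+D Y,w\rangle\ne0$, i.e. except possibly at one point. **Statement.** Let $f:(M,\langle\,,\rangle)\to\mathbb R^N$ be an isometric immersion, where $M=M^{n_1}\times M^{n_2}$ is simply connected and $\langle\,,\rangle$ is a twisted product metric, and suppose that the second fundamental form of $f$ is adapted to $\mathcal E$. If $n_i=1$ for some $i\in\{1,2\}$, suppose further that the leaves of $E_i$ are spherical in $M$. Then there are a smooth function $\varphi>0$ on $M$ and Riemannian metrics $\langle\,,\rangle_i^\sim$ on $M^{n_i}$ with $$\langle\,,\rangle=\varphi^2\big(\pi_1^*\langle\,,\rangle_1^\sim+\pi_2^*\langle\,,\rangle_2^\sim\big),$$ and, with $M_i=(M^{n_i},\langle\,,\rangle_i^\sim)$, one of the following holds: (i) There are an extrinsic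 product $\Psi$ of $N_1=N(d_1,c_1)$ and $N_2=N(d_2,c_2)$, isometric immersions $f_i:M_i\to N_i$, $i=1,2$, and a homothety $H$ such that $f=\mathcal P\circ H\circ\Psi\circ(f_1\times f_2)$, where either $\Psi$ takes values in $\mathbb R^N$, $H$ is a homothety of $\mathbb R^N$, and $\mathcal P$ is the identity or an inversion in $\mathbb R^N$ with respect to a sphere of unit radius; or $\Psi$ takes values in $\mathbb S^N(c)\subset\mathbb R^{N+1}$ for some $c>0$, $H$ is the homothety of $\mathbb R^{N+1}$ with $H(\mathbb S^N(c))=\mathbb S^N$, and $\mathcal P$ is a stereographic projection of $\mathbb S^N$ onto $\mathbb R^N$. (The image of $H\circ\Psi\circ(f_1\times f_2)$ does not contain the center of the inversion, or the pole of the projection.) (ii) For exactly one $j\in\{1,2\}$, with $i$ denoting the other index, there are $1\le m\le N-1$, $c,c_i>0$, an extrinsic product $\Psi:N(d_i,c_i)\to\mathbb S^{N-m}(c)$ (with one factor), isometric immersions $f_j:M_j\to\mathbb H^m(-c)$ and $f_i:M_i\to N(d_i,c_i)$, and a conformal diffeomorphism $\Theta$ as above, such that $f(p)=\Theta\big(f_j(p_j),\Psi(f_i(p_i))\big)$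 for all $p=(p_1,p_2)\in M$ (all these points being in the domain of $\Theta$). -/

import Mathlib

open Bundle
open scoped Manifold ContDiff InnerProductSpace

noncomputable section

/-! ### Riemannian metrics, twisted products -/

section Metrics

variable {E : Type*} [NormedAddCommGroup E] [NormedSpace ℝ E]
  {H : Type*} [TopologicalSpace H] (I : ModelWithCorners ℝ E H)
  (M : Type*) [TopologicalSpace M] [ChartedSpace H M] [IsManifold I ∞ M]

/-- Smooth Riemannian metrics on the manifold `M`. -/
abbrev SmoothMetric :=
  ContMDiffRiemannianMetric I ∞ E (fun p : M => TangentSpace I p)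

end Metrics

section Products

variable {E₁ : Type*} [NormedAddCommGroup E₁] [NormedSpace ℝ E₁]
  {H₁ : Type*} [TopologicalSpace H₁] {I₁ : ModelWithCorners ℝ E₁ H₁}
  {M₁ : Type*} [TopologicalSpace M₁] [ChartedSpace H₁ M₁] [IsManifold I₁ ∞ M₁]
  {E₂ : Type*} [NormedAddCommGroup E₂] [NormedSpace ℝ E₂]
  {H₂ : Type*} [TopologicalSpace H₂] {I₂ : ModelWithCorners ℝ E₂ H₂}
  {M₂ : Type*} [TopologicalSpace M₂] [ChartedSpace H₂ M₂] [IsManifold I₂ ∞ M₂]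

/-- The pullback `π₁^* g₁` of a metric on the first factor, evaluated on `X, Y ∈ T_p(M₁ × M₂)`. -/
def pullbackFst (g₁ : SmoothMetric I₁ M₁) (p : M₁ × M₂) (X Y : TangentSpace (I₁.prod I₂) p) : ℝ :=
  g₁.inner p.1 (mfderiv (I₁.prod I₂) I₁ Prod.fst p X) (mfderiv (I₁.prod I₂) I₁ Prod.fst p Y)

/-- The pullback `π₂^* g₂` of a metric on the second factor, evaluated on `X, Y ∈ T_p(M₁ × M₂)`. -/
def pullbackSnd (g₂ : SmoothMetric I₂ M₂) (p : M₁ × M₂) (X Y : TangentSpace (I₁.prod I₂) p) : ℝ :=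
  g₂.inner p.2 (mfderiv (I₁.prod I₂) I₂ Prod.snd p X) (mfderiv (I₁.prod I₂) I₂ Prod.snd p Y)

/-- `g = ρ₁² π₁^* g₁ + ρ₂² π₂^* g₂` for Riemannian metrics `g₁`, `g₂` on the factors and smooth
positive functions `ρ₁`, `ρ₂` on the product. -/
def IsTwistedProductMetric (g : SmoothMetric (I₁.prod I₂) (M₁ × M₂)) : Prop :=
  ∃ (g₁ : SmoothMetric I₁ M₁) (g₂ : SmoothMetric I₂ M₂) (ρ₁ ρ₂ : M₁ × M₂ → ℝ),
    ContMDiff (I₁.prod I₂) 𝓘(ℝ, ℝ) ∞ ρ₁ ∧ ContMDiff (I₁.prod I₂) 𝓘(ℝ, ℝ) ∞ ρ₂ ∧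
    (∀ p, 0 < ρ₁ p) ∧ (∀ p, 0 < ρ₂ p) ∧
    ∀ (p : M₁ × M₂) (X Y : TangentSpace (I₁.prod I₂) p),
      g.inner p X Y = ρ₁ p ^ 2 * pullbackFst g₁ p X Y + ρ₂ p ^ 2 * pullbackSnd g₂ p X Y

/-- `g` is conformal, with conformal factor `φ`, to the Riemannian product metric
`π₁^* h₁ + π₂^* h₂`. -/
def IsConformalToProduct (g : SmoothMetric (I₁.prod I₂) (M₁ × M₂)) (φ : M₁ × M₂ → ℝ)
    (h₁ : SmoothMetric I₁ M₁) (h₂ : SmoothMetric I₂ M₂) : Prop :=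
  ContMDiff (I₁.prod I₂) 𝓘(ℝ, ℝ) ∞ φ ∧ (∀ p, 0 < φ p) ∧
    ∀ (p : M₁ × M₂) (X Y : TangentSpace (I₁.prod I₂) p),
      g.inner p X Y = φ p ^ 2 * (pullbackFst h₁ p X Y + pullbackSnd h₂ p X Y)

variable (I₁ I₂) in
/-- The first subbundle `E₁` of the product net: the vectors tangent to the leaves
`M₁ × {p₂}`. -/
def productNetFst (p : M₁ × M₂) : Submodule ℝ (TangentSpace (I₁.prod I₂) p) :=
  LinearMap.ker (mfderiv (I₁.prod I₂) I₂ (Prod.snd : M₁ × M₂ → M₂) p).toLinearMap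

variable (I₁ I₂) in
/-- The second subbundle `E₂` of the product net: the vectors tangent to the leaves
`{p₁} × M₂`. -/
def productNetSnd (p : M₁ × M₂) : Submodule ℝ (TangentSpace (I₁.prod I₂) p) :=
  LinearMap.ker (mfderiv (I₁.prod I₂) I₁ (Prod.fst : M₁ × M₂ → M₁) p).toLinearMap

end Products

/-! ### Submanifold geometry -/

section Geometry

variable {E : Type*} [NormedAddCommGroup E] [NormedSpace ℝ E]
  {H : Type*} [TopologicalSpace H] {I : ModelWithCorners ℝ E H}
  {M : Type*} [TopologicalSpace M] [ChartedSpace H M]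

/-- `f` is a smooth isometric immersion of `(M, g)` into the vector space `V` endowed with the
(definite or Lorentzian) scalar product `B`. -/
def IsIsometricImmersion [IsManifold I ∞ M] {V : Type*} [NormedAddCommGroup V] [NormedSpace ℝ V]
    (B : V → V → ℝ) (g : SmoothMetric I M) (f : M → V) : Prop :=
  ContMDiff I 𝓘(ℝ, V) ∞ f ∧
    ∀ (p : M) (X Y : TangentSpace I p),
      B (mfderiv I 𝓘(ℝ, V) f p X) (mfderiv I 𝓘(ℝ, V) f p Y) = g.inner p X Y

/-- The standard inner product of `ℝ^d`. -/
def euclid (d : ℕ) (x y : EuclideanSpace ℝ (Fin d)) : ℝ := ⟪x, y⟫_ℝ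

variable (I) in
/-- The tangent space `df(T_pM)` of an immersion, as a subspace of `ℝ^N`. -/
def tangentImage {N : ℕ} (f : M → EuclideanSpace ℝ (Fin N)) (p : M) :
    Submodule ℝ (EuclideanSpace ℝ (Fin N)) :=
  LinearMap.range (mfderiv I 𝓘(ℝ, EuclideanSpace ℝ (Fin N)) f p).toLinearMap

variable (I) in
/-- The second derivative `D²(f ∘ x⁻¹)` at `p`, where `x` is the preferred chart at `p` (with
respect to which tangent vectors at `p` are identified with vectors of the model space). -/
def coordHessian {N : ℕ} (f : M → EuclideanSpace ℝ (Fin N)) (p : M) :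
    E →L[ℝ] E →L[ℝ] EuclideanSpace ℝ (Fin N) :=
  fderiv ℝ (fderiv ℝ (f ∘ (extChartAt I p).symm)) (extChartAt I p p)

variable (I) in
/-- The second fundamental form `α_f(X, Y)`: the normal component of the derivative of `df(Y)` in
the direction `X`. The coordinate field with value `Y` at `p` is used to extend `Y`; another
extension changes the derivative only by a tangent vector. -/
def secondFundamentalForm {N : ℕ} (f : M → EuclideanSpace ℝ (Fin N)) (p : M)
    (X Y : TangentSpace I p) : EuclideanSpace ℝ (Fin N) :=
  (tangentImage I f p)ᗮ.starProjection (coordHessian I f p X Y)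

variable [IsManifold I ∞ M]

/-- `A` is the shape operator `A_ξ` of `f` at `p` in the normal direction `ξ`, that is,
`⟨A_ξ X, Y⟩ = ⟨α_f(X, Y), ξ⟩`. -/
def IsShapeOperator {N : ℕ} (g : SmoothMetric I M) (f : M → EuclideanSpace ℝ (Fin N)) (p : M)
    (ξ : EuclideanSpace ℝ (Fin N)) (A : TangentSpace I p →ₗ[ℝ] TangentSpace I p) : Prop :=
  ∀ X Y : TangentSpace I p, g.inner p (A X) Y = ⟪secondFundamentalForm I f p X Y, ξ⟫_ℝ

/-- The subbundle `D` is invariant by all shape operators of `f`. -/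
def IsShapeInvariant {N : ℕ} (g : SmoothMetric I M) (f : M → EuclideanSpace ℝ (Fin N))
    (D : ∀ p : M, Submodule ℝ (TangentSpace I p)) : Prop :=
  ∀ (p : M), ∀ ξ ∈ (tangentImage I f p)ᗮ,
    ∃ A : TangentSpace I p →ₗ[ℝ] TangentSpace I p,
      IsShapeOperator g f p ξ A ∧ ∀ X ∈ D p, A X ∈ D p

/-- The components `g_x(u, v)` of the metric in the preferred chart at `p`. -/
def coordMetric (g : SmoothMetric I M) (p : M) (x u v : E) : ℝ :=
  g.inner ((extChartAt I p).symm x)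
    (mfderiv 𝓘(ℝ, E) I (extChartAt I p).symm x u) (mfderiv 𝓘(ℝ, E) I (extChartAt I p).symm x v)

/-- The Christoffel symbols of the first kind at `p`, in the preferred chart at `p`:
`½ (∂_u g(v, w) + ∂_v g(u, w) - ∂_w g(u, v))`. -/
def christoffel (g : SmoothMetric I M) (p : M) (u v w : E) : ℝ :=
  (1 / 2) * (fderiv ℝ (fun x => coordMetric g p x v w) (extChartAt I p p) u
    + fderiv ℝ (fun x => coordMetric g p x u w) (extChartAt I p p) v
    - fderiv ℝ (fun x => coordMetric g p x u v) (extChartAt I p p) w)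

/-- The vector field `Y` read in the preferred chart at `p`. -/
def coordField (Y : ∀ q : M, TangentSpace I q) (p : M) (x : E) : E :=
  mfderiv I 𝓘(ℝ, E) (extChartAt I p) ((extChartAt I p).symm x) (Y ((extChartAt I p).symm x))

/-- `⟨∇_X Y, Z⟩` at `p`, where `∇` is the Levi-Civita connection of `g`, `X` and `Z` are tangent
vectors at `p`, and `Y` is a vector field defined near `p`. -/
def leviCivita (g : SmoothMetric I M) (Y : ∀ q : M, TangentSpace I q) (p : M)
    (X Z : TangentSpace I p) : ℝ :=
  g.inner p (fderiv ℝ (coordField Y p) (extChartAt I p p) X : E) Z + christoffel g p X (Y p) Z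

/-- The subbundle `D` is spherical: there is a smooth vector field `η` orthogonal to `D` (the
mean curvature normal) such that `(∇_X Y)_{D^⊥} = ⟨X, Y⟩ η` for all local sections `X`, `Y` of `D`
and `(∇_X η)_{D^⊥} = 0` for all `X` in `D`. For an integrable subbundle this says that its leaves
are umbilical submanifolds with parallel mean curvature vector. -/
def IsSpherical (g : SmoothMetric I M) (D : ∀ p : M, Submodule ℝ (TangentSpace I p)) : Prop :=
  ∃ η : ∀ p : M, TangentSpace I p,
    ContMDiff I I.tangent ∞ (fun p => (⟨p, η p⟩ : TangentBundle I M)) ∧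
    (∀ p, ∀ X ∈ D p, g.inner p (η p) X = 0) ∧
    (∀ (p : M) (Y : ∀ q : M, TangentSpace I q),
      ContMDiffAt I I.tangent ∞ (fun q => (⟨q, Y q⟩ : TangentBundle I M)) p →
      (∀ᶠ q in nhds p, Y q ∈ D q) →
      ∀ X ∈ D p, ∀ Z : TangentSpace I p, (∀ W ∈ D p, g.inner p Z W = 0) →
        leviCivita g Y p X Z = g.inner p X (Y p) * g.inner p (η p) Z) ∧
    (∀ (p : M), ∀ X ∈ D p, ∀ Z : TangentSpace I p, (∀ W ∈ D p, g.inner p Z W = 0) →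
        leviCivita g η p X Z = 0)

end Geometry

/-! ### Extrinsic products -/

/-- The complete submanifold of `ℝ^d` of constant curvature `c ≥ 0` used as a factor: `ℝ^d` itself
if `c = 0`, and the sphere `{X : ⟨X, X⟩ = 1/c}` if `c ≠ 0`. -/
def spaceForm (d : ℕ) (c : ℝ) : Set (EuclideanSpace ℝ (Fin d)) :=
  {X | c ≠ 0 → ⟪X, X⟫_ℝ = 1 / c}

/-- An extrinsic product of the manifolds `N_i = spaceForm (d i) (c i)`, `i : ι`, in `ℝ^K`: with
respect to an orthogonal decomposition of `ℝ^K` into the ranges of the linear isometries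
`incl i : ℝ^(d i) → ℝ^K` and a (possibly trivial) rest containing `const`, it is the map
`(x_i) ↦ ∑ i, incl i (x_i) + const`. -/
structure ExtrinsicProduct {ι : Type} [Fintype ι] (d : ι → ℕ) (c : ι → ℝ) (K : ℕ) where
  nonneg : ∀ i, 0 ≤ c i
  two_le : ∀ i, c i ≠ 0 → 2 ≤ d i
  incl : ∀ i, EuclideanSpace ℝ (Fin (d i)) →ₗᵢ[ℝ] EuclideanSpace ℝ (Fin K)
  incl_orthogonal : ∀ i j, i ≠ j → ∀ x y, ⟪incl i x, incl j y⟫_ℝ = 0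
  const : EuclideanSpace ℝ (Fin K)
  const_orthogonal : ∀ i x, ⟪incl i x, const⟫_ℝ = 0

namespace ExtrinsicProduct

variable {ι : Type} [Fintype ι] {d : ι → ℕ} {c : ι → ℝ} {K : ℕ}

/-- The map `Ψ(x) = ∑ i, incl i (x_i) + const`. -/
def map (Ψ : ExtrinsicProduct d c K) (x : ∀ i, EuclideanSpace ℝ (Fin (d i))) :
    EuclideanSpace ℝ (Fin K) :=
  ∑ i, Ψ.incl i (x i) + Ψ.const

/-- `Ψ` takes the product of the `N_i` into the sphere `{X : ⟨X, X⟩ = 1/a}` of `ℝ^K` if `a ≠ 0`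
(no condition if `a = 0`). -/
def TakesValuesIn (Ψ : ExtrinsicProduct d c K) (a : ℝ) : Prop :=
  ∀ x : ∀ i, EuclideanSpace ℝ (Fin (d i)),
    (∀ i, x i ∈ spaceForm (d i) (c i)) → Ψ.map x ∈ spaceForm K a

end ExtrinsicProduct

/-- The pair `(x, y)` as a family indexed by `Fin 2`. -/
def pairFamily {d : Fin 2 → ℕ} (x : EuclideanSpace ℝ (Fin (d 0)))
    (y : EuclideanSpace ℝ (Fin (d 1))) : ∀ i, EuclideanSpace ℝ (Fin (d i)) :=
  Fin.cons x (Fin.cons y finZeroElim)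

/-! ### Stereographic projections -/

/-- `P` is a stereographic projection with pole `e` of the unit sphere of `ℝ^(N+1)` onto `ℝ^N`:
the central projection from `e` onto a hyperplane `{y : ⟨e, y⟩ = t}`, `t ≠ 1`, parallel to the
tangent hyperplane of the sphere at `e`, which is identified with `ℝ^N` by an isometry `L`. -/
def IsStereographicProjection {N : ℕ} (e : EuclideanSpace ℝ (Fin (N + 1)))
    (P : EuclideanSpace ℝ (Fin (N + 1)) → EuclideanSpace ℝ (Fin N)) : Prop :=
  ‖e‖ = 1 ∧ ∃ (t : ℝ) (L : EuclideanSpace ℝ (Fin N) →ᵃⁱ[ℝ] EuclideanSpace ℝ (Fin (N + 1))),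
    t ≠ 1 ∧ (∀ y, ⟪e, L y⟫_ℝ = t) ∧
    ∀ x, ‖x‖ = 1 → x ≠ e → L (P x) = e + ((1 - t) / (1 - ⟪e, x⟫_ℝ)) • (x - e)

/-! ### Minkowski space and the conformal diffeomorphisms `Θ` -/

/-- Minkowski space `𝕃^(m+1)`; the last coordinate is the time-like one. -/
abbrev Minkowski (m : ℕ) := EuclideanSpace ℝ (Fin m) × ℝ

/-- The Lorentz scalar product of signature `(+, …, +, -)`. -/
def lorentz {m : ℕ} (x y : Minkowski m) : ℝ := ⟪x.1, y.1⟫_ℝ - x.2 * y.2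

/-- The hyperbolic space `ℍ^m(-c)`, as a sheet of the hyperboloid `⟨X, X⟩ = -1/c`. -/
def hyperbolicSpace (m : ℕ) (c : ℝ) : Set (Minkowski m) :=
  {X | lorentz X X = -(1 / c) ∧ 0 < X.2}

/-- A triple `(p₀, w, A)`: light-like vectors `p₀`, `w` with `⟨p₀, w⟩ = 1` and a linear isometry
`A` of `ℝ^N` onto `span {p₀, w}^⊥`. -/
structure ConeTriple (N : ℕ) where
  p₀ : Minkowski (N + 1)
  w : Minkowski (N + 1)
  A : EuclideanSpace ℝ (Fin N) →ₗ[ℝ] Minkowski (N + 1)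
  p₀_lightlike : lorentz p₀ p₀ = 0
  w_lightlike : lorentz w w = 0
  p₀_w : lorentz p₀ w = 1
  A_isometry : ∀ x y, lorentz (A x) (A y) = ⟪x, y⟫_ℝ
  A_p₀ : ∀ x, lorentz (A x) p₀ = 0
  A_w : ∀ x, lorentz (A x) w = 0

/-- The isometry `x ↦ p₀ + A x - ½ ‖x‖² w` of `ℝ^N` onto `{p : ⟨p, p⟩ = 0, ⟨p, w⟩ = 1}`. -/
def ConeTriple.embed {N : ℕ} (T : ConeTriple N) (x : EuclideanSpace ℝ (Fin N)) :
    Minkowski (N + 1) :=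
  T.p₀ + T.A x - ((1 / 2) * ‖x‖ ^ 2) • T.w

/-- Linear isometries `C : 𝕃^(m+1) → V`, `D : ℝ^d → W` onto the summands of an orthogonal
decomposition `𝕃^(N+2) = V ⊕ W` with `V` time-like; here `(m + 1) + d = N + 2`, so that `V` and
`W`, being orthogonal and non-degenerate, span `𝕃^(N+2)`. -/
structure LorentzSplitting (m d N : ℕ) where
  dim : (m + 1) + d = N + 2
  C : Minkowski m →ₗ[ℝ] Minkowski (N + 1)
  D : EuclideanSpace ℝ (Fin d) →ₗ[ℝ] Minkowski (N + 1)
  C_isometry : ∀ X Y, lorentz (C X) (C Y) = lorentz X Y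
  D_isometry : ∀ X Y, lorentz (D X) (D Y) = ⟪X, Y⟫_ℝ
  orthogonal : ∀ X Y, lorentz (C X) (D Y) = 0

/-- The isometric immersion `(X, Y) ↦ C X + D Y` of `ℍ^m(-c) × 𝕊^(d-1)(c)` into the light cone. -/
def LorentzSplitting.map {m d N : ℕ} (S : LorentzSplitting m d N) (X : Minkowski m)
    (Y : EuclideanSpace ℝ (Fin d)) : Minkowski (N + 1) :=
  S.C X + S.D Y

/-- `Θ : ℍ^m(-c) × 𝕊^(d-1)(c) → ℝ^N`, `m + d = N + 1`, is the conformal diffeomorphism (onto an open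
subset of `ℝ^N`) obtained by projecting the point `C X + D Y` of the light cone to the point
`(C X + D Y) / ⟨C X + D Y, w⟩` of the model `{p : ⟨p, p⟩ = 0, ⟨p, w⟩ = 1}` of `ℝ^N`. It is defined
where `⟨C X + D Y, w⟩ ≠ 0`, that is, except possibly at one point. -/
def IsTheta {m d N : ℕ} (c : ℝ) (T : ConeTriple N) (S : LorentzSplitting m d N)
    (Θ : Minkowski m → EuclideanSpace ℝ (Fin d) → EuclideanSpace ℝ (Fin N)) : Prop :=
  ∀ X ∈ hyperbolicSpace m c, ∀ Y ∈ spaceForm d c, lorentz (S.map X Y) T.w ≠ 0 →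
    T.embed (Θ X Y) = (lorentz (S.map X Y) T.w)⁻¹ • S.map X Y

/-! ### The two forms of a conformal immersion of a Riemannian product -/

section Forms

variable {E₁ : Type*} [NormedAddCommGroup E₁] [NormedSpace ℝ E₁]
  {H₁ : Type*} [TopologicalSpace H₁] {I₁ : ModelWithCorners ℝ E₁ H₁}
  {M₁ : Type*} [TopologicalSpace M₁] [ChartedSpace H₁ M₁] [IsManifold I₁ ∞ M₁]
  {E₂ : Type*} [NormedAddCommGroup E₂] [NormedSpace ℝ E₂]
  {H₂ : Type*} [TopologicalSpace H₂] {I₂ : ModelWithCorners ℝ E₂ H₂}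
  {M₂ : Type*} [TopologicalSpace M₂] [ChartedSpace H₂ M₂] [IsManifold I₂ ∞ M₂]
  {N : ℕ}

/-- `F = Ψ ∘ (f₁ × f₂)` for an extrinsic product `Ψ : N₁ × N₂ → ℝ^K` and isometric immersions
`f_i : (M_i, h_i) → N_i`, where `Ψ` takes values in the sphere of curvature `a` if `a ≠ 0`. -/
def IsExtrinsicProductImmersion {K : ℕ} (a : ℝ) (h₁ : SmoothMetric I₁ M₁)
    (h₂ : SmoothMetric I₂ M₂) (F : M₁ × M₂ → EuclideanSpace ℝ (Fin K)) : Prop :=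
  ∃ (d : Fin 2 → ℕ) (c : Fin 2 → ℝ) (Ψ : ExtrinsicProduct d c K)
    (f₁ : M₁ → EuclideanSpace ℝ (Fin (d 0))) (f₂ : M₂ → EuclideanSpace ℝ (Fin (d 1))),
    Ψ.TakesValuesIn a ∧
    IsIsometricImmersion (euclid (d 0)) h₁ f₁ ∧ (∀ p, f₁ p ∈ spaceForm (d 0) (c 0)) ∧
    IsIsometricImmersion (euclid (d 1)) h₂ f₂ ∧ (∀ p, f₂ p ∈ spaceForm (d 1) (c 1)) ∧
    ∀ p, F p = Ψ.map (pairFamily (f₁ p.1) (f₂ p.2))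

/-- First form, `f = 𝒫 ∘ H ∘ Ψ ∘ (f₁ × f₂)` with `Ψ ∘ (f₁ × f₂)` an extrinsic product of isometric
immersions and `H` a homothety of ratio `r > 0`. Either `Ψ` takes values in `ℝ^N` and `𝒫` is the
identity or an inversion with respect to a sphere of unit radius, or `Ψ` takes values in a sphere
`𝕊^N(c) ⊆ ℝ^(N+1)`, `c > 0`, `H` maps this sphere onto the unit sphere and `𝒫` is a stereographic
projection of the unit sphere onto `ℝ^N`. -/
def IsProductForm (h₁ : SmoothMetric I₁ M₁) (h₂ : SmoothMetric I₂ M₂)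
    (f : M₁ × M₂ → EuclideanSpace ℝ (Fin N)) : Prop :=
  (∃ (F : M₁ × M₂ → EuclideanSpace ℝ (Fin N)) (r : ℝ),
    IsExtrinsicProductImmersion 0 h₁ h₂ F ∧ 0 < r ∧
    ((∀ p, f p = r • F p) ∨
      ∃ q : EuclideanSpace ℝ (Fin N), ∀ p, r • F p ≠ q ∧
        f p = EuclideanGeometry.inversion q 1 (r • F p))) ∨
  (∃ (c : ℝ) (F : M₁ × M₂ → EuclideanSpace ℝ (Fin (N + 1))) (r : ℝ)
      (e : EuclideanSpace ℝ (Fin (N + 1)))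
      (P : EuclideanSpace ℝ (Fin (N + 1)) → EuclideanSpace ℝ (Fin N)),
    0 < c ∧ IsExtrinsicProductImmersion c h₁ h₂ F ∧
    0 < r ∧ r ^ 2 = c ∧ IsStereographicProjection e P ∧
    ∀ p, r • F p ≠ e ∧ f p = P (r • F p))

/-- Second form, `f = Θ ∘ (f₁ × (Ψ ∘ f₂))`, where `f₁ : (M₁, h₁) → ℍ^m(-c)` and
`f₂ : (M₂, h₂) → 𝕊^(d₂-1)(c₂)` are isometric immersions, `Ψ : 𝕊^(d₂-1)(c₂) → 𝕊^(d-1)(c)` is an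
extrinsic product with one factor, `m + d = N + 1`, `1 ≤ m ≤ N - 1`. -/
def IsHyperbolicForm (h₁ : SmoothMetric I₁ M₁) (h₂ : SmoothMetric I₂ M₂)
    (f : M₁ → M₂ → EuclideanSpace ℝ (Fin N)) : Prop :=
  ∃ (m d d₂ : ℕ) (c c₂ : ℝ) (T : ConeTriple N) (S : LorentzSplitting m d N)
    (Θ : Minkowski m → EuclideanSpace ℝ (Fin d) → EuclideanSpace ℝ (Fin N))
    (Ψ : ExtrinsicProduct (fun _ : Unit => d₂) (fun _ => c₂) d)
    (f₁ : M₁ → Minkowski m) (f₂ : M₂ → EuclideanSpace ℝ (Fin d₂)),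
    1 ≤ m ∧ 2 ≤ d ∧ 0 < c ∧ 0 < c₂ ∧ IsTheta c T S Θ ∧ Ψ.TakesValuesIn c ∧
    IsIsometricImmersion lorentz h₁ f₁ ∧ (∀ p, f₁ p ∈ hyperbolicSpace m c) ∧
    IsIsometricImmersion (euclid d₂) h₂ f₂ ∧ (∀ p, f₂ p ∈ spaceForm d₂ c₂) ∧
    ∀ p₁ p₂, lorentz (S.map (f₁ p₁) (Ψ.map fun _ => f₂ p₂)) T.w ≠ 0 ∧
      f p₁ p₂ = Θ (f₁ p₁) (Ψ.map fun _ => f₂ p₂)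

/-- The conclusion of the decomposition theorem for a conformal immersion `f` of the Riemannian
product `(M₁, h₁) × (M₂, h₂)`: `f` has the first form, or it has the second form with exactly one
of the two factors in the role of the factor mapped into hyperbolic space. -/
def IsDecomposable (h₁ : SmoothMetric I₁ M₁) (h₂ : SmoothMetric I₂ M₂)
    (f : M₁ × M₂ → EuclideanSpace ℝ (Fin N)) : Prop :=
  IsProductForm h₁ h₂ f ∨
    Xor (IsHyperbolicForm h₁ h₂ fun p₁ p₂ => f (p₁, p₂))
      (IsHyperbolicForm h₂ h₁ fun p₂ p₁ => f (p₁, p₂))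

end Forms

end

open Filter Topology

noncomputable section

/-! ### Calculus in normed spaces -/

section Calculus

variable {E : Type*} [NormedAddCommGroup E] [NormedSpace ℝ E]
  {V : Type*} [NormedAddCommGroup V] [NormedSpace ℝ V]

/-! Write u and v for the logarithms of the twisting functions, and let indices a and b denote
derivatives along the first and second factor. Twistedness of the metric and adaptedness of the
second fundamental form together amount to the equation f_ab = u_b f_a + v_a f_b
(`mixed_hessian_eq`, in charts `IsTwistedNet.hessian_eq`). If a factor has dimension at least two,
differentiating this equation once more in that factor and comparing mixed derivatives gives u_ab =
v_a u_b, respectively v_ab = v_a u_b. In dimension one the same identity is the sphericity of the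
leaves (`IsTwistedNet.hessian_log_of_codazzi`, `IsTwistedNet.hessian_log_of_isSpherical`). Hence (u
- v)_ab = 0, so u - v is a sum of functions on the factors. Absorbing these into the metrics of the
factors makes the metric conformal to a product metric, with a factor φ = e^ψ satisfying ψ_b = u_b
and ψ_a = v_a.

Now embed ℝ^N isometrically into the light cone of 𝕃^(N+2). The second derivative of this embedding
vanishes on orthogonal pairs, so the embedded f satisfies the same equation. Dividing by φ removes
all mixed derivatives, so F = φ⁻¹ (embedded f) is a sum of a function of x and a function of y
(`exists_conformal_splitting`). It is also an isometric immersion of the Riemannian product into the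
light cone.

What remains is linear algebra. Let V₁ and V₂ be the spans of the increments of F along the two
factors. Because F is null, V₁ and V₂ are orthogonal (`IsConeSplitting.lorentz_sub_sub`). If one of
them contains a time-like vector, F splits into a hyperbolic and a spherical part, which is the
second form. Otherwise V₁ + V₂ contains no time-like vector either, and `timelike_trichotomy` leaves
two cases. If V₁ + V₂ is orthogonal to a time-like vector, F lies in a space-like affine slice of
the cone, which is a round sphere, and f is its stereographic image. If V₁ + V₂ contains a null
vector n orthogonal to it, F lies in a slice ⟨·, n⟩ = const, which is a flat copy of ℝ^N. Comparing
this copy with the one defining the embedding gives a homothety or an inversion. The cases are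
assembled in `IsConeSplitting.isDecomposable`; that the two hyperbolic alternatives exclude each
other is `IsConeSplitting.nonneg_of_isHyperbolicForm`. -/

theorem ContDiffAt.differentiableAt_fderiv {f : E → V} {z : E} {n : WithTop ℕ∞}
    (hf : ContDiffAt ℝ n f z) (hn : 2 ≤ n) : DifferentiableAt ℝ (fderiv ℝ f) z :=
  (hf.fderiv_right (m := 1) (by simpa [one_add_one_eq_two] using hn)).differentiableAt one_ne_zero

theorem ContDiffAt.differentiableAt_two {f : E → V} {z : E} {n : WithTop ℕ∞}
    (hf : ContDiffAt ℝ n f z) (hn : 2 ≤ n) : DifferentiableAt ℝ f z :=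
  hf.differentiableAt (fun h => by simp [h] at hn)

theorem ContDiffAt.fderiv_fderiv_comm {f : E → V} {z : E} {n : WithTop ℕ∞}
    (hf : ContDiffAt ℝ n f z) (hn : 2 ≤ n) (a b : E) :
    fderiv ℝ (fderiv ℝ f) z a b = fderiv ℝ (fderiv ℝ f) z b a :=
  (hf.isSymmSndFDerivAt (by simpa using hn)).eq a b

theorem fderiv_fderiv_apply {f : E → V} {z : E} (hf : DifferentiableAt ℝ (fderiv ℝ f) z) (a b : E) :
    fderiv ℝ (fun x => fderiv ℝ f x a) z b = fderiv ℝ (fderiv ℝ f) z b a := by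
  have := (hf.hasFDerivAt.clm_apply (hasFDerivAt_const a z)).fderiv
  simp [this]

theorem eventually_contDiffAt {f : E → V} {z : E} {n : ℕ}
    (hf : ContDiffAt ℝ n f z) : ∀ᶠ x in 𝓝 z, ContDiffAt ℝ n f x :=
  hf.eventually (by simp)

/-- Differentiating the PDE `f_ab = u_b f_a + v_a f_b` in a further direction of `P`. -/
theorem hessian_eq_of_mixed_pde {f : E → V} {u v : E → ℝ} {P Q : Set E} {z : E}
    (hf : ContDiffAt ℝ 3 f z) (hu : ContDiffAt ℝ 2 u z) (hv : ContDiffAt ℝ 2 v z)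
    (hpde : ∀ᶠ x in 𝓝 z, ∀ a ∈ P, ∀ b ∈ Q, fderiv ℝ (fderiv ℝ f) x b a =
      fderiv ℝ u x b • fderiv ℝ f x a + fderiv ℝ v x a • fderiv ℝ f x b)
    {a a' b : E} (ha : a ∈ P) (ha' : a' ∈ P) (hb : b ∈ Q)
    (hli : LinearIndependent ℝ ![fderiv ℝ f z a, fderiv ℝ f z a']) :
    fderiv ℝ (fderiv ℝ u) z a' b = fderiv ℝ v z a' * fderiv ℝ u z b := by
  have h23 : (2 : WithTop ℕ∞) ≤ 3 := by norm_num
  have df := hf.differentiableAt_fderiv h23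
  have du := hu.differentiableAt_fderiv le_rfl
  have dv := hv.differentiableAt_fderiv le_rfl
  have hl : ContDiffAt ℝ 2 (fun x => fderiv ℝ f x b) z :=
    (hf.fderiv_right (m := 2) (by norm_num)).clm_apply contDiffAt_const
  have hev : ∀ᶠ x in 𝓝 z, ContDiffAt ℝ 3 f x := eventually_contDiffAt (n := 3) hf
  have key : ∀ c ∈ P, ∀ d ∈ P,
      fderiv ℝ (fderiv ℝ (fun x => fderiv ℝ f x b)) z d c =
        fderiv ℝ (fderiv ℝ u) z d b • fderiv ℝ f z c
          + fderiv ℝ u z b • fderiv ℝ (fderiv ℝ f) z d c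
          + fderiv ℝ (fderiv ℝ v) z d c • fderiv ℝ f z b
          + fderiv ℝ v z c • (fderiv ℝ u z b • fderiv ℝ f z d + fderiv ℝ v z d • fderiv ℝ f z b) := by
    intro c hc d hd
    have h1 : (fun x => fderiv ℝ (fun y => fderiv ℝ f y b) x c) =ᶠ[𝓝 z]
        fun x => fderiv ℝ u x b • fderiv ℝ f x c + fderiv ℝ v x c • fderiv ℝ f x b := by
      filter_upwards [hpde, hev] with x hx hfx
      rw [fderiv_fderiv_apply (hfx.differentiableAt_fderiv h23), hfx.fderiv_fderiv_comm h23, hx c hc b hb]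
    rw [← fderiv_fderiv_apply (hl.differentiableAt_fderiv le_rfl), h1.fderiv_eq]
    have e1 := (du.hasFDerivAt.clm_apply (hasFDerivAt_const b z)).smul
      (df.hasFDerivAt.clm_apply (hasFDerivAt_const c z))
    have e2 := (dv.hasFDerivAt.clm_apply (hasFDerivAt_const c z)).smul
      (df.hasFDerivAt.clm_apply (hasFDerivAt_const b z))
    have e3 := hpde.self_of_nhds d hd b hb
    rw [hf.fderiv_fderiv_comm h23] at e3
    have e4 := (e1.add e2).fderiv
    have e5 : fderiv ℝ (fun x => fderiv ℝ u x b • fderiv ℝ f x c + fderiv ℝ v x c • fderiv ℝ f x b) z d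
      = _ := congrArg (fun L : E →L[ℝ] V => L d) e4
    rw [e5]
    simp [e3]
    abel
  have hcomm := hl.fderiv_fderiv_comm le_rfl a a'
  rw [key a' ha' a ha, key a ha a' ha', hf.fderiv_fderiv_comm h23 a a',
    hv.fderiv_fderiv_comm le_rfl a a'] at hcomm
  -- The terms symmetric in a and a' cancel, including all multiples of f_b. What is left is a
  -- linear relation between f_a and f_a'.
  have h0 : (fderiv ℝ (fderiv ℝ u) z a' b - fderiv ℝ v z a' * fderiv ℝ u z b) • fderiv ℝ f z a +
      (-(fderiv ℝ (fderiv ℝ u) z a b - fderiv ℝ v z a * fderiv ℝ u z b)) • fderiv ℝ f z a' = 0 := by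
    rw [← sub_eq_zero] at hcomm
    rw [← neg_eq_zero, ← hcomm]
    module
  have := (LinearIndependent.pair_iff.1 hli _ _ h0).1
  linarith

/-- If `h_ab = u_b h_a + v_a h_b` and `ψ_b = u_b`, `ψ_a = v_a`, `v_ab = u_b v_a`, then `e^{-ψ} h`
has vanishing mixed second derivatives. -/
theorem mixed_hessian_exp_neg_smul {h : E → V} {u v ψ : E → ℝ} {z : E}
    (hh : ContDiffAt ℝ 2 h z) (hψ : ContDiffAt ℝ 2 ψ z) (hv : ContDiffAt ℝ 2 v z)
    {a b : E}
    (hpde : fderiv ℝ (fderiv ℝ h) z b a = fderiv ℝ u z b • fderiv ℝ h z a + fderiv ℝ v z a • fderiv ℝ h z b)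
    (hψa : ∀ᶠ x in 𝓝 z, fderiv ℝ ψ x a = fderiv ℝ v x a)
    (hψb : fderiv ℝ ψ z b = fderiv ℝ u z b)
    (hvab : fderiv ℝ (fderiv ℝ v) z b a = fderiv ℝ v z a * fderiv ℝ u z b) :
    fderiv ℝ (fderiv ℝ (fun x => Real.exp (-ψ x) • h x)) z b a = 0 := by
  have hF : ContDiffAt ℝ 2 (fun x => Real.exp (-ψ x) • h x) z := (hψ.neg.exp).smul hh
  rw [← fderiv_fderiv_apply (hF.differentiableAt_fderiv le_rfl)]
  have h1 : (fun x => fderiv ℝ (fun x => Real.exp (-ψ x) • h x) x a) =ᶠ[𝓝 z]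
      fun x => Real.exp (-ψ x) • (fderiv ℝ h x a - fderiv ℝ v x a • h x) := by
    filter_upwards [hψa, eventually_contDiffAt (n := 2) hh, eventually_contDiffAt (n := 2) hψ]
      with x hx h2 h3
    have := ((h3.differentiableAt_two le_rfl).hasFDerivAt.neg.exp.smul
      (h2.differentiableAt_two le_rfl).hasFDerivAt).fderiv
    have e := congrArg (fun L : E →L[ℝ] V => L a) this
    refine e.trans ?_
    simp [hx]
    module
  rw [h1.fderiv_eq]
  have e := (((hψ.differentiableAt_two le_rfl).hasFDerivAt.neg.exp.smul
    (((hh.differentiableAt_fderiv le_rfl).hasFDerivAt.clm_apply (hasFDerivAt_const a z)).sub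
    (((hv.differentiableAt_fderiv le_rfl).hasFDerivAt.clm_apply (hasFDerivAt_const a z)).smul
    (hh.differentiableAt_two le_rfl).hasFDerivAt)))).fderiv
  have e := congrArg (fun L : E →L[ℝ] V => L b) e
  refine e.trans ?_
  -- The equation for h cancels the first order terms, and v_ab = v_a u_b cancels the terms
  -- containing h itself.
  simp [hpde, hψb, hvab]
  module

theorem fderiv_fderiv_comp {F : Type*} [NormedAddCommGroup F] [NormedSpace ℝ F]
    {h : F → V} {τ : E → F} {z : E} (hh : ContDiffAt ℝ 2 h (τ z)) (hτ : ContDiffAt ℝ 2 τ z)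
    (a b : E) :
    fderiv ℝ (fderiv ℝ (h ∘ τ)) z a b = fderiv ℝ (fderiv ℝ h) (τ z) (fderiv ℝ τ z a) (fderiv ℝ τ z b)
      + fderiv ℝ h (τ z) (fderiv ℝ (fderiv ℝ τ) z a b) := by
  have h1 : fderiv ℝ (h ∘ τ) =ᶠ[𝓝 z] fun x => (fderiv ℝ h (τ x)).comp (fderiv ℝ τ x) := by
    filter_upwards [eventually_contDiffAt (n := 2) hτ,
      hτ.continuousAt.eventually (eventually_contDiffAt (n := 2) hh)] with x h2 h3
    exact fderiv_comp x (h3.differentiableAt_two le_rfl) (h2.differentiableAt_two le_rfl)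
  rw [h1.fderiv_eq]
  have e1 : HasFDerivAt (fun x => fderiv ℝ h (τ x)) _ z :=
    (hh.differentiableAt_fderiv le_rfl).hasFDerivAt.comp z (hτ.differentiableAt_two le_rfl).hasFDerivAt
  have e := (e1.clm_comp (hτ.differentiableAt_fderiv le_rfl).hasFDerivAt).fderiv
  rw [e]
  simp [add_comm]

variable {W : Type*} [NormedAddCommGroup W] [InnerProductSpace ℝ W]

theorem fderiv_inner_fderiv {f : E → W} {z : E} (hf : ContDiffAt ℝ 2 f z) (a b w : E) :
    fderiv ℝ (fun x => ⟪fderiv ℝ f x a, fderiv ℝ f x b⟫_ℝ) z w =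
      ⟪fderiv ℝ f z a, fderiv ℝ (fderiv ℝ f) z w b⟫_ℝ
        + ⟪fderiv ℝ (fderiv ℝ f) z w a, fderiv ℝ f z b⟫_ℝ := by
  have df := (hf.differentiableAt_fderiv le_rfl).hasFDerivAt
  have e := ((df.clm_apply (hasFDerivAt_const a z)).inner ℝ
    (df.clm_apply (hasFDerivAt_const b z))).fderiv
  rw [e]
  simp

/-- The mixed second derivatives of an immersion whose induced metric is twisted and whose second
fundamental form is adapted. -/
theorem mixed_hessian_eq {f : E → W} {u v : E → ℝ} {P Q : Submodule ℝ E} {z : E}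
    (hPQ : P ⊔ Q = ⊤) (hf : ContDiffAt ℝ 2 f z)
    (horth : ∀ᶠ x in 𝓝 z, ∀ a ∈ P, ∀ b ∈ Q, ⟪fderiv ℝ f x a, fderiv ℝ f x b⟫_ℝ = 0)
    (hP : ∀ a ∈ P, ∀ a' ∈ P, ∀ b ∈ Q, fderiv ℝ (fun x => ⟪fderiv ℝ f x a, fderiv ℝ f x a'⟫_ℝ) z b =
      2 * fderiv ℝ u z b * ⟪fderiv ℝ f z a, fderiv ℝ f z a'⟫_ℝ)
    (hQ : ∀ b ∈ Q, ∀ b' ∈ Q, ∀ a ∈ P, fderiv ℝ (fun x => ⟪fderiv ℝ f x b, fderiv ℝ f x b'⟫_ℝ) z a =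
      2 * fderiv ℝ v z a * ⟪fderiv ℝ f z b, fderiv ℝ f z b'⟫_ℝ)
    {a b : E} (ha : a ∈ P) (hb : b ∈ Q)
    (hran : fderiv ℝ (fderiv ℝ f) z b a ∈ LinearMap.range (fderiv ℝ f z).toLinearMap) :
    fderiv ℝ (fderiv ℝ f) z b a =
      fderiv ℝ u z b • fderiv ℝ f z a + fderiv ℝ v z a • fderiv ℝ f z b := by
  have hcomm := fun c d => hf.fderiv_fderiv_comm le_rfl c d
  have h0 : ∀ c ∈ P, ∀ d ∈ Q, ∀ w, ⟪fderiv ℝ f z c, fderiv ℝ (fderiv ℝ f) z w d⟫_ℝ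
        + ⟪fderiv ℝ (fderiv ℝ f) z w c, fderiv ℝ f z d⟫_ℝ = 0 := by
    intro c hc d hd w
    rw [← fderiv_inner_fderiv hf]
    have : (fun x => ⟪fderiv ℝ f x c, fderiv ℝ f x d⟫_ℝ) =ᶠ[𝓝 z] fun _ => 0 := by
      filter_upwards [horth] with x hx using hx c hc d hd
    rw [this.fderiv_eq]
    simp
  -- As in the Koszul formula: differentiating the orthogonality relation along P shows that both
  -- terms of ∂_b⟨f_a, f_a'⟩ equal -⟨f_aa', f_b⟩, so each of them is one half of the sum.
  have hP' : ∀ a' ∈ P, ⟪fderiv ℝ (fderiv ℝ f) z b a, fderiv ℝ f z a'⟫_ℝ =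
      fderiv ℝ u z b * ⟪fderiv ℝ f z a, fderiv ℝ f z a'⟫_ℝ := by
    intro a' ha'
    have e1 := hP a ha a' ha' b hb
    rw [fderiv_inner_fderiv hf] at e1
    have e2 := h0 a ha b hb a'
    have e3 := h0 a' ha' b hb a
    rw [hcomm a' a, hcomm a' b] at e2
    rw [hcomm a b] at e3
    rw [real_inner_comm (fderiv ℝ (fderiv ℝ f) z b a)] at e3
    linarith
  have hQ' : ∀ b' ∈ Q, ⟪fderiv ℝ (fderiv ℝ f) z b a, fderiv ℝ f z b'⟫_ℝ =
      fderiv ℝ v z a * ⟪fderiv ℝ f z b, fderiv ℝ f z b'⟫_ℝ := by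
    intro b' hb'
    have e1 := hQ b hb b' hb' a ha
    rw [fderiv_inner_fderiv hf] at e1
    have e2 := h0 a ha b hb b'
    have e3 := h0 a ha b' hb' b
    rw [hcomm b' b] at e2
    rw [hcomm a b', hcomm a b] at e1
    have e4 := real_inner_comm (fderiv ℝ f z b) (fderiv ℝ (fderiv ℝ f) z b' a)
    linarith
  rw [← sub_eq_zero]
  set T := fderiv ℝ (fderiv ℝ f) z b a -
    (fderiv ℝ u z b • fderiv ℝ f z a + fderiv ℝ v z a • fderiv ℝ f z b) with hT
  have hTr : T ∈ LinearMap.range (fderiv ℝ f z).toLinearMap :=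
    Submodule.sub_mem _ hran (Submodule.add_mem _ (Submodule.smul_mem _ _ ⟨a, rfl⟩)
      (Submodule.smul_mem _ _ ⟨b, rfl⟩))
  have horth0 := horth.self_of_nhds
  -- T lies in the image of the derivative of f and is orthogonal to that image, hence vanishes.
  have hperp : ∀ w, ⟪T, fderiv ℝ f z w⟫_ℝ = 0 := by
    intro w
    obtain ⟨c, hc, d, hd, rfl⟩ := Submodule.mem_sup.1 (hPQ ▸ Submodule.mem_top : w ∈ P ⊔ Q)
    have e1 := horth0 c hc b hb
    have e2 := horth0 a ha d hd
    rw [real_inner_comm] at e1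
    simp only [hT, map_add, inner_sub_left, inner_add_left, inner_add_right, real_inner_smul_left,
      hP' c hc, hQ' d hd, e1, e2]
    ring
  obtain ⟨w, hw⟩ := hTr
  have := hperp w
  rw [show fderiv ℝ f z w = T from hw] at this
  exact inner_self_eq_zero.1 this

end Calculus

/-! ### Reading functions and metrics in charts -/

section Charts

variable {E : Type*} [NormedAddCommGroup E] [NormedSpace ℝ E]
  {H : Type*} [TopologicalSpace H] {I : ModelWithCorners ℝ E H} [I.Boundaryless]
  {M : Type*} [TopologicalSpace M] [ChartedSpace H M] [IsManifold I ∞ M]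
  {V : Type*} [NormedAddCommGroup V] [NormedSpace ℝ V]

variable (I) in
/-- The derivative of the inverse of the preferred chart at `p`. -/
def chartSymmDeriv (p : M) (z : E) : E →L[ℝ] E :=
  mfderiv 𝓘(ℝ, E) I (extChartAt I p).symm z

variable (I) in
/-- The derivative of a vector valued function on `M`, as a linear map on the model space. -/
def vectorDeriv (h : M → V) (p : M) : E →L[ℝ] V := mfderiv I 𝓘(ℝ, V) h p

variable (I) in
/-- The derivative of the preferred chart at `p`, at the point with coordinates `z`. -/
def chartDeriv (p : M) (z : E) : E →L[ℝ] E :=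
  mfderiv I 𝓘(ℝ, E) (extChartAt I p) ((extChartAt I p).symm z)

/-- The scalar product `g_p` as a bilinear form on the model space. -/
def metricAt (g : SmoothMetric I M) (p : M) : E →L[ℝ] E →L[ℝ] ℝ := g.inner p

theorem two_le_infty : (2 : WithTop ℕ∞) ≤ ∞ := WithTop.coe_le_coe.2 le_top

theorem three_le_infty : (3 : WithTop ℕ∞) ≤ ∞ := WithTop.coe_le_coe.2 le_top

omit [IsManifold I ∞ M] in
theorem extChartAt_target_mem_nhds_of_mem {p : M} {z : E} (hz : z ∈ (extChartAt I p).target) :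
    (extChartAt I p).target ∈ 𝓝 z :=
  (isOpen_extChartAt_target p).mem_nhds hz

theorem contMDiffAt_extChartAt_symm {p : M} {z : E} (hz : z ∈ (extChartAt I p).target) :
    ContMDiffAt 𝓘(ℝ, E) I ∞ (extChartAt I p).symm z :=
  (contMDiffOn_extChartAt_symm p).contMDiffAt (extChartAt_target_mem_nhds_of_mem hz)

theorem ContMDiff.contDiffAt_chart {h : M → V} (hh : ContMDiff I 𝓘(ℝ, V) ∞ h) {p : M} {z : E}
    (hz : z ∈ (extChartAt I p).target) : ContDiffAt ℝ ∞ (h ∘ (extChartAt I p).symm) z :=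
  (hh.contMDiffAt.comp z (contMDiffAt_extChartAt_symm hz)).contDiffAt

theorem fderiv_chart {h : M → V} (hh : ContMDiff I 𝓘(ℝ, V) ∞ h) {p : M} {z : E}
    (hz : z ∈ (extChartAt I p).target) (w : E) :
    fderiv ℝ (h ∘ (extChartAt I p).symm) z w =
      vectorDeriv I h ((extChartAt I p).symm z) (chartSymmDeriv I p z w) := by
  rw [← mfderiv_eq_fderiv, mfderiv_comp z (hh.mdifferentiableAt (by simp))
    ((contMDiffAt_extChartAt_symm hz).mdifferentiableAt (by simp))]
  rfl

theorem chartSymmDeriv_self (p : M) (w : E) : chartSymmDeriv I p (extChartAt I p p) w = w := by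
  have : IsManifold I 1 M := .of_le (n := ∞) (by simp)
  have := mfderivWithin_range_extChartAt_symm (I := I) (x := p)
  rw [I.range_eq_univ, mfderivWithin_univ] at this
  exact congrArg (fun L : E →L[ℝ] E => L w) this

omit [IsManifold I ∞ M] in
theorem vectorDeriv_eq_fderiv {h : M → V} (hh : ContMDiff I 𝓘(ℝ, V) ∞ h) (p : M) (w : E) :
    vectorDeriv I h p w =
      fderiv ℝ (h ∘ (extChartAt I p).symm) (extChartAt I p p) w := by
  have hd : MDifferentiableAt I 𝓘(ℝ, V) h p := hh.mdifferentiableAt (by simp)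
  simp only [vectorDeriv, mfderiv, hd, I.range_eq_univ, fderivWithin_univ]
  rfl

theorem chartDeriv_chartSymmDeriv {p : M} {z : E} (hz : z ∈ (extChartAt I p).target)
    (w : E) : chartDeriv I p z
    (chartSymmDeriv I p z w) = w := by
  have : IsManifold I 1 M := .of_le (n := ∞) (by simp)
  have := mfderiv_extChartAt_comp_mfderivWithin_extChartAt_symm (I := I) hz
  rw [I.range_eq_univ, mfderivWithin_univ] at this
  exact congrArg (fun L : E →L[ℝ] E => L w) this

theorem chartSymmDeriv_chartDeriv {p : M} {z : E} (hz : z ∈ (extChartAt I p).target)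
    (w : E) : chartSymmDeriv I p z
      (chartDeriv I p z w) = w := by
  have : IsManifold I 1 M := .of_le (n := ∞) (by simp)
  have := mfderivWithin_extChartAt_symm_comp_mfderiv_extChartAt (I := I) hz
  rw [I.range_eq_univ, mfderivWithin_univ] at this
  exact congrArg (fun L : E →L[ℝ] E => L w) this

/-- Second derivatives in two charts differ by the change of basis, up to tangent vectors. -/
theorem hessian_chart_change {h : M → V} (hh : ContMDiff I 𝓘(ℝ, V) ∞ h) {p : M} {z : E}
    (hz : z ∈ (extChartAt I p).target) (a b : E) :
    ∃ w : E, fderiv ℝ (fderiv ℝ (h ∘ (extChartAt I p).symm)) z a b =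
      fderiv ℝ (fderiv ℝ (h ∘ (extChartAt I ((extChartAt I p).symm z)).symm))
        (extChartAt I ((extChartAt I p).symm z) ((extChartAt I p).symm z))
        (chartSymmDeriv I p z a) (chartSymmDeriv I p z b)
      + vectorDeriv I h ((extChartAt I p).symm z) w := by
  have : IsManifold I 1 M := .of_le (n := ∞) (by simp)
  set q := (extChartAt I p).symm z with hq
  set τ : E → E := extChartAt I q ∘ (extChartAt I p).symm with hτdef
  have hτz : τ z = extChartAt I q q := rfl
  have hqc : ContMDiffAt I 𝓘(ℝ, E) ∞ (extChartAt I q) q := contMDiffAt_extChartAt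
  have hτ : ContDiffAt ℝ ∞ τ z :=
    (ContMDiffAt.comp z (hq ▸ hqc) (contMDiffAt_extChartAt_symm hz)).contDiffAt
  have hcomp : (h ∘ (extChartAt I p).symm) =ᶠ[𝓝 z] (h ∘ (extChartAt I q).symm) ∘ τ := by
    have : (extChartAt I p).symm ⁻¹' (extChartAt I q).source ∈ 𝓝 z :=
      (contMDiffAt_extChartAt_symm hz).continuousAt.preimage_mem_nhds
        (extChartAt_source_mem_nhds q)
    filter_upwards [this] with x hx
    simp only [hτdef, Function.comp_apply, (extChartAt I q).left_inv hx]
  have hτ' : ∀ w, fderiv ℝ τ z w = chartSymmDeriv I p z w := by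
    intro w
    rw [← mfderiv_eq_fderiv, mfderiv_comp z (hqc.mdifferentiableAt (by simp))
      ((contMDiffAt_extChartAt_symm hz).mdifferentiableAt (by simp))]
    have := mfderiv_extChartAt_self (I := I) (x := q)
    exact congrArg (fun L : E →L[ℝ] E => L (chartSymmDeriv I p z w)) this
  have hh' : ContDiffAt ℝ ∞ (h ∘ (extChartAt I q).symm) (τ z) :=
    hh.contDiffAt_chart (mem_extChartAt_target q)
  refine ⟨fderiv ℝ (fderiv ℝ τ) z a b, ?_⟩
  rw [hcomp.fderiv.fderiv_eq, fderiv_fderiv_comp (hh'.of_le two_le_infty) (hτ.of_le two_le_infty), hτ', hτ',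
    vectorDeriv_eq_fderiv hh, hτz]

/-- Lets derivatives of metric coefficients be computed, and shown to exist, from the derivatives of
f. -/
theorem coordMetric_eq_inner {N : ℕ} {g : SmoothMetric I M} {f : M → EuclideanSpace ℝ (Fin N)}
    (hf : IsIsometricImmersion (euclid N) g f) {p : M} {z : E} (hz : z ∈ (extChartAt I p).target)
    (a b : E) : coordMetric g p z a b = ⟪fderiv ℝ (f ∘ (extChartAt I p).symm) z a,
      fderiv ℝ (f ∘ (extChartAt I p).symm) z b⟫_ℝ := by
  rw [fderiv_chart hf.1 hz, fderiv_chart hf.1 hz]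
  exact (hf.2 ((extChartAt I p).symm z) (chartSymmDeriv I p z a) (chartSymmDeriv I p z b)).symm

omit [I.Boundaryless] in
theorem IsIsometricImmersion.vectorDeriv_form {B : V → V → ℝ} {g : SmoothMetric I M}
    {f : M → V} (hf : IsIsometricImmersion B g f) (p : M) (a b : E) :
    B (vectorDeriv I f p a) (vectorDeriv I f p b) = metricAt g p a b := hf.2 p a b

omit [I.Boundaryless] in
theorem metricAt_pos (g : SmoothMetric I M) (p : M) {a : E} (ha : a ≠ 0) : 0 < metricAt g p a a :=
  g.pos p a ha

omit [I.Boundaryless] in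
theorem metricAt_symm (g : SmoothMetric I M) (p : M) (a b : E) :
    metricAt g p a b = metricAt g p b a :=
  g.symm p a b

omit [I.Boundaryless] in
theorem IsIsometricImmersion.eq_zero_of_vectorDeriv {N : ℕ} {g : SmoothMetric I M}
    {f : M → EuclideanSpace ℝ (Fin N)}
    (hf : IsIsometricImmersion (euclid N) g f) (p : M) {a : E}
    (ha : vectorDeriv I f p a = 0) : a = 0 := by
  by_contra h
  have h1 := metricAt_pos g p h
  rw [← hf.vectorDeriv_form p a a, ha] at h1
  simp [euclid] at h1

omit [I.Boundaryless] in
theorem coordMetric_eq (g : SmoothMetric I M) (p : M) (z a b : E) : coordMetric g p z a b =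
    metricAt g ((extChartAt I p).symm z) (chartSymmDeriv I p z a) (chartSymmDeriv I p z b) := rfl

theorem coordMetric_self (g : SmoothMetric I M) (p : M) (a b : E) :
    coordMetric g p (extChartAt I p p) a b = metricAt g p a b := by
  rw [coordMetric_eq, chartSymmDeriv_self, chartSymmDeriv_self, extChartAt_to_inv]

end Charts

/-! ### Twisted nets -/

section Nets

variable {E : Type*} [NormedAddCommGroup E] [NormedSpace ℝ E]
  {H : Type*} [TopologicalSpace H] {I : ModelWithCorners ℝ E H}
  {M : Type*} [TopologicalSpace M] [ChartedSpace H M] [IsManifold I ∞ M]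

/-- A pair of complementary subspaces of the model space that is preserved by the preferred charts
and that is, with respect to `g`, orthogonal and twisted with logarithmic twisting functions
`u`, `v`. -/
structure IsTwistedNet (g : SmoothMetric I M) (P Q : Submodule ℝ E) (u v : M → ℝ) : Prop where
  sup_eq : P ⊔ Q = ⊤
  smooth_fst : ContMDiff I 𝓘(ℝ, ℝ) ∞ u
  smooth_snd : ContMDiff I 𝓘(ℝ, ℝ) ∞ v
  chart_fst : ∀ p : M, ∀ z ∈ (extChartAt I p).target, ∀ a ∈ P, chartSymmDeriv I p z a ∈ P
  chart_snd : ∀ p : M, ∀ z ∈ (extChartAt I p).target, ∀ b ∈ Q, chartSymmDeriv I p z b ∈ Q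
  orth : ∀ p : M, ∀ a ∈ P, ∀ b ∈ Q, metricAt g p a b = 0
  deriv_fst : ∀ p : M, ∀ z ∈ (extChartAt I p).target, ∀ a ∈ P, ∀ a' ∈ P, ∀ b ∈ Q,
    fderiv ℝ (fun x => coordMetric g p x a a') z b =
      2 * fderiv ℝ (u ∘ (extChartAt I p).symm) z b * coordMetric g p z a a'
  deriv_snd : ∀ p : M, ∀ z ∈ (extChartAt I p).target, ∀ b ∈ Q, ∀ b' ∈ Q, ∀ a ∈ P,
    fderiv ℝ (fun x => coordMetric g p x b b') z a =
      2 * fderiv ℝ (v ∘ (extChartAt I p).symm) z a * coordMetric g p z b b'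

variable {g : SmoothMetric I M} {P Q : Submodule ℝ E} {u v : M → ℝ}

theorem IsTwistedNet.symm (h : IsTwistedNet g P Q u v) : IsTwistedNet g Q P v u where
  sup_eq := by rw [sup_comm, h.sup_eq]
  smooth_fst := h.smooth_snd
  smooth_snd := h.smooth_fst
  chart_fst := h.chart_snd
  chart_snd := h.chart_fst
  orth p a ha b hb := by rw [metricAt_symm, h.orth p b hb a ha]
  deriv_fst := h.deriv_snd
  deriv_snd := h.deriv_fst

theorem IsTwistedNet.coordMetric_eq_zero (h : IsTwistedNet g P Q u v) {p : M} {z : E}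
    (hz : z ∈ (extChartAt I p).target) {a b : E} (ha : a ∈ P) (hb : b ∈ Q) :
    coordMetric g p z a b = 0 :=
  h.orth _ _ (h.chart_fst p z hz a ha) _ (h.chart_snd p z hz b hb)

/-- Take the normal vector ξ = α(a, b) itself. Then |ξ|² = ⟨A_ξ a, b⟩ vanishes because A_ξ a stays
in P, which is orthogonal to b. So the second derivative has no normal component. -/
theorem IsShapeInvariant.hessian_mem {N : ℕ} {f : M → EuclideanSpace ℝ (Fin N)}
    {D : ∀ p : M, Submodule ℝ (TangentSpace I p)} (hD : ∀ p (a : E), a ∈ D p ↔ a ∈ P)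
    (h : IsShapeInvariant g f D) (horth : ∀ p, ∀ a ∈ P, ∀ b ∈ Q, metricAt g p a b = 0)
    (p : M) {a b : E} (ha : a ∈ P) (hb : b ∈ Q) :
    coordHessian I f p a b ∈ LinearMap.range (vectorDeriv I f p).toLinearMap := by
  have key : (tangentImage I f p)ᗮ.starProjection (coordHessian I f p a b) = 0 := by
    set x := (tangentImage I f p)ᗮ.starProjection (coordHessian I f p a b) with hx
    have hmem : x ∈ (tangentImage I f p)ᗮ := Submodule.starProjection_apply_mem _ _
    obtain ⟨A, hA, hinv⟩ := h p x hmem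
    have h1 := hA a b
    have h2 : metricAt g p (A a) b = 0 := horth p _ ((hD p _).1 (hinv a ((hD p a).2 ha))) b hb
    have h3 : ⟪x, x⟫_ℝ = 0 := h1.symm.trans h2
    exact inner_self_eq_zero.1 h3
  have h2 := (Submodule.starProjection_apply_eq_zero_iff _).1 key
  rw [Submodule.orthogonal_orthogonal] at h2
  exact h2

variable [I.Boundaryless]

theorem IsTwistedNet.hessian_eq (h : IsTwistedNet g P Q u v) {N : ℕ}
    {f : M → EuclideanSpace ℝ (Fin N)} (hf : IsIsometricImmersion (euclid N) g f)
    (hadapt : ∀ p, ∀ a ∈ P, ∀ b ∈ Q,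
      coordHessian I f p a b ∈ LinearMap.range (vectorDeriv I f p).toLinearMap)
    {p : M} {z : E} (hz : z ∈ (extChartAt I p).target) {a b : E} (ha : a ∈ P) (hb : b ∈ Q) :
    fderiv ℝ (fderiv ℝ (f ∘ (extChartAt I p).symm)) z b a =
      fderiv ℝ (u ∘ (extChartAt I p).symm) z b • fderiv ℝ (f ∘ (extChartAt I p).symm) z a
      + fderiv ℝ (v ∘ (extChartAt I p).symm) z a • fderiv ℝ (f ∘ (extChartAt I p).symm) z b := by
  have hnhds := extChartAt_target_mem_nhds_of_mem hz
  have hmet : ∀ c d, (fun x => ⟪fderiv ℝ (f ∘ (extChartAt I p).symm) x c,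
      fderiv ℝ (f ∘ (extChartAt I p).symm) x d⟫_ℝ) =ᶠ[𝓝 z] fun x => coordMetric g p x c d := by
    intro c d
    filter_upwards [hnhds] with x hx using (coordMetric_eq_inner hf hx c d).symm
  have hfd := (hf.1.contDiffAt_chart hz).of_le two_le_infty
  refine mixed_hessian_eq h.sup_eq hfd ?_ ?_ ?_ ha hb ?_
  · filter_upwards [hnhds] with x hx c hc d hd
    rw [← coordMetric_eq_inner hf hx, h.coordMetric_eq_zero hx hc hd]
  · intro c hc d hd e he
    rw [(hmet c d).fderiv_eq, h.deriv_fst p z hz c hc d hd e he, coordMetric_eq_inner hf hz]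
  · intro c hc d hd e he
    rw [(hmet c d).fderiv_eq, h.deriv_snd p z hz c hc d hd e he, coordMetric_eq_inner hf hz]
  · rw [hfd.fderiv_fderiv_comm le_rfl]
    -- Adaptedness is formulated at the centre of each preferred chart, so at another point z the
    -- second derivative is first rewritten in the chart centred there. The correction term is
    -- tangent and therefore harmless.
    obtain ⟨w, hw⟩ := hessian_chart_change hf.1 hz a b
    rw [hw]
    have hrange : ∀ y, vectorDeriv I f ((extChartAt I p).symm z) y ∈
        LinearMap.range (fderiv ℝ (f ∘ (extChartAt I p).symm) z).toLinearMap := fun y => by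
      refine ⟨chartDeriv I p z y, ?_⟩
      rw [ContinuousLinearMap.coe_coe, fderiv_chart hf.1 hz, chartSymmDeriv_chartDeriv hz]
    refine Submodule.add_mem _ ?_ (hrange w)
    obtain ⟨y, hy⟩ := hadapt ((extChartAt I p).symm z) _ (h.chart_fst p z hz a ha) _
      (h.chart_snd p z hz b hb)
    have := hrange y
    rw [show vectorDeriv I f _ y = _ from hy] at this
    exact this

/-- Codazzi equation: the leaves tangent to `P` are spherical if `P` has dimension at least two. -/
theorem IsTwistedNet.hessian_log_of_codazzi (h : IsTwistedNet g P Q u v) {N : ℕ}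
    {f : M → EuclideanSpace ℝ (Fin N)} (hf : IsIsometricImmersion (euclid N) g f)
    (hadapt : ∀ p, ∀ a ∈ P, ∀ b ∈ Q,
      coordHessian I f p a b ∈ LinearMap.range (vectorDeriv I f p).toLinearMap)
    (hdim : ∀ a ∈ P, a ≠ 0 → ∃ a' ∈ P, LinearIndependent ℝ ![a', a])
    (p : M) {a b : E} (ha : a ∈ P) (hb : b ∈ Q) :
    fderiv ℝ (fderiv ℝ (u ∘ (extChartAt I p).symm)) (extChartAt I p p) a b =
      fderiv ℝ (v ∘ (extChartAt I p).symm) (extChartAt I p p) a *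
        fderiv ℝ (u ∘ (extChartAt I p).symm) (extChartAt I p p) b := by
  have hz := mem_extChartAt_target (I := I) p
  rcases eq_or_ne a 0 with rfl | hne
  · simp
  obtain ⟨a', ha', hli⟩ := hdim a ha hne
  refine hessian_eq_of_mixed_pde (P := P) (Q := Q) (f := f ∘ (extChartAt I p).symm) (a := a')
    ((hf.1.contDiffAt_chart hz).of_le three_le_infty)
    ((h.smooth_fst.contDiffAt_chart hz).of_le two_le_infty)
    ((h.smooth_snd.contDiffAt_chart hz).of_le two_le_infty) ?_ ha' ha hb ?_
  · filter_upwards [extChartAt_target_mem_nhds_of_mem hz] with x hx c hc d hd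
    exact h.hessian_eq hf hadapt hx hc hd
  · rw [LinearIndependent.pair_iff] at hli ⊢
    intro s t hst
    refine hli s t (hf.eq_zero_of_vectorDeriv p ?_)
    rw [vectorDeriv_eq_fderiv hf.1, map_add, map_smul, map_smul, hst]

omit [IsManifold I ∞ M] [I.Boundaryless] in
theorem coordField_eq {Y : ∀ q : M, TangentSpace I q} {p : M} {z : E} :
    coordField Y p z = chartDeriv I p z
      (Y ((extChartAt I p).symm z)) := rfl

/-- Near p the derivative of the chart at p is the trivialization of the tangent bundle at p. -/
theorem ContMDiffAt.coordField {Y : ∀ q : M, TangentSpace I q} {p : M}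
    (hY : ContMDiffAt I I.tangent ∞ (fun q => (⟨q, Y q⟩ : TangentBundle I M)) p) :
    ContDiffAt ℝ ∞ (coordField Y p) (extChartAt I p p) := by
  have : IsManifold I 1 M := .of_le (n := ∞) (by simp)
  have h1 := (contMDiffAt_section (F := E) (E := TangentSpace I) (n := ∞) (s := Y) p).1 hY
  have h2 : ContMDiffAt 𝓘(ℝ, E) 𝓘(ℝ, E) ∞ (fun z =>
      (trivializationAt E (TangentSpace I) p ⟨(extChartAt I p).symm z,
        Y ((extChartAt I p).symm z)⟩).2) (extChartAt I p p) := by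
    refine ContMDiffAt.comp _ (g := fun q => (trivializationAt E (TangentSpace I) p ⟨q, Y q⟩).2)
      ?_ (contMDiffAt_extChartAt_symm (mem_extChartAt_target p))
    rw [extChartAt_to_inv]
    exact h1
  refine h2.contDiffAt.congr_of_eventuallyEq ?_
  filter_upwards [extChartAt_target_mem_nhds (I := I) p] with z hz
  have hs : (extChartAt I p).symm z ∈ (chartAt H p).source := by
    rw [← extChartAt_source (I := I)]
    exact (extChartAt I p).map_target hz
  rw [coordField_eq]
  have e := congrArg (fun L => L (Y ((extChartAt I p).symm z)))
    (TangentBundle.continuousLinearMapAt_trivializationAt (I := I) hs)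
  rw [Trivialization.continuousLinearMapAt_apply, Trivialization.coe_linearMapAt_of_mem _ (by simpa using hs)] at e
  exact e.symm

/-- The value of the mean curvature normal on the complementary subbundle. -/
theorem IsTwistedNet.meanCurvature_eq (h : IsTwistedNet g P Q u v)
    {D : ∀ p : M, Submodule ℝ (TangentSpace I p)} (hD : ∀ p (a : E), a ∈ D p ↔ a ∈ P)
    {η : ∀ p : M, TangentSpace I p}
    (hη : ∀ (p : M) (Y : ∀ q : M, TangentSpace I q),
      ContMDiffAt I I.tangent ∞ (fun q => (⟨q, Y q⟩ : TangentBundle I M)) p →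
      (∀ᶠ q in nhds p, Y q ∈ D q) →
      ∀ X ∈ D p, ∀ Z : TangentSpace I p, (∀ W ∈ D p, g.inner p Z W = 0) →
        leviCivita g Y p X Z = g.inner p X (Y p) * g.inner p (η p) Z)
    {a : E} (ha : a ∈ P) (ha0 : a ≠ 0) (p : M) {b : E} (hb : b ∈ Q) :
    metricAt g p (η p) b = - vectorDeriv I u p b := by
  have hz := mem_extChartAt_target (I := I) p
  have hnhds := extChartAt_target_mem_nhds_of_mem hz
  -- The coordinate field with value a. Its coordinate expression is constant, so ⟨∇_a Y, b⟩ reduces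
  -- to the Christoffel symbol -½ ∂_b g(a, a) = -u_b g(a, a).
  set Y : ∀ q : M, TangentSpace I q := fun q => chartSymmDeriv I p (extChartAt I p q) a with hY
  have hYp : Y p = a := chartSymmDeriv_self p a
  have hYs : ContMDiffAt I I.tangent ∞ (fun q => (⟨q, Y q⟩ : TangentBundle I M)) p := by
    have : IsManifold I 1 M := .of_le (n := ∞) (by simp)
    refine (contMDiffAt_section (F := E) (E := TangentSpace I) (n := ∞) (s := Y) p).2 ?_
    refine (contMDiffAt_const (c := a)).congr_of_eventuallyEq ?_
    filter_upwards [extChartAt_source_mem_nhds (I := I) p] with q hq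
    have hs : q ∈ (chartAt H p).source := by rwa [← extChartAt_source (I := I)]
    have e := congrArg (fun L => L (Y q))
      (TangentBundle.continuousLinearMapAt_trivializationAt (I := I) hs)
    rw [Trivialization.continuousLinearMapAt_apply,
      Trivialization.coe_linearMapAt_of_mem _ (by simpa using hs)] at e
    refine e.trans ?_
    have e2 := chartDeriv_chartSymmDeriv (I := I) ((extChartAt I p).map_source hq) a
    unfold chartDeriv at e2
    rw [(extChartAt I p).left_inv hq] at e2
    exact e2
  have hYD : ∀ᶠ q in 𝓝 p, Y q ∈ D q := by
    filter_upwards [extChartAt_source_mem_nhds (I := I) p] with q hq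
    exact (hD q _).2 (h.chart_fst p _ ((extChartAt I p).map_source hq) a ha)
  have hYc : coordField Y p =ᶠ[𝓝 (extChartAt I p p)] fun _ => a := by
    filter_upwards [hnhds] with z hz
    rw [coordField_eq, hY]
    simp only [(extChartAt I p).right_inv hz]
    exact chartDeriv_chartSymmDeriv hz a
  have key : metricAt g p (fderiv ℝ (coordField Y p) (extChartAt I p p) a) b
      + christoffel g p a (Y p) b = metricAt g p a (Y p) * metricAt g p (η p) b :=
    hη p Y hYs hYD a ((hD p a).2 ha) b fun W hW => h.symm.orth p b hb W ((hD p W).1 hW)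
  have hzero : (fun x => coordMetric g p x a b) =ᶠ[𝓝 (extChartAt I p p)] fun _ => 0 := by
    filter_upwards [hnhds] with z hz using h.coordMetric_eq_zero hz ha hb
  rw [hYc.fderiv_eq, hYp, christoffel, hzero.fderiv_eq, h.deriv_fst p _ hz a ha a ha b hb,
    coordMetric_self, ← vectorDeriv_eq_fderiv h.smooth_fst] at key
  have hpos := metricAt_pos g p ha0
  simp only [fderiv_fun_const, Pi.zero_apply, zero_apply, map_zero] at key
  refine mul_left_cancel₀ hpos.ne' ?_
  linarith

/-- Differentiate ⟨η, b⟩ = -u_b along a. Since the normal part of ∇_a η vanishes, the left side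
becomes ⟨η, ∇_a b⟩, which equals v_a ⟨η, b⟩ = -v_a u_b because η lies in Q and the metric on Q has
logarithmic derivative 2 v_a along P. -/
theorem IsTwistedNet.hessian_log_of_meanCurvature (h : IsTwistedNet g P Q u v) {N : ℕ}
    {f : M → EuclideanSpace ℝ (Fin N)} (hf : IsIsometricImmersion (euclid N) g f)
    {η : M → E} (p : M) {a b : E} (ha : a ∈ P) (hb : b ∈ Q)
    (hdη : DifferentiableAt ℝ (coordField (I := I) η p) (extChartAt I p p))
    (hηD : ∀ c ∈ P, metricAt g p (η p) c = 0)
    (hmean : ∀ q, ∀ c ∈ Q, metricAt g q (η q) c = - vectorDeriv I u q c)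
    (key : metricAt g p (fderiv ℝ (coordField (I := I) η p) (extChartAt I p p) a) b
      + christoffel g p a (η p) b = 0) :
    fderiv ℝ (fderiv ℝ (u ∘ (extChartAt I p).symm)) (extChartAt I p p) a b =
      fderiv ℝ (v ∘ (extChartAt I p).symm) (extChartAt I p p) a *
        fderiv ℝ (u ∘ (extChartAt I p).symm) (extChartAt I p p) b := by
  have hz := mem_extChartAt_target (I := I) p
  have hnhds := extChartAt_target_mem_nhds_of_mem hz
  have hcoord : ∀ z, coordField (I := I) η p z = chartDeriv I p z (η ((extChartAt I p).symm z)) :=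
    fun _ => rfl
  -- The P-component of η is orthogonal to itself, hence zero.
  have hηQ : η p ∈ Q := by
    obtain ⟨c, hc, d, hd, hcd⟩ := Submodule.mem_sup.1
      (h.sup_eq ▸ Submodule.mem_top : η p ∈ P ⊔ Q)
    have e1 := hηD c hc
    rw [← hcd, map_add, _root_.add_apply, metricAt_symm g p d c, h.orth p c hc d hd,
      add_zero] at e1
    have : c = 0 := by
      by_contra hne
      exact (metricAt_pos g p hne).ne' e1
    rw [this, zero_add] at hcd
    exact hcd ▸ hd
  have hη0 : coordField (I := I) η p (extChartAt I p p) = η p := by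
    rw [← chartSymmDeriv_self (I := I) p (coordField (I := I) η p (extChartAt I p p)), hcoord,
      chartSymmDeriv_chartDeriv hz, extChartAt_to_inv]
  have hzero : ∀ c ∈ P, ∀ d ∈ Q,
      (fun x => coordMetric g p x c d) =ᶠ[𝓝 (extChartAt I p p)] fun _ => 0 := by
    intro c hc d hd
    filter_upwards [hnhds] with z hz using h.coordMetric_eq_zero hz hc hd
  set F := f ∘ (extChartAt I p).symm with hF
  have hFd : ContDiffAt ℝ 2 F (extChartAt I p p) :=
    (hf.1.contDiffAt_chart hz).of_le two_le_infty
  have hud : ContDiffAt ℝ 2 (u ∘ (extChartAt I p).symm) (extChartAt I p p) :=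
    (h.smooth_fst.contDiffAt_chart hz).of_le two_le_infty
  have hrel : (fun z => ⟪fderiv ℝ F z (coordField (I := I) η p z), fderiv ℝ F z b⟫_ℝ)
      =ᶠ[𝓝 (extChartAt I p p)] fun z => - fderiv ℝ (u ∘ (extChartAt I p).symm) z b := by
    filter_upwards [hnhds] with z hz
    rw [← coordMetric_eq_inner hf hz, coordMetric_eq, hcoord, chartSymmDeriv_chartDeriv hz,
      hmean _ _ (h.chart_snd p z hz b hb), fderiv_chart h.smooth_fst hz]
  have hd := congrArg (fun L : E →L[ℝ] ℝ => L a) hrel.fderiv_eq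
  have dF := (hFd.differentiableAt_fderiv le_rfl).hasFDerivAt
  rw [((dF.clm_apply hdη.hasFDerivAt).inner ℝ (dF.clm_apply (hasFDerivAt_const b _))).fderiv,
    fderiv_fun_neg] at hd
  have hd' : ⟪fderiv ℝ F (extChartAt I p p) (η p),
        fderiv ℝ (fderiv ℝ F) (extChartAt I p p) a b⟫_ℝ
      + ⟪fderiv ℝ (fderiv ℝ F) (extChartAt I p p) a (η p), fderiv ℝ F (extChartAt I p p) b⟫_ℝ
      + metricAt g p (fderiv ℝ (coordField (I := I) η p) (extChartAt I p p) a) b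
      = - fderiv ℝ (fderiv ℝ (u ∘ (extChartAt I p).symm)) (extChartAt I p p) a b := by
    rw [← coordMetric_self, coordMetric_eq_inner hf hz, ← hF,
      ← fderiv_fderiv_apply (hud.differentiableAt_fderiv le_rfl)]
    rw [← hη0]
    simpa [inner_add_left, add_assoc, add_comm, add_left_comm] using hd
  rw [← fderiv_inner_fderiv hFd] at hd'
  have hmet : (fun x => ⟪fderiv ℝ F x (η p), fderiv ℝ F x b⟫_ℝ)
      =ᶠ[𝓝 (extChartAt I p p)] fun x => coordMetric g p x (η p) b := by
    filter_upwards [hnhds] with x hx using (coordMetric_eq_inner hf hx _ _).symm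
  rw [hmet.fderiv_eq, h.deriv_snd p _ hz _ hηQ _ hb _ ha, coordMetric_self, hmean p b hb,
    vectorDeriv_eq_fderiv h.smooth_fst] at hd'
  rw [christoffel, (hzero a ha _ hηQ).fderiv_eq, (hzero a ha b hb).fderiv_eq,
    h.deriv_snd p _ hz _ hηQ _ hb _ ha, coordMetric_self, hmean p b hb,
    vectorDeriv_eq_fderiv h.smooth_fst] at key
  simp only [fderiv_fun_const, Pi.zero_apply, zero_apply] at key
  linarith

/-- The leaves tangent to `P` are spherical, in terms of the twisting functions. -/
theorem IsTwistedNet.hessian_log_of_isSpherical (h : IsTwistedNet g P Q u v) {N : ℕ}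
    {f : M → EuclideanSpace ℝ (Fin N)} (hf : IsIsometricImmersion (euclid N) g f)
    {D : ∀ p : M, Submodule ℝ (TangentSpace I p)} (hD : ∀ p (a : E), a ∈ D p ↔ a ∈ P)
    (hsph : IsSpherical g D) (p : M) {a b : E} (ha : a ∈ P) (hb : b ∈ Q) :
    fderiv ℝ (fderiv ℝ (u ∘ (extChartAt I p).symm)) (extChartAt I p p) a b =
      fderiv ℝ (v ∘ (extChartAt I p).symm) (extChartAt I p p) a *
        fderiv ℝ (u ∘ (extChartAt I p).symm) (extChartAt I p p) b := by
  rcases eq_or_ne a 0 with rfl | hne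
  · simp
  obtain ⟨η, hηs, hηD, hη, hpar⟩ := hsph
  exact h.hessian_log_of_meanCurvature hf (η := η) p ha hb
    (((hηs p).coordField).differentiableAt (by simp))
    (fun c hc => hηD p c ((hD p c).2 hc))
    (fun q c hc => h.meanCurvature_eq hD hη ha hne q hc)
    (hpar p a ((hD p a).2 ha) b fun W hW => h.symm.orth p b hb W ((hD p W).1 hW))

end Nets

/-! ### Functions on products -/

section Constant

variable {E : Type*} [NormedAddCommGroup E] [NormedSpace ℝ E]
  {H : Type*} [TopologicalSpace H] {I : ModelWithCorners ℝ E H} [I.Boundaryless]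
  {M : Type*} [TopologicalSpace M] [ChartedSpace H M] [IsManifold I ∞ M]
  {V : Type*} [NormedAddCommGroup V] [NormedSpace ℝ V]

theorem eq_of_hasMFDerivAt_zero [PreconnectedSpace M] {k : M → V}
    (hk : ∀ y, HasMFDerivAt I 𝓘(ℝ, V) k y 0) (y y' : M) : k y = k y' := by
  have hloc : IsLocallyConstant k := by
    rw [IsLocallyConstant.iff_eventually_eq]
    intro p
    obtain ⟨ε, hε, hball⟩ := Metric.mem_nhds_iff.1 (extChartAt_target_mem_nhds (I := I) p)
    have hd : ∀ z ∈ (extChartAt I p).target,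
        HasFDerivAt (k ∘ (extChartAt I p).symm) (0 : E →L[ℝ] V) z := by
      intro z hz
      have := (hk ((extChartAt I p).symm z)).comp z
        ((contMDiffAt_extChartAt_symm hz).mdifferentiableAt (by simp)).hasMFDerivAt
      exact HasFDerivAt.congr_fderiv (f' := (0 : E →L[ℝ] V).comp (chartSymmDeriv I p z))
        this.hasFDerivAt (by ext; simp)
    have hcont : ∀ᶠ q in 𝓝 p, extChartAt I p q ∈ Metric.ball (extChartAt I p p) ε :=
      (continuousAt_extChartAt p).eventually (Metric.ball_mem_nhds _ hε)
    filter_upwards [hcont, extChartAt_source_mem_nhds (I := I) p] with q hq hqs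
    have := (convex_ball (extChartAt I p p) ε).is_const_of_fderivWithin_eq_zero (𝕜 := ℝ)
      (f := k ∘ (extChartAt I p).symm)
      (fun z hz => (hd z (hball hz)).differentiableAt.differentiableWithinAt)
      (fun z hz => by
        rw [fderivWithin_of_isOpen Metric.isOpen_ball hz]
        exact (hd z (hball hz)).fderiv) hq (Metric.mem_ball_self hε)
    simpa only [Function.comp_apply, (extChartAt I p).left_inv hqs, extChartAt_to_inv] using this
  exact hloc.apply_eq_of_preconnectedSpace y y'

end Constant

section Products

variable {E₁ : Type*} [NormedAddCommGroup E₁] [NormedSpace ℝ E₁]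
  {H₁ : Type*} [TopologicalSpace H₁] {I₁ : ModelWithCorners ℝ E₁ H₁}
  {M₁ : Type*} [TopologicalSpace M₁] [ChartedSpace H₁ M₁]
  {E₂ : Type*} [NormedAddCommGroup E₂] [NormedSpace ℝ E₂]
  {H₂ : Type*} [TopologicalSpace H₂] {I₂ : ModelWithCorners ℝ E₂ H₂}
  {M₂ : Type*} [TopologicalSpace M₂] [ChartedSpace H₂ M₂]
  {V : Type*} [NormedAddCommGroup V] [NormedSpace ℝ V]

theorem ContMDiff.fst_slice {h : M₁ × M₂ → V} (hh : ContMDiff (I₁.prod I₂) 𝓘(ℝ, V) ∞ h) (y : M₂) :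
    ContMDiff I₁ 𝓘(ℝ, V) ∞ fun x => h (x, y) :=
  hh.comp (contMDiff_id.prodMk contMDiff_const)

theorem ContMDiff.snd_slice {h : M₁ × M₂ → V} (hh : ContMDiff (I₁.prod I₂) 𝓘(ℝ, V) ∞ h) (x : M₁) :
    ContMDiff I₂ 𝓘(ℝ, V) ∞ fun y => h (x, y) :=
  hh.comp (contMDiff_const.prodMk contMDiff_id)

theorem vectorDeriv_fst_slice {h : M₁ × M₂ → V} (hh : ContMDiff (I₁.prod I₂) 𝓘(ℝ, V) ∞ h)
    (x : M₁) (y : M₂) (a : E₁) :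
    vectorDeriv I₁ (fun x => h (x, y)) x a = vectorDeriv (I₁.prod I₂) h (x, y) (a, 0) := by
  have e := mfderiv_comp (I' := I₁.prod I₂) (f := fun x : M₁ => (x, y)) x
    (hh.mdifferentiableAt (x := (x, y)) (by simp))
    (mdifferentiableAt_id.prodMk mdifferentiableAt_const)
  rw [mfderiv_prod_left] at e
  exact congrArg (fun L : E₁ →L[ℝ] V => L a) e

theorem vectorDeriv_snd_slice {h : M₁ × M₂ → V} (hh : ContMDiff (I₁.prod I₂) 𝓘(ℝ, V) ∞ h)
    (x : M₁) (y : M₂) (b : E₂) :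
    vectorDeriv I₂ (fun y => h (x, y)) y b = vectorDeriv (I₁.prod I₂) h (x, y) (0, b) := by
  have e := mfderiv_comp (I' := I₁.prod I₂) (f := fun y : M₂ => (x, y)) y
    (hh.mdifferentiableAt (x := (x, y)) (by simp))
    (mdifferentiableAt_const.prodMk mdifferentiableAt_id)
  rw [mfderiv_prod_right] at e
  exact congrArg (fun L : E₂ →L[ℝ] V => L b) e

variable [IsManifold I₁ ∞ M₁] [IsManifold I₂ ∞ M₂]

omit [IsManifold I₁ ∞ M₁] [IsManifold I₂ ∞ M₂] in
theorem mem_extChartAt_prod_target {p : M₁ × M₂} {z : E₁ × E₂} :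
    z ∈ (extChartAt (I₁.prod I₂) p).target ↔
      z.1 ∈ (extChartAt I₁ p.1).target ∧ z.2 ∈ (extChartAt I₂ p.2).target := by
  rw [extChartAt_prod, PartialEquiv.prod_target, Set.mem_prod]

omit [IsManifold I₁ ∞ M₁] [IsManifold I₂ ∞ M₂] in
theorem extChartAt_prod_symm_apply (p : M₁ × M₂) (z : E₁ × E₂) :
    (extChartAt (I₁.prod I₂) p).symm z =
      ((extChartAt I₁ p.1).symm z.1, (extChartAt I₂ p.2).symm z.2) := by
  rw [extChartAt_prod, PartialEquiv.prod_coe_symm]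

omit [IsManifold I₁ ∞ M₁] [IsManifold I₂ ∞ M₂] in
theorem extChartAt_prod_apply (p q : M₁ × M₂) :
    extChartAt (I₁.prod I₂) p q = (extChartAt I₁ p.1 q.1, extChartAt I₂ p.2 q.2) := by
  rw [extChartAt_prod, PartialEquiv.prod_coe]

variable [I₁.Boundaryless] [I₂.Boundaryless]

theorem chartSymmDeriv_prod {p : M₁ × M₂} {z : E₁ × E₂}
    (hz : z ∈ (extChartAt (I₁.prod I₂) p).target) (w : E₁ × E₂) :
    chartSymmDeriv (I₁.prod I₂) p z w =
      (chartSymmDeriv I₁ p.1 z.1 w.1, chartSymmDeriv I₂ p.2 z.2 w.2) := by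
  rw [mem_extChartAt_prod_target] at hz
  have h1 : MDifferentiableAt 𝓘(ℝ, E₁) I₁ (extChartAt I₁ p.1).symm z.1 :=
    (contMDiffAt_extChartAt_symm hz.1).mdifferentiableAt (by simp)
  have h2 : MDifferentiableAt 𝓘(ℝ, E₂) I₂ (extChartAt I₂ p.2).symm z.2 :=
    (contMDiffAt_extChartAt_symm hz.2).mdifferentiableAt (by simp)
  have e := mfderiv_prodMap h1 h2
  have e2 : ((extChartAt (I₁.prod I₂) p).symm : E₁ × E₂ → M₁ × M₂) =
      Prod.map (extChartAt I₁ p.1).symm (extChartAt I₂ p.2).symm := by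
    ext z <;> rw [extChartAt_prod_symm_apply] <;> rfl
  rw [modelWithCornersSelf_prod.symm, chartedSpaceSelf_prod] at e
  unfold chartSymmDeriv
  rw [e2]
  exact congrArg (fun L : E₁ × E₂ →L[ℝ] E₁ × E₂ => L w) e

/-- A function on a product whose mixed second derivatives vanish is a sum of functions on the
factors. -/
theorem add_eq_add_of_mixed_hessian_eq_zero [PreconnectedSpace M₁] [PreconnectedSpace M₂]
    {h : M₁ × M₂ → V} (hh : ContMDiff (I₁.prod I₂) 𝓘(ℝ, V) ∞ h)
    (h0 : ∀ (p : M₁ × M₂) (a : E₁) (b : E₂),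
      fderiv ℝ (fderiv ℝ (h ∘ (extChartAt (I₁.prod I₂) p).symm)) (extChartAt (I₁.prod I₂) p p)
        (0, b) (a, 0) = 0) (x x' : M₁) (y y' : M₂) :
    h (x, y) + h (x', y') = h (x', y) + h (x, y') := by
  -- The vanishing mixed derivatives say that the derivative of h along the first factor does not
  -- change with y. The chart centred at x is kept fixed while y moves, so the vector a retains its
  -- meaning.
  have step : ∀ (x : M₁) (a : E₁) (y y' : M₂), vectorDeriv (I₁.prod I₂) h (x, y) (a, 0) =
      vectorDeriv (I₁.prod I₂) h (x, y') (a, 0) := by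
    intro x a y y'
    refine eq_of_hasMFDerivAt_zero (I := I₂)
      (k := fun y => vectorDeriv (I₁.prod I₂) h (x, y) (a, 0)) (fun y₀ => ?_) y y'
    set F := h ∘ (extChartAt (I₁.prod I₂) (x, y₀)).symm with hF
    have hFd : ContDiffAt ℝ ∞ F (extChartAt I₁ x x, extChartAt I₂ y₀ y₀) := by
      have := hh.contDiffAt_chart (mem_extChartAt_target (I := I₁.prod I₂) (x, y₀))
      rwa [extChartAt_prod_apply] at this
    have hK : HasFDerivAt (fun η : E₂ => fderiv ℝ F (extChartAt I₁ x x, η) (a, 0))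
        (0 : E₂ →L[ℝ] V) (extChartAt I₂ y₀ y₀) := by
      have e1 := (hFd.differentiableAt_fderiv two_le_infty).hasFDerivAt.comp (extChartAt I₂ y₀ y₀)
        (hasFDerivAt_prodMk_right (𝕜 := ℝ) (extChartAt I₁ x x) (extChartAt I₂ y₀ y₀))
      refine (e1.clm_apply (hasFDerivAt_const (a, (0 : E₂)) _)).congr_fderiv ?_
      ext b
      have := h0 (x, y₀) a b
      rw [extChartAt_prod_apply, ← hF] at this
      simpa using this
    have hc := hK.hasMFDerivAt.comp y₀ ((contMDiffAt_extChartAt (I := I₂) (n := ∞)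
      (x := y₀)).mdifferentiableAt (by simp)).hasMFDerivAt
    have hc' : HasMFDerivAt I₂ 𝓘(ℝ, V) ((fun η : E₂ => fderiv ℝ F (extChartAt I₁ x x, η) (a, 0)) ∘
        extChartAt I₂ y₀) y₀ (0 : E₂ →L[ℝ] V) := by
      have e : (0 : E₂ →L[ℝ] V).comp
          (mfderiv I₂ 𝓘(ℝ, E₂) (extChartAt I₂ y₀) y₀ : E₂ →L[ℝ] E₂) = 0 :=
        ContinuousLinearMap.zero_comp _
      exact e ▸ hc
    refine hc'.congr_of_eventuallyEq ?_
    filter_upwards [extChartAt_source_mem_nhds (I := I₂) y₀] with y hy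
    have hz : (extChartAt I₁ x x, extChartAt I₂ y₀ y) ∈
        (extChartAt (I₁.prod I₂) (x, y₀)).target :=
      mem_extChartAt_prod_target.2 ⟨mem_extChartAt_target x, (extChartAt I₂ y₀).map_source hy⟩
    rw [Function.comp_apply, hF, fderiv_chart hh hz, chartSymmDeriv_prod hz,
      extChartAt_prod_symm_apply]
    simp only [extChartAt_to_inv, (extChartAt I₂ y₀).left_inv hy, map_zero, chartSymmDeriv_self]
  have := eq_of_hasMFDerivAt_zero (I := I₁) (k := fun x => h (x, y) - h (x, y')) (fun x₀ => ?_) x x'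
  · rw [sub_eq_sub_iff_add_eq_add] at this
    rw [this, add_comm]
  · have e1 := ((hh.fst_slice y).mdifferentiableAt (x := x₀) (by simp)).hasMFDerivAt
    have e2 := ((hh.fst_slice y').mdifferentiableAt (x := x₀) (by simp)).hasMFDerivAt
    have e3 := e1.sub e2
    have e : vectorDeriv I₁ (fun x => h (x, y)) x₀ - vectorDeriv I₁ (fun x => h (x, y')) x₀ = 0 := by
      ext a
      rw [_root_.sub_apply, vectorDeriv_fst_slice hh, vectorDeriv_fst_slice hh,
        step x₀ a y y', sub_self, _root_.zero_apply]
    exact e ▸ e3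

end Products

/-! ### Twisted product metrics -/

section Scaling

variable {E : Type*} [NormedAddCommGroup E] [NormedSpace ℝ E]
  {H : Type*} [TopologicalSpace H] {I : ModelWithCorners ℝ E H}
  {M : Type*} [TopologicalSpace M] [ChartedSpace H M] [IsManifold I ∞ M]

theorem exists_conformal_metric (h : SmoothMetric I M) {α : M → ℝ} (hα : ContMDiff I 𝓘(ℝ, ℝ) ∞ α)
    (hpos : ∀ p, 0 < α p) :
    ∃ h' : SmoothMetric I M, ∀ p a b, metricAt h' p a b = α p ^ 2 * metricAt h p a b := by
  refine ⟨{ inner := fun p => (α p ^ 2) • h.inner p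
            symm := fun p a b => ?_
            pos := fun p a ha => ?_
            isVonNBounded := fun p => ?_
            contMDiff := ?_ }, fun p a b => rfl⟩
  · exact congrArg (fun t => α p ^ 2 * t) (h.symm p a b)
  · exact mul_pos (pow_pos (hpos p) 2) (h.pos p a ha)
  -- At p, the unit ball of the rescaled metric is that of h shrunk by the factor α(p).
  · have hb := (h.isVonNBounded p).image ((α p)⁻¹ • ContinuousLinearMap.id ℝ (TangentSpace I p))
    refine hb.subset fun a ha => (Set.mem_image _ _ _).2 ⟨α p • a, ?_, ?_⟩
    · have e : h.inner p (α p • a) (α p • a) = α p ^ 2 * h.inner p a a := by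
        simp only [map_smul, _root_.smul_apply, smul_eq_mul]
        ring
      exact e.trans_lt ha
    · exact inv_smul_smul₀ (hpos p).ne' a
  · exact ContMDiff.smul_section (V := fun b : M => TangentSpace I b →L[ℝ] TangentSpace I b →L[ℝ] ℝ)
      (f := fun p => α p ^ 2) (hα.pow 2) h.contMDiff

end Scaling

section LineDerivative

variable {E₁ : Type*} [NormedAddCommGroup E₁] [NormedSpace ℝ E₁]
  {E₂ : Type*} [NormedAddCommGroup E₂] [NormedSpace ℝ E₂]

/-- A function `e^{2u} γ` has logarithmic derivative `2 u_b` in a direction `b` along which `γ` is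
constant. -/
theorem fderiv_exp_mul_of_const_along {E : Type*} [NormedAddCommGroup E] [NormedSpace ℝ E]
    {k u γ : E → ℝ} {z b : E} (hk : DifferentiableAt ℝ k z)
    (hu : DifferentiableAt ℝ u z) (hγ : ∀ t : ℝ, γ (z + t • b) = γ z)
    (heq : ∀ᶠ x in 𝓝 z, k x = Real.exp (2 * u x) * γ x) :
    fderiv ℝ k z b = 2 * fderiv ℝ u z b * k z := by
  have hline : HasDerivAt (fun t : ℝ => z + t • b) b 0 := by
    simpa using ((hasDerivAt_id (0 : ℝ)).smul_const b).const_add z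
  have h0 : z + (0 : ℝ) • b = z := by simp
  have h1 : HasDerivAt (fun t : ℝ => k (z + t • b)) (fderiv ℝ k z b) 0 := by
    refine HasFDerivAt.comp_hasDerivAt (0 : ℝ) (f := fun t : ℝ => z + t • b) ?_ hline
    rw [h0]
    exact hk.hasFDerivAt
  have h2 : HasDerivAt (fun t : ℝ => u (z + t • b)) (fderiv ℝ u z b) 0 := by
    refine HasFDerivAt.comp_hasDerivAt (0 : ℝ) (f := fun t : ℝ => z + t • b) ?_ hline
    rw [h0]
    exact hu.hasFDerivAt
  have h3 := ((h2.const_mul 2).exp.mul_const (γ z))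
  have hev : (fun t : ℝ => k (z + t • b)) =ᶠ[𝓝 0]
      fun t => Real.exp (2 * u (z + t • b)) * γ z := by
    have hc : Tendsto (fun t : ℝ => z + t • b) (𝓝 0) (𝓝 z) := by
      simpa [h0] using hline.continuousAt.tendsto
    filter_upwards [hc.eventually heq] with t ht
    rw [ht, hγ]
  rw [h1.unique (h3.congr_of_eventuallyEq hev), heq.self_of_nhds, h0]
  ring

end LineDerivative

section Products

variable {E₁ : Type*} [NormedAddCommGroup E₁] [NormedSpace ℝ E₁]
  {H₁ : Type*} [TopologicalSpace H₁] {I₁ : ModelWithCorners ℝ E₁ H₁}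
  {M₁ : Type*} [TopologicalSpace M₁] [ChartedSpace H₁ M₁] [IsManifold I₁ ∞ M₁]
  {E₂ : Type*} [NormedAddCommGroup E₂] [NormedSpace ℝ E₂]
  {H₂ : Type*} [TopologicalSpace H₂] {I₂ : ModelWithCorners ℝ E₂ H₂}
  {M₂ : Type*} [TopologicalSpace M₂] [ChartedSpace H₂ M₂] [IsManifold I₂ ∞ M₂]
  {V : Type*} [NormedAddCommGroup V] [NormedSpace ℝ V]

omit [IsManifold I₂ ∞ M₂] in
theorem pullbackFst_eq (h₁ : SmoothMetric I₁ M₁) (p : M₁ × M₂) (a b : E₁ × E₂) :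
    pullbackFst (I₂ := I₂) h₁ p a b = metricAt h₁ p.1 a.1 b.1 := by
  unfold pullbackFst
  rw [mfderiv_fst]
  rfl

omit [IsManifold I₁ ∞ M₁] in
theorem pullbackSnd_eq (h₂ : SmoothMetric I₂ M₂) (p : M₁ × M₂) (a b : E₁ × E₂) :
    pullbackSnd (I₁ := I₁) h₂ p a b = metricAt h₂ p.2 a.2 b.2 := by
  unfold pullbackSnd
  rw [mfderiv_snd]
  rfl

omit [IsManifold I₁ ∞ M₁] [IsManifold I₂ ∞ M₂] in
theorem mem_productNetFst (p : M₁ × M₂) (a : E₁ × E₂) :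
    a ∈ productNetFst I₁ I₂ p ↔ a ∈ (Submodule.prod ⊤ ⊥ : Submodule ℝ (E₁ × E₂)) := by
  unfold productNetFst
  rw [mfderiv_snd, Submodule.mem_prod]
  simp only [Submodule.mem_top, true_and, Submodule.mem_bot]
  rfl

omit [IsManifold I₁ ∞ M₁] [IsManifold I₂ ∞ M₂] in
theorem mem_productNetSnd (p : M₁ × M₂) (a : E₁ × E₂) :
    a ∈ productNetSnd I₁ I₂ p ↔ a ∈ (Submodule.prod ⊥ ⊤ : Submodule ℝ (E₁ × E₂)) := by
  unfold productNetSnd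
  rw [mfderiv_fst, Submodule.mem_prod]
  simp only [Submodule.mem_top, and_true, Submodule.mem_bot]
  rfl

variable [I₁.Boundaryless] [I₂.Boundaryless]

theorem fderiv_snd_comp_chart {k : M₂ → V} (hk : ContMDiff I₂ 𝓘(ℝ, V) ∞ k) {p : M₁ × M₂}
    {z : E₁ × E₂} (hz : z ∈ (extChartAt (I₁.prod I₂) p).target) (a : E₁) :
    fderiv ℝ ((fun q : M₁ × M₂ => k q.2) ∘ (extChartAt (I₁.prod I₂) p).symm) z (a, 0) = 0 := by
  have hs : ContMDiff (I₁.prod I₂) 𝓘(ℝ, V) ∞ (fun q : M₁ × M₂ => k q.2) := hk.comp contMDiff_snd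
  rw [fderiv_chart hs hz, chartSymmDeriv_prod hz, map_zero,
    extChartAt_prod_symm_apply, ← vectorDeriv_fst_slice hs]
  have : vectorDeriv I₁ (fun _ : M₁ => k ((extChartAt I₂ p.2).symm z.2))
      ((extChartAt I₁ p.1).symm z.1) = 0 := mfderiv_const
  rw [this]
  rfl

theorem fderiv_fst_comp_chart {k : M₁ → V} (hk : ContMDiff I₁ 𝓘(ℝ, V) ∞ k) {p : M₁ × M₂}
    {z : E₁ × E₂} (hz : z ∈ (extChartAt (I₁.prod I₂) p).target) (b : E₂) :
    fderiv ℝ ((fun q : M₁ × M₂ => k q.1) ∘ (extChartAt (I₁.prod I₂) p).symm) z (0, b) = 0 := by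
  have hs : ContMDiff (I₁.prod I₂) 𝓘(ℝ, V) ∞ (fun q : M₁ × M₂ => k q.1) := hk.comp contMDiff_fst
  rw [fderiv_chart hs hz, chartSymmDeriv_prod hz, map_zero,
    extChartAt_prod_symm_apply, ← vectorDeriv_snd_slice hs]
  have : vectorDeriv I₂ (fun _ : M₂ => k ((extChartAt I₁ p.1).symm z.1))
      ((extChartAt I₂ p.2).symm z.2) = 0 := mfderiv_const
  rw [this]
  rfl

/-- The product net is a twisted net for a twisted product metric. -/
theorem isTwistedNet_of_twistedProduct {g : SmoothMetric (I₁.prod I₂) (M₁ × M₂)} {N : ℕ}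
    {f : M₁ × M₂ → EuclideanSpace ℝ (Fin N)} (hf : IsIsometricImmersion (euclid N) g f)
    {g₁ : SmoothMetric I₁ M₁} {g₂ : SmoothMetric I₂ M₂} {u v : M₁ × M₂ → ℝ}
    (hu : ContMDiff (I₁.prod I₂) 𝓘(ℝ, ℝ) ∞ u) (hv : ContMDiff (I₁.prod I₂) 𝓘(ℝ, ℝ) ∞ v)
    (hg : ∀ p a b, metricAt g p a b = Real.exp (2 * u p) * metricAt g₁ p.1 a.1 b.1
      + Real.exp (2 * v p) * metricAt g₂ p.2 a.2 b.2) :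
    IsTwistedNet g (Submodule.prod ⊤ ⊥) (Submodule.prod ⊥ ⊤) u v := by
  have hcm : ∀ (p : M₁ × M₂), ∀ z ∈ (extChartAt (I₁.prod I₂) p).target, ∀ c d : E₁ × E₂,
      DifferentiableAt ℝ (fun x => coordMetric g p x c d) z := by
    intro p z hz c d
    have hF := ((hf.1.contDiffAt_chart hz).differentiableAt_fderiv two_le_infty)
    have : DifferentiableAt ℝ (fun x => ⟪fderiv ℝ (f ∘ (extChartAt (I₁.prod I₂) p).symm) x c,
        fderiv ℝ (f ∘ (extChartAt (I₁.prod I₂) p).symm) x d⟫_ℝ) z :=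
      (hF.clm_apply (differentiableAt_const c)).inner ℝ (hF.clm_apply (differentiableAt_const d))
    refine this.congr_of_eventuallyEq ?_
    filter_upwards [extChartAt_target_mem_nhds_of_mem hz] with x hx using coordMetric_eq_inner hf hx c d
  have hcd : ∀ (p : M₁ × M₂), ∀ z ∈ (extChartAt (I₁.prod I₂) p).target, ∀ c d : E₁ × E₂,
      coordMetric g p z c d =
        Real.exp (2 * (u ∘ (extChartAt (I₁.prod I₂) p).symm) z) *
          coordMetric g₁ p.1 z.1 c.1 d.1
        + Real.exp (2 * (v ∘ (extChartAt (I₁.prod I₂) p).symm) z) *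
          coordMetric g₂ p.2 z.2 c.2 d.2 := by
    intro p z hz c d
    rw [coordMetric_eq, hg, chartSymmDeriv_prod hz, chartSymmDeriv_prod hz]
    simp only [Function.comp_apply, coordMetric_eq]
    rw [extChartAt_prod_symm_apply]
  have hzero₁ : ∀ (p : M₁) (z : E₁) (c : E₁), coordMetric g₁ p z 0 c = 0 := by
    intro p z c
    rw [coordMetric_eq, map_zero, map_zero, _root_.zero_apply]
  have hzero₂ : ∀ (p : M₂) (z : E₂) (c : E₂), coordMetric g₂ p z 0 c = 0 := by
    intro p z c
    rw [coordMetric_eq, map_zero, map_zero, _root_.zero_apply]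
  refine ⟨?_, hu, hv, ?_, ?_, ?_, ?_, ?_⟩
  · rw [eq_top_iff]
    rintro ⟨a, b⟩ -
    exact Submodule.mem_sup.2 ⟨(a, 0), by simp, (0, b), by simp, by simp⟩
  · rintro p z hz ⟨a, a₂⟩ ha
    rw [chartSymmDeriv_prod hz]
    obtain rfl : a₂ = 0 := by simpa using ha
    simp
  · rintro p z hz ⟨a, a₂⟩ ha
    rw [chartSymmDeriv_prod hz]
    obtain rfl : a = 0 := by simpa using ha
    simp
  · rintro p ⟨a, a₂⟩ ha ⟨b₁, b⟩ hb
    obtain rfl : a₂ = 0 := by simpa using ha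
    obtain rfl : b₁ = 0 := by simpa using hb
    rw [hg]
    simp
  · rintro p z hz ⟨a, a₂⟩ ha ⟨a', a'₂⟩ ha' ⟨b₁, b⟩ hb
    obtain rfl : a₂ = 0 := by simpa using ha
    obtain rfl : b₁ = 0 := by simpa using hb
    refine fderiv_exp_mul_of_const_along (γ := fun x => coordMetric g₁ p.1 x.1 a a') (hcm p z hz _ _)
      ((hu.contDiffAt_chart hz).differentiableAt (by simp)) (fun t => by simp) ?_
    filter_upwards [extChartAt_target_mem_nhds_of_mem hz] with x hx
    rw [hcd p x hx, hzero₂, mul_zero, add_zero]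
  · rintro p z hz ⟨a, a₂⟩ ha ⟨a', a'₂⟩ ha' ⟨b₁, b⟩ hb
    obtain rfl : a = 0 := by simpa using ha
    obtain rfl : b = 0 := by simpa using hb
    refine fderiv_exp_mul_of_const_along (γ := fun x => coordMetric g₂ p.2 x.2 a₂ a'₂)
      (hcm p z hz _ _) ((hv.contDiffAt_chart hz).differentiableAt (by simp)) (fun t => by simp) ?_
    filter_upwards [extChartAt_target_mem_nhds_of_mem hz] with x hx
    rw [hcd p x hx, hzero₁, mul_zero, zero_add]

end Products

/-! ### The embedding of Euclidean space into the light cone -/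

section Cone

variable {N : ℕ}

theorem lorentz_add_left {m : ℕ} (x y z : Minkowski m) :
    lorentz (x + y) z = lorentz x z + lorentz y z := by
  simp only [lorentz, Prod.fst_add, Prod.snd_add, inner_add_left]; ring

theorem lorentz_smul_left {m : ℕ} (c : ℝ) (x y : Minkowski m) :
    lorentz (c • x) y = c * lorentz x y := by
  simp only [lorentz, Prod.smul_fst, Prod.smul_snd, real_inner_smul_left, smul_eq_mul]; ring

theorem lorentz_comm {m : ℕ} (x y : Minkowski m) : lorentz x y = lorentz y x := by
  simp only [lorentz, real_inner_comm]; ring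

theorem lorentz_add_right {m : ℕ} (x y z : Minkowski m) :
    lorentz x (y + z) = lorentz x y + lorentz x z := by
  rw [lorentz_comm, lorentz_add_left, lorentz_comm y, lorentz_comm z]

theorem lorentz_smul_right {m : ℕ} (c : ℝ) (x y : Minkowski m) :
    lorentz x (c • y) = c * lorentz x y := by
  rw [lorentz_comm, lorentz_smul_left, lorentz_comm y]

variable (m : ℕ) in
/-- The Lorentz scalar product as a bilinear form. -/
def lorentzForm : LinearMap.BilinForm ℝ (Minkowski m) :=
  LinearMap.mk₂ ℝ lorentz lorentz_add_left lorentz_smul_left lorentz_add_right lorentz_smul_right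

theorem lorentzForm_apply {m : ℕ} (x y : Minkowski m) : lorentzForm m x y = lorentz x y := rfl

theorem lorentz_sub_left {m : ℕ} (x y z : Minkowski m) :
    lorentz (x - y) z = lorentz x z - lorentz y z := (lorentzForm m).map_sub₂ x y z

theorem lorentz_sub_right {m : ℕ} (x y z : Minkowski m) :
    lorentz x (y - z) = lorentz x y - lorentz x z := (lorentzForm m x).map_sub y z

theorem lorentz_zero_left {m : ℕ} (x : Minkowski m) : lorentz 0 x = 0 :=
  (lorentzForm m).map_zero₂ x

theorem lorentz_zero_right {m : ℕ} (x : Minkowski m) : lorentz x 0 = 0 := (lorentzForm m x).map_zero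

theorem lorentz_neg_left {m : ℕ} (x y : Minkowski m) : lorentz (-x) y = - lorentz x y :=
  (lorentzForm m).map_neg₂ x y

theorem lorentz_neg_right {m : ℕ} (x y : Minkowski m) : lorentz x (-y) = - lorentz x y :=
  (lorentzForm m x).map_neg y

namespace ConeTriple

variable (T : ConeTriple N)

/-- The derivative of the embedding of `ℝ^N` into the light cone. -/
def embedDeriv (x v : EuclideanSpace ℝ (Fin N)) : Minkowski (N + 1) := T.A v - ⟪x, v⟫_ℝ • T.w

theorem contDiff_embed : ContDiff ℝ ∞ T.embed := by
  unfold embed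
  have hA : ContDiff ℝ ∞ T.A := T.A.toContinuousLinearMap.contDiff
  exact (contDiff_const.add hA).sub
    ((contDiff_const.mul (contDiff_norm_sq ℝ)).smul contDiff_const)

theorem fderiv_embed (x v : EuclideanSpace ℝ (Fin N)) :
    fderiv ℝ T.embed x v = T.embedDeriv x v := by
  have h1 : HasFDerivAt (fun x : EuclideanSpace ℝ (Fin N) => ‖x‖ ^ 2) (2 • innerSL ℝ x) x :=
    (hasStrictFDerivAt_norm_sq x).hasFDerivAt
  have h2 := ((T.A.toContinuousLinearMap.hasFDerivAt (x := x)).const_add T.p₀).sub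
    ((h1.const_mul (1 / 2)).smul_const T.w)
  have h3 : fderiv ℝ T.embed x = _ := h2.fderiv
  rw [h3]
  simp [embedDeriv]

/-- As the second derivative only involves ⟨b, a⟩, it does not contribute for the orthogonal vectors
f_a and f_b. This is why the lift of f inherits the equation for mixed derivatives. -/
theorem fderiv_fderiv_embed (x a b : EuclideanSpace ℝ (Fin N)) :
    fderiv ℝ (fderiv ℝ T.embed) x b a = - ⟪b, a⟫_ℝ • T.w := by
  have hd := (T.contDiff_embed.contDiffAt (x := x)).differentiableAt_fderiv two_le_infty
  rw [← fderiv_fderiv_apply hd]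
  have e : (fun x => fderiv ℝ T.embed x a) = fun x => T.A a - ⟪x, a⟫_ℝ • T.w := by
    funext x
    rw [fderiv_embed, embedDeriv]
  have h1 : HasFDerivAt (fun x : EuclideanSpace ℝ (Fin N) => ⟪x, a⟫_ℝ) (innerSL ℝ a) x := by
    have := (innerSL ℝ a).hasFDerivAt (x := x)
    simpa [real_inner_comm] using this
  rw [e, ((h1.smul_const T.w).const_sub (T.A a)).fderiv]
  simp [real_inner_comm]

/-- Scalar products in the cone record Euclidean distances. After rescaling they record distances
multiplied by conformal factors, which is how spheres, inversions and stereographic projections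
enter. -/
theorem lorentz_embed (x y : EuclideanSpace ℝ (Fin N)) :
    lorentz (T.embed x) (T.embed y) = - (1 / 2) * ‖x - y‖ ^ 2 := by
  simp only [embed, lorentz_add_left, lorentz_sub_left, lorentz_smul_left, lorentz_add_right,
    lorentz_sub_right, lorentz_smul_right, T.p₀_lightlike, T.w_lightlike, T.p₀_w, T.A_isometry,
    T.A_p₀, T.A_w, lorentz_comm T.w, lorentz_comm T.p₀ (T.A _), norm_sub_sq_real]
  ring

theorem lorentz_embed_w (x : EuclideanSpace ℝ (Fin N)) : lorentz (T.embed x) T.w = 1 := by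
  simp only [embed, lorentz_add_left, lorentz_sub_left, lorentz_smul_left, T.w_lightlike, T.p₀_w,
    T.A_w]
  ring

theorem lorentz_embedDeriv (x v v' : EuclideanSpace ℝ (Fin N)) :
    lorentz (T.embedDeriv x v) (T.embedDeriv x v') = ⟪v, v'⟫_ℝ := by
  simp only [embedDeriv, lorentz_sub_left, lorentz_smul_left, lorentz_sub_right,
    lorentz_smul_right, T.w_lightlike, T.A_isometry, T.A_w, lorentz_comm T.w]
  ring

theorem lorentz_embed_embedDeriv (x v : EuclideanSpace ℝ (Fin N)) :
    lorentz (T.embed x) (T.embedDeriv x v) = 0 := by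
  simp only [embed, embedDeriv, lorentz_add_left, lorentz_sub_left, lorentz_smul_left,
    lorentz_sub_right, lorentz_smul_right, T.w_lightlike, T.p₀_w, T.A_isometry,
    T.A_p₀, T.A_w, lorentz_comm T.w, lorentz_comm T.p₀ (T.A _)]
  ring

end ConeTriple

end Cone

/-! ### Rescaled lifts into the light cone. -/

section Derivative

variable {E : Type*} [NormedAddCommGroup E] [NormedSpace ℝ E]
  {H : Type*} [TopologicalSpace H] {I : ModelWithCorners ℝ E H} [I.Boundaryless]
  {M : Type*} [TopologicalSpace M] [ChartedSpace H M] [IsManifold I ∞ M]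
  {N : ℕ}

omit [I.Boundaryless] [IsManifold I ∞ M] in
theorem ConeTriple.contMDiff_smul_embed (T : ConeTriple N) {f : M → EuclideanSpace ℝ (Fin N)}
    (hf : ContMDiff I 𝓘(ℝ, EuclideanSpace ℝ (Fin N)) ∞ f) {l : M → ℝ}
    (hl : ContMDiff I 𝓘(ℝ, ℝ) ∞ l) :
    ContMDiff I 𝓘(ℝ, Minkowski (N + 1)) ∞ fun p => l p • T.embed (f p) :=
  hl.smul (T.contDiff_embed.contMDiff.comp hf)

/-- The metric induced by a rescaled immersion into the light cone. -/
theorem ConeTriple.lorentz_vectorDeriv_smul_embed (T : ConeTriple N)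
    {f : M → EuclideanSpace ℝ (Fin N)}
    (hf : ContMDiff I 𝓘(ℝ, EuclideanSpace ℝ (Fin N)) ∞ f) {l : M → ℝ}
    (hl : ContMDiff I 𝓘(ℝ, ℝ) ∞ l) (p : M) (a b : E) :
    lorentz (vectorDeriv I (fun p => l p • T.embed (f p)) p a)
      (vectorDeriv I (fun p => l p • T.embed (f p)) p b) =
      l p ^ 2 * ⟪vectorDeriv I f p a, vectorDeriv I f p b⟫_ℝ := by
  have hz := mem_extChartAt_target (I := I) p
  have hfd := ((hf.contDiffAt_chart hz).differentiableAt (by simp)).hasFDerivAt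
  have hld := ((hl.contDiffAt_chart hz).differentiableAt (by simp)).hasFDerivAt
  have hed : HasFDerivAt T.embed _ ((f ∘ (extChartAt I p).symm) (extChartAt I p p)) :=
    (T.contDiff_embed.contDiffAt.differentiableAt (by simp)).hasFDerivAt
  have h1 := hld.smul (hed.comp _ hfd)
  have key : ∀ c, vectorDeriv I (fun p => l p • T.embed (f p)) p c =
      l p • T.embedDeriv (f p) (vectorDeriv I f p c) + vectorDeriv I l p c • T.embed (f p) := by
    intro c
    rw [vectorDeriv_eq_fderiv (T.contMDiff_smul_embed hf hl), vectorDeriv_eq_fderiv hf,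
      vectorDeriv_eq_fderiv hl]
    refine (congrArg (fun L : E →L[ℝ] Minkowski (N + 1) => L c) h1.fderiv).trans ?_
    simp [T.fderiv_embed]
  rw [key, key]
  simp only [lorentz_add_left, lorentz_add_right, lorentz_smul_left, lorentz_smul_right,
    T.lorentz_embedDeriv, T.lorentz_embed_embedDeriv, T.lorentz_embed,
    lorentz_comm (T.embedDeriv _ _) (T.embed _), sub_self, norm_zero]
  ring

theorem exists_linearIndependent_pair {E : Type*} [AddCommGroup E] [Module ℝ E]
    (hE : 2 ≤ Module.finrank ℝ E) {a : E} (ha : a ≠ 0) :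
    ∃ a' : E, LinearIndependent ℝ ![a', a] := by
  have hlt : Submodule.span ℝ {a} ≠ ⊤ := by
    intro h
    have h1 := finrank_span_singleton (K := ℝ) ha
    rw [h, finrank_top] at h1
    omega
  obtain ⟨a', ha'⟩ := SetLike.exists_not_mem_of_ne_top _ hlt rfl
  refine ⟨a', ?_⟩
  rw [LinearIndependent.pair_symm_iff, LinearIndependent.pair_iff' ha]
  intro c hc
  exact ha' (Submodule.mem_span_singleton.2 ⟨c, hc⟩)

end Derivative

/-! ### The conformal product structure and the additive splitting of the lift. -/

section Splitting

variable {E₁ : Type*} [NormedAddCommGroup E₁] [NormedSpace ℝ E₁]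
  {H₁ : Type*} [TopologicalSpace H₁] {I₁ : ModelWithCorners ℝ E₁ H₁} [I₁.Boundaryless]
  {M₁ : Type*} [TopologicalSpace M₁] [ChartedSpace H₁ M₁] [IsManifold I₁ ∞ M₁]
  {E₂ : Type*} [NormedAddCommGroup E₂] [NormedSpace ℝ E₂]
  {H₂ : Type*} [TopologicalSpace H₂] {I₂ : ModelWithCorners ℝ E₂ H₂} [I₂.Boundaryless]
  {M₂ : Type*} [TopologicalSpace M₂] [ChartedSpace H₂ M₂] [IsManifold I₂ ∞ M₂]
  {N : ℕ}

/-- Both u and v have mixed second derivative v_a u_b: by Codazzi in a factor of dimension at least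
two, by sphericity otherwise. So the net is a product net up to a conformal change, and the same
identity makes the mixed derivatives of the lift vanish after division by the conformal factor. -/
theorem exists_conformal_splitting [ConnectedSpace M₁] [ConnectedSpace M₂]
    {g : SmoothMetric (I₁.prod I₂) (M₁ × M₂)} (hg : IsTwistedProductMetric g)
    {f : M₁ × M₂ → EuclideanSpace ℝ (Fin N)} (hf : IsIsometricImmersion (euclid N) g f)
    (hadapted : IsShapeInvariant g f (productNetFst I₁ I₂))
    (h₁ : 2 ≤ Module.finrank ℝ E₁ ∨ IsSpherical g (productNetFst I₁ I₂))
    (h₂ : 2 ≤ Module.finrank ℝ E₂ ∨ IsSpherical g (productNetSnd I₁ I₂)) :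
    ∃ (φ : M₁ × M₂ → ℝ) (h₁ : SmoothMetric I₁ M₁) (h₂ : SmoothMetric I₂ M₂),
      IsConformalToProduct g φ h₁ h₂ ∧ ∀ (T : ConeTriple N) (x x' : M₁) (y y' : M₂),
        (φ (x, y))⁻¹ • T.embed (f (x, y)) + (φ (x', y'))⁻¹ • T.embed (f (x', y')) =
        (φ (x', y))⁻¹ • T.embed (f (x', y)) + (φ (x, y'))⁻¹ • T.embed (f (x, y')) := by
  obtain ⟨g₁, g₂, ρ₁, ρ₂, hρ₁, hρ₂, hpos₁, hpos₂, hgρ⟩ := hg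
  set u : M₁ × M₂ → ℝ := fun p => Real.log (ρ₁ p) with hudef
  set v : M₁ × M₂ → ℝ := fun p => Real.log (ρ₂ p) with hvdef
  have hu : ContMDiff (I₁.prod I₂) 𝓘(ℝ, ℝ) ∞ u := fun p =>
    ((Real.contDiffAt_log (n := ∞)).2 (hpos₁ p).ne').contMDiffAt.comp p (hρ₁ p)
  have hv : ContMDiff (I₁.prod I₂) 𝓘(ℝ, ℝ) ∞ v := fun p =>
    ((Real.contDiffAt_log (n := ∞)).2 (hpos₂ p).ne').contMDiffAt.comp p (hρ₂ p)
  have hgm : ∀ p a b, metricAt g p a b = Real.exp (2 * u p) * metricAt g₁ p.1 a.1 b.1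
      + Real.exp (2 * v p) * metricAt g₂ p.2 a.2 b.2 := by
    intro p a b
    rw [two_mul, two_mul, Real.exp_add, Real.exp_add, Real.exp_log (hpos₁ p),
      Real.exp_log (hpos₂ p), ← pow_two, ← pow_two, ← pullbackFst_eq (I₂ := I₂),
      ← pullbackSnd_eq (I₁ := I₁)]
    exact hgρ p a b
  set P : Submodule ℝ (E₁ × E₂) := Submodule.prod ⊤ ⊥ with hP
  set Q : Submodule ℝ (E₁ × E₂) := Submodule.prod ⊥ ⊤ with hQ
  have hnet : IsTwistedNet g P Q u v := isTwistedNet_of_twistedProduct hf hu hv hgm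
  have hmemP : ∀ a : E₁, (a, (0 : E₂)) ∈ P := by simp [hP]
  have hmemQ : ∀ b : E₂, ((0 : E₁), b) ∈ Q := by simp [hQ]
  have hadapt : ∀ p, ∀ a ∈ P, ∀ b ∈ Q, coordHessian (I₁.prod I₂) f p a b ∈
      LinearMap.range (vectorDeriv (I₁.prod I₂) f p).toLinearMap := fun p a ha b hb =>
    hadapted.hessian_mem (fun p a => mem_productNetFst p a) hnet.orth p ha hb
  have hadapt' : ∀ p, ∀ a ∈ Q, ∀ b ∈ P, coordHessian (I₁.prod I₂) f p a b ∈
      LinearMap.range (vectorDeriv (I₁.prod I₂) f p).toLinearMap := by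
    intro p a ha b hb
    have : coordHessian (I₁.prod I₂) f p a b = coordHessian (I₁.prod I₂) f p b a :=
      (hf.1.contDiffAt_chart (mem_extChartAt_target p)).fderiv_fderiv_comm two_le_infty a b
    rw [this]
    exact hadapt p b hb a ha
  have hud : ∀ (p : M₁ × M₂), ∀ z ∈ (extChartAt (I₁.prod I₂) p).target,
      ContDiffAt ℝ 2 (u ∘ (extChartAt (I₁.prod I₂) p).symm) z :=
    fun p z hz => (hu.contDiffAt_chart hz).of_le two_le_infty
  have hvd : ∀ (p : M₁ × M₂), ∀ z ∈ (extChartAt (I₁.prod I₂) p).target,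
      ContDiffAt ℝ 2 (v ∘ (extChartAt (I₁.prod I₂) p).symm) z :=
    fun p z hz => (hv.contDiffAt_chart hz).of_le two_le_infty
  have huab : ∀ (p : M₁ × M₂) (a : E₁) (b : E₂),
      fderiv ℝ (fderiv ℝ (u ∘ (extChartAt (I₁.prod I₂) p).symm)) (extChartAt (I₁.prod I₂) p p)
        (0, b) (a, 0) =
      fderiv ℝ (v ∘ (extChartAt (I₁.prod I₂) p).symm) (extChartAt (I₁.prod I₂) p p) (a, 0) *
        fderiv ℝ (u ∘ (extChartAt (I₁.prod I₂) p).symm) (extChartAt (I₁.prod I₂) p p) (0, b) := by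
    intro p a b
    rw [(hud p _ (mem_extChartAt_target p)).fderiv_fderiv_comm le_rfl]
    rcases h₁ with h₁ | h₁
    · refine hnet.hessian_log_of_codazzi hf hadapt ?_ p (hmemP a) (hmemQ b)
      rintro ⟨c, c₂⟩ hc hc0
      obtain rfl : c₂ = 0 := by simpa [hP] using hc
      obtain ⟨c', hc'⟩ := exists_linearIndependent_pair h₁ (a := c) (by rintro rfl; exact hc0 rfl)
      refine ⟨(c', 0), hmemP c', ?_⟩
      rw [LinearIndependent.pair_iff] at hc' ⊢
      intro s t hst
      exact hc' s t (congrArg Prod.fst hst)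
    · exact hnet.hessian_log_of_isSpherical hf (fun p a => mem_productNetFst p a) h₁ p (hmemP a)
        (hmemQ b)
  have hvab : ∀ (p : M₁ × M₂) (a : E₁) (b : E₂),
      fderiv ℝ (fderiv ℝ (v ∘ (extChartAt (I₁.prod I₂) p).symm)) (extChartAt (I₁.prod I₂) p p)
        (0, b) (a, 0) =
      fderiv ℝ (v ∘ (extChartAt (I₁.prod I₂) p).symm) (extChartAt (I₁.prod I₂) p p) (a, 0) *
        fderiv ℝ (u ∘ (extChartAt (I₁.prod I₂) p).symm) (extChartAt (I₁.prod I₂) p p) (0, b) := by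
    intro p a b
    rw [mul_comm]
    rcases h₂ with h₂ | h₂
    · refine hnet.symm.hessian_log_of_codazzi hf hadapt' ?_ p (hmemQ b) (hmemP a)
      rintro ⟨c₁, c⟩ hc hc0
      obtain rfl : c₁ = 0 := by simpa [hQ] using hc
      obtain ⟨c', hc'⟩ := exists_linearIndependent_pair h₂ (a := c) (by rintro rfl; exact hc0 rfl)
      refine ⟨(0, c'), hmemQ c', ?_⟩
      rw [LinearIndependent.pair_iff] at hc' ⊢
      intro s t hst
      exact hc' s t (congrArg Prod.snd hst)
    · exact hnet.symm.hessian_log_of_isSpherical hf (fun p a => mem_productNetSnd p a) h₂ p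
        (hmemQ b) (hmemP a)
  -- the difference of the logarithmic twisting functions is a sum of functions on the factors
  have hsplit := add_eq_add_of_mixed_hessian_eq_zero (hu.sub hv) (fun p a b => by
    have hz := mem_extChartAt_target (I := I₁.prod I₂) p
    have e : fderiv ℝ ((fun x => u x - v x) ∘ (extChartAt (I₁.prod I₂) p).symm)
        =ᶠ[𝓝 (extChartAt (I₁.prod I₂) p p)] fun z =>
          fderiv ℝ (u ∘ (extChartAt (I₁.prod I₂) p).symm) z -
            fderiv ℝ (v ∘ (extChartAt (I₁.prod I₂) p).symm) z := by
      filter_upwards [extChartAt_target_mem_nhds_of_mem hz] with z hz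
      exact fderiv_sub ((hud p z hz).differentiableAt_two le_rfl)
        ((hvd p z hz).differentiableAt_two le_rfl)
    rw [e.fderiv_eq, fderiv_fun_sub ((hud p _ hz).differentiableAt_fderiv le_rfl)
      ((hvd p _ hz).differentiableAt_fderiv le_rfl), _root_.sub_apply, _root_.sub_apply,
      huab, hvab, sub_self])
  obtain ⟨x₀⟩ : Nonempty M₁ := inferInstance
  obtain ⟨y₀⟩ : Nonempty M₂ := inferInstance
  -- With u - v = A + B, the function ψ = u - A = v + B has the derivatives of u along the second
  -- factor and those of v along the first. The metrics of the factors then become e^{2A} g₁ and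
  -- e^{-2B} g₂.
  set A : M₁ → ℝ := fun x => u (x, y₀) - v (x, y₀) with hA
  set B : M₂ → ℝ := fun y => (u (x₀, y) - v (x₀, y)) - (u (x₀, y₀) - v (x₀, y₀)) with hB
  have hAs : ContMDiff I₁ 𝓘(ℝ, ℝ) ∞ A := (hu.fst_slice y₀).sub (hv.fst_slice y₀)
  have hBs : ContMDiff I₂ 𝓘(ℝ, ℝ) ∞ B :=
    ((hu.snd_slice x₀).sub (hv.snd_slice x₀)).sub contMDiff_const
  have hAs' : ContMDiff (I₁.prod I₂) 𝓘(ℝ, ℝ) ∞ (fun q : M₁ × M₂ => A q.1) :=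
    hAs.comp contMDiff_fst
  have hBs' : ContMDiff (I₁.prod I₂) 𝓘(ℝ, ℝ) ∞ (fun q : M₁ × M₂ => B q.2) :=
    hBs.comp contMDiff_snd
  set ψ : M₁ × M₂ → ℝ := fun p => u p - A p.1 with hψ
  have hψB : ψ = fun p => v p + B p.2 := by
    funext ⟨x, y⟩
    have := hsplit x x₀ y y₀
    simp only [hψ, hA, hB]
    linarith
  have hψs : ContMDiff (I₁.prod I₂) 𝓘(ℝ, ℝ) ∞ ψ := hu.sub hAs'
  obtain ⟨k₁, hk₁⟩ := exists_conformal_metric g₁ (α := fun x => Real.exp (A x))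
    (Real.contDiff_exp.contMDiff.comp hAs) (fun _ => Real.exp_pos _)
  obtain ⟨k₂, hk₂⟩ := exists_conformal_metric g₂ (α := fun y => Real.exp (-B y))
    (Real.contDiff_exp.contMDiff.comp hBs.neg) (fun _ => Real.exp_pos _)
  refine ⟨fun p => Real.exp (ψ p), k₁, k₂,
    ⟨Real.contDiff_exp.contMDiff.comp hψs, fun _ => Real.exp_pos _, fun p a b => ?_⟩, fun T => ?_⟩
  · have e1 := hgm p a b
    have e2 : Real.exp (2 * u p) = Real.exp (ψ p) ^ 2 * Real.exp (A p.1) ^ 2 := by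
      rw [← mul_pow, ← Real.exp_add, ← Real.exp_nat_mul]
      congr 1
      simp only [hψ]
      push_cast
      ring
    have e3 : Real.exp (2 * v p) = Real.exp (ψ p) ^ 2 * Real.exp (-B p.2) ^ 2 := by
      rw [← mul_pow, ← Real.exp_add, ← Real.exp_nat_mul]
      congr 1
      rw [hψB]
      push_cast
      ring
    rw [e2, e3, mul_assoc, mul_assoc, ← hk₁ p.1 a.1 b.1, ← hk₂ p.2 a.2 b.2, ← mul_add] at e1
    exact e1.trans (congrArg (fun t => Real.exp (ψ p) ^ 2 * t)
      (congrArg₂ (· + ·) (pullbackFst_eq k₁ p a b).symm (pullbackSnd_eq k₂ p a b).symm))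
  · have hG : ContMDiff (I₁.prod I₂) 𝓘(ℝ, Minkowski (N + 1)) ∞ (fun p => T.embed (f p)) :=
      T.contDiff_embed.contMDiff.comp hf.1
    have hF : ContMDiff (I₁.prod I₂) 𝓘(ℝ, Minkowski (N + 1)) ∞
        (fun p => Real.exp (-ψ p) • T.embed (f p)) :=
      T.contMDiff_smul_embed hf.1 (Real.contDiff_exp.contMDiff.comp hψs.neg)
    have := add_eq_add_of_mixed_hessian_eq_zero hF (fun p a b => by
      have hz := mem_extChartAt_target (I := I₁.prod I₂) p
      have hfd := (hf.1.contDiffAt_chart hz).of_le two_le_infty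
      refine mixed_hessian_exp_neg_smul (u := u ∘ (extChartAt (I₁.prod I₂) p).symm)
        (v := v ∘ (extChartAt (I₁.prod I₂) p).symm) (ψ := ψ ∘ (extChartAt (I₁.prod I₂) p).symm)
        (h := T.embed ∘ (f ∘ (extChartAt (I₁.prod I₂) p).symm))
        ((hG.contDiffAt_chart hz).of_le two_le_infty)
        ((hψs.contDiffAt_chart hz).of_le two_le_infty) (hvd p _ hz) ?_ ?_ ?_ (hvab p a b)
      · have hc : ∀ w, fderiv ℝ (T.embed ∘ (f ∘ (extChartAt (I₁.prod I₂) p).symm))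
            (extChartAt (I₁.prod I₂) p p) w = fderiv ℝ T.embed (f p)
              (fderiv ℝ (f ∘ (extChartAt (I₁.prod I₂) p).symm) (extChartAt (I₁.prod I₂) p p) w) := by
          intro w
          rw [fderiv_comp _ (T.contDiff_embed.contDiffAt.differentiableAt (by simp))
            (hfd.differentiableAt_two le_rfl)]
          simp only [ContinuousLinearMap.comp_apply, Function.comp_apply, extChartAt_to_inv]
        -- In the second order chain rule, the Hessian of the embedding is applied to the orthogonal
        -- pair f_a, f_b and drops out.
        rw [fderiv_fderiv_comp (T.contDiff_embed.contDiffAt.of_le two_le_infty) hfd,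
          hnet.hessian_eq hf hadapt hz (hmemP a) (hmemQ b), hc, hc, T.fderiv_fderiv_embed,
          real_inner_comm, ← coordMetric_eq_inner hf hz,
          hnet.coordMetric_eq_zero hz (hmemP a) (hmemQ b), map_add, map_smul, map_smul]
        simp only [neg_zero, zero_smul, zero_add, Function.comp_apply, extChartAt_to_inv]
      · filter_upwards [extChartAt_target_mem_nhds_of_mem hz] with z hz
        have e : ψ ∘ (extChartAt (I₁.prod I₂) p).symm = v ∘ (extChartAt (I₁.prod I₂) p).symm +
            (fun q : M₁ × M₂ => B q.2) ∘ (extChartAt (I₁.prod I₂) p).symm := by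
          rw [hψB]; rfl
        rw [e, fderiv_add ((hvd p z hz).differentiableAt_two le_rfl)
          ((hBs'.contDiffAt_chart hz).differentiableAt (by simp)),
          _root_.add_apply, fderiv_snd_comp_chart hBs hz, add_zero]
      · have e : ψ ∘ (extChartAt (I₁.prod I₂) p).symm = u ∘ (extChartAt (I₁.prod I₂) p).symm -
            (fun q : M₁ × M₂ => A q.1) ∘ (extChartAt (I₁.prod I₂) p).symm := rfl
        rw [e, fderiv_sub ((hud p _ hz).differentiableAt_two le_rfl)
          ((hAs'.contDiffAt_chart hz).differentiableAt (by simp)),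
          _root_.sub_apply, fderiv_fst_comp_chart hAs hz, sub_zero])
    simpa only [Real.exp_neg] using this

end Splitting

/-! ### Linear algebra of Minkowski space -/

section Minkowski

variable {N m : ℕ}

theorem eq_zero_of_lightlike_of_snd_eq_zero {x : Minkowski m} (hx : lorentz x x = 0) (h : x.2 = 0) :
    x = 0 := by
  rw [lorentz, h, mul_zero, sub_zero, inner_self_eq_zero] at hx
  exact Prod.ext hx h

namespace ConeTriple

theorem embed_injective (T : ConeTriple N) : Function.Injective T.embed := by
  intro x y h
  have h1 := T.lorentz_embed x y
  rw [h, T.lorentz_embed, sub_self, norm_zero] at h1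
  rw [← sub_eq_zero, ← norm_eq_zero, ← pow_eq_zero_iff two_ne_zero]
  linarith

/-- By a dimension count, p₀, w and the range of A span Minkowski space. The coefficient of p₀ is 1
by the condition on ⟨n, w⟩, and nullity determines the coefficient of w from the component in the
range of A. -/
theorem exists_embed_eq (T : ConeTriple N) {n : Minkowski (N + 1)} (hn : lorentz n n = 0)
    (hw : lorentz n T.w = 1) : ∃ x, T.embed x = n := by
  let S : (EuclideanSpace ℝ (Fin N) × ℝ × ℝ) →ₗ[ℝ] Minkowski (N + 1) :=
    T.A.coprod ((LinearMap.toSpanSingleton ℝ _ T.p₀).coprod (LinearMap.toSpanSingleton ℝ _ T.w))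
  have hS : ∀ x s t, S (x, s, t) = T.A x + (s • T.p₀ + t • T.w) := fun x s t => by simp [S]
  have hSw : ∀ x s t, lorentz (S (x, s, t)) T.w = s := fun x s t => by
    simp only [hS, lorentz_add_left, lorentz_smul_left, T.A_w, T.p₀_w, T.w_lightlike]; ring
  have hSp : ∀ x s t, lorentz (S (x, s, t)) T.p₀ = t := fun x s t => by
    simp only [hS, lorentz_add_left, lorentz_smul_left, T.A_p₀, lorentz_comm T.w, T.p₀_w,
      T.p₀_lightlike]; ring
  have hinj : Function.Injective S := by
    rw [← LinearMap.ker_eq_bot, LinearMap.ker_eq_bot']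
    rintro ⟨x, s, t⟩ h
    have hs := hSw x s t
    have ht := hSp x s t
    rw [h, lorentz_zero_left] at hs ht
    subst hs ht
    rw [hS, zero_smul, zero_smul, add_zero, add_zero] at h
    have := T.A_isometry x x
    rw [h, lorentz_zero_left] at this
    rw [inner_self_eq_zero.1 this.symm]
    rfl
  have hsurj : Function.Surjective S :=
    (LinearMap.injective_iff_surjective_of_finrank_eq_finrank (by simp)).1 hinj
  obtain ⟨⟨x, s, t⟩, rfl⟩ := hsurj n
  rw [hSw] at hw
  subst hw
  rw [hS] at hn ⊢
  refine ⟨x, ?_⟩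
  simp only [lorentz_add_left, lorentz_add_right, lorentz_smul_left, lorentz_smul_right,
    T.A_isometry, T.A_p₀, T.A_w, T.p₀_lightlike, T.w_lightlike, T.p₀_w, lorentz_comm T.w,
    lorentz_comm T.p₀ (T.A _), real_inner_self_eq_norm_sq] at hn
  have ht : t = - (1 / 2 * ‖x‖ ^ 2) := by linarith
  rw [embed, ht]
  module

/-- The image of a cone triple under a linear isometry of Minkowski space. -/
def map (T : ConeTriple N) (R : Minkowski (N + 1) →ₗ[ℝ] Minkowski (N + 1))
    (hR : ∀ x y, lorentz (R x) (R y) = lorentz x y) : ConeTriple N where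
  p₀ := R T.p₀
  w := R T.w
  A := R ∘ₗ T.A
  p₀_lightlike := by rw [hR, T.p₀_lightlike]
  w_lightlike := by rw [hR, T.w_lightlike]
  p₀_w := by rw [hR, T.p₀_w]
  A_isometry x y := by simp only [LinearMap.comp_apply, hR, T.A_isometry]
  A_p₀ x := by simp only [LinearMap.comp_apply, hR, T.A_p₀]
  A_w x := by simp only [LinearMap.comp_apply, hR, T.A_w]

theorem map_embed (T : ConeTriple N) (R : Minkowski (N + 1) →ₗ[ℝ] Minkowski (N + 1))
    (hR : ∀ x y, lorentz (R x) (R y) = lorentz x y) (x : EuclideanSpace ℝ (Fin N)) :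
    (T.map R hR).embed x = R (T.embed x) := by
  simp [embed, map]

end ConeTriple

theorem exists_coneTriple (N : ℕ) : Nonempty (ConeTriple N) := by
  set e : EuclideanSpace ℝ (Fin (N + 1)) := EuclideanSpace.single (Fin.last N) 1 with he
  have hnorm : ‖e‖ = 1 := by simp [he]
  have hee : ⟪e, e⟫_ℝ = 1 := by rw [real_inner_self_eq_norm_sq, hnorm, one_pow]
  have hne : e ≠ 0 := by rw [← norm_ne_zero_iff, hnorm]; exact one_ne_zero
  have : Fact (Module.finrank ℝ (EuclideanSpace ℝ (Fin (N + 1))) = N + 1) := ⟨by simp⟩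
  let J := (OrthonormalBasis.fromOrthogonalSpanSingleton (𝕜 := ℝ) N hne).repr.symm
  have hJ : ∀ x, ⟪(J x : EuclideanSpace ℝ (Fin (N + 1))), e⟫_ℝ = 0 := fun x => by
    rw [real_inner_comm]
    exact Submodule.mem_orthogonal_singleton_iff_inner_right.1 (J x).2
  have hJJ : ∀ x y, ⟪(J x : EuclideanSpace ℝ (Fin (N + 1))), (J y : EuclideanSpace ℝ (Fin (N + 1)))⟫_ℝ
      = ⟪x, y⟫_ℝ := fun x y => J.inner_map_map x y
  -- For a unit vector e, the vectors (e, 1) and (e/2, -1/2) span a Lorentz plane; A identifies ℝ^N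
  -- with the space-like complement e^⊥ × {0}.
  exact ⟨{
    p₀ := ((1 / 2 : ℝ) • e, -(1 / 2))
    w := (e, 1)
    A := (LinearMap.inl ℝ _ ℝ) ∘ₗ (Submodule.subtype _) ∘ₗ J.toLinearEquiv.toLinearMap
    p₀_lightlike := by
      simp only [lorentz, real_inner_smul_left, real_inner_smul_right, hee]; norm_num
    w_lightlike := by simp only [lorentz, hee]; norm_num
    p₀_w := by simp only [lorentz, real_inner_smul_left, hee]; norm_num
    A_isometry := fun x y => by simpa [lorentz] using hJJ x y
    A_p₀ := fun x => by simpa [lorentz, inner_smul_right] using hJ x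
    A_w := fun x => by simpa [lorentz] using hJ x }⟩

/-- A time-like vector can be moved to the time axis by a linear isometry, which moreover can be
chosen to make a given light-like vector future directed. -/
theorem exists_lorentz_isometry {τ : Minkowski m} (hτ : lorentz τ τ < 0) {q : Minkowski m}
    (hq : lorentz q q = 0) (hq0 : q ≠ 0) :
    ∃ R : Minkowski m →ₗ[ℝ] Minkowski m, (∀ x y, lorentz (R x) (R y) = lorentz x y) ∧
      (∃ r : ℝ, r ≠ 0 ∧ R τ = (0, r)) ∧ 0 < (R q).2 := by
  -- The time direction of q can be corrected by replacing R with -R: the image of q is null and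
  -- nonzero, so its time coordinate is nonzero.
  suffices h : ∃ R : Minkowski m →ₗ[ℝ] Minkowski m,
      (∀ x y, lorentz (R x) (R y) = lorentz x y) ∧ (∃ r : ℝ, r ≠ 0 ∧ R τ = (0, r)) by
    obtain ⟨R, hR, r, hr, hRτ⟩ := h
    have hRq : (R q).2 ≠ 0 := by
      intro h0
      have h1 : R q = 0 := eq_zero_of_lightlike_of_snd_eq_zero (by rw [hR, hq]) h0
      have h2 : Function.Injective R := by
        rw [← LinearMap.ker_eq_bot, LinearMap.ker_eq_bot']
        intro x hx
        have h3 : ∀ y, lorentz x y = 0 := fun y => by rw [← hR, hx, lorentz_zero_left]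
        have h4 := h3 (x.1, 0)
        have h5 := h3 (0, 1)
        simp only [lorentz, mul_zero, sub_zero, inner_self_eq_zero, inner_zero_right, mul_one,
          zero_sub, neg_eq_zero] at h4 h5
        exact Prod.ext h4 h5
      exact hq0 (h2 (by rw [h1, map_zero]))
    rcases lt_or_gt_of_ne hRq with h | h
    · refine ⟨-R, fun x y => ?_, ⟨-r, neg_ne_zero.2 hr, ?_⟩, ?_⟩
      · simp only [LinearMap.neg_apply, lorentz_neg_left, lorentz_neg_right, neg_neg, hR]
      · rw [LinearMap.neg_apply, hRτ]; simp
      · simpa using h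
    · exact ⟨R, hR, ⟨r, hr, hRτ⟩, h⟩
  -- The vector e = (0, s) has the same square as τ, and the sign of s makes ⟨τ, e⟩ ≤ 0. Thus τ + e
  -- is time-like, and the reflection along it sends τ to -e.
  obtain ⟨s, hs, hsτ⟩ : ∃ s : ℝ, s ^ 2 = - lorentz τ τ ∧ 0 ≤ s * τ.2 := by
    have h0 := Real.sq_sqrt (by linarith : 0 ≤ - lorentz τ τ)
    have h1 := Real.sqrt_nonneg (- lorentz τ τ)
    rcases le_total 0 τ.2 with h | h
    · exact ⟨_, h0, mul_nonneg h1 h⟩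
    · exact ⟨-√(- lorentz τ τ), by rw [neg_sq, h0], by nlinarith⟩
  set e : Minkowski m := (0, s) with he
  have hee : lorentz e e = - s ^ 2 := by simp [lorentz, he, pow_two]
  have hτe : lorentz τ e = - (s * τ.2) := by simp [lorentz, he, mul_comm]
  set v := τ + e with hv
  have hvv : lorentz v v = 2 * lorentz τ v := by
    simp only [hv, lorentz_add_left, lorentz_add_right, lorentz_comm e τ]
    linarith
  have hτv : lorentz τ v < 0 := by
    rw [hv, lorentz_add_right]
    linarith
  refine ⟨LinearMap.id - (2 / lorentz v v) • (lorentzForm m v).smulRight v,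
    fun x y => ?_, -s, ?_, ?_⟩
  · simp only [LinearMap.sub_apply, LinearMap.id_apply, LinearMap.smul_apply,
      LinearMap.smulRight_apply, lorentzForm_apply, lorentz_sub_left,
      lorentz_sub_right, lorentz_smul_left, lorentz_smul_right]
    have : lorentz v v ≠ 0 := by rw [hvv]; linarith
    rw [lorentz_comm x v]
    field_simp
    ring
  · intro h
    rw [neg_eq_zero] at h
    rw [h] at hs
    linarith [hs, hτ]
  · have : lorentz τ v ≠ 0 := hτv.ne
    simp only [LinearMap.sub_apply, LinearMap.id_apply, LinearMap.smul_apply,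
      LinearMap.smulRight_apply, lorentzForm_apply, hvv, smul_smul, lorentz_comm v τ]
    have h2 : 2 / (2 * lorentz τ v) * lorentz τ v = 1 := by field_simp
    rw [h2, one_smul, hv, he]
    ext <;> simp

/-- A subspace of Minkowski space contains a time-like vector, or is orthogonal to one, or is
degenerate. -/
theorem timelike_trichotomy (U : Submodule ℝ (Minkowski m)) :
    (∃ τ ∈ U, lorentz τ τ < 0) ∨ (∃ τ, lorentz τ τ < 0 ∧ ∀ x ∈ U, lorentz τ x = 0) ∨
      ∃ n ∈ U, n ≠ 0 ∧ lorentz n n = 0 ∧ ∀ x ∈ U, lorentz n x = 0 := by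
  by_cases h1 : ∃ τ ∈ U, lorentz τ τ < 0
  · exact Or.inl h1
  push Not at h1
  refine Or.inr ?_
  by_cases h2 : ∃ n ∈ U, n ≠ 0 ∧ lorentz n n = 0
  · obtain ⟨n, hn, hn0, hnn⟩ := h2
    refine Or.inr ⟨n, hn, hn0, hnn, fun x hx => ?_⟩
    by_contra hne
    -- The multiple of n is chosen so that the difference has square -1, which contradicts the
    -- absence of time-like vectors in U.
    have key := h1 (x - ((lorentz x x + 1) / (2 * lorentz n x)) • n)
      (U.sub_mem hx (U.smul_mem _ hn))
    simp only [lorentz_sub_left, lorentz_sub_right, lorentz_smul_left, lorentz_smul_right, hnn,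
      lorentz_comm x n] at key
    have e : (lorentz x x + 1) / (2 * lorentz n x) * lorentz n x = (lorentz x x + 1) / 2 := by
      field_simp
    rw [e] at key
    linarith
  · push Not at h2
    refine Or.inl ?_
    have hnd : ((lorentzForm m).restrict U).Nondegenerate := by
      have h3 : ∀ x : U, lorentz (x : Minkowski m) x = 0 → x = 0 := fun x hx => by
        by_contra h0
        exact h2 x x.2 (fun h => h0 (Subtype.ext h)) hx
      exact ⟨fun x hx => h3 x (hx x), fun x hx => h3 x (hx x)⟩
    have hcompl := LinearMap.BilinForm.isCompl_orthogonal_of_restrict_nondegenerate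
      (B := lorentzForm m) (W := U) (fun x y h => by
        rw [lorentzForm_apply] at h ⊢; rw [lorentz_comm, h]) hnd
    -- Here U is positive definite, so the time axis splits into a part a in U and a part b
    -- orthogonal to U. As a has nonnegative square, b must be time-like.
    obtain ⟨a, ha, b, hb, hab⟩ := Submodule.mem_sup.1
      (hcompl.sup_eq_top ▸ Submodule.mem_top : ((0, 1) : Minkowski m) ∈ U ⊔ (lorentzForm m).orthogonal U)
    have hba : ∀ x ∈ U, lorentz x b = 0 := fun x hx => hb x hx
    refine ⟨b, ?_, fun x hx => by rw [lorentz_comm, hba x hx]⟩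
    have e : lorentz (a + b) (a + b) = -1 := by rw [hab]; simp [lorentz]
    rw [lorentz_add_left, lorentz_add_right, lorentz_add_right, lorentz_comm b a, hba a ha] at e
    linarith [h1 a ha]

end Minkowski

/-! ### Derivatives and the Gram matrices of increments. -/

section Gram

variable {E : Type*} [NormedAddCommGroup E] [NormedSpace ℝ E]
  {H : Type*} [TopologicalSpace H] {I : ModelWithCorners ℝ E H} [I.Boundaryless]
  {M : Type*} [TopologicalSpace M] [ChartedSpace H M] [IsManifold I ∞ M]
  {V : Type*} [NormedAddCommGroup V] [NormedSpace ℝ V]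
  {W : Type*} [NormedAddCommGroup W] [NormedSpace ℝ W]

theorem vectorDeriv_comp_linear (L : V →L[ℝ] W) {k : M → V} (hk : ContMDiff I 𝓘(ℝ, V) ∞ k) (p : M)
    (a : E) : vectorDeriv I (fun x => L (k x)) p a = L (vectorDeriv I k p a) := by
  have hLk : ContMDiff I 𝓘(ℝ, W) ∞ fun x => L (k x) := L.contMDiff.comp hk
  rw [vectorDeriv_eq_fderiv hLk, vectorDeriv_eq_fderiv hk]
  have h := (hk.contDiffAt_chart (mem_extChartAt_target (I := I) p)).differentiableAt (by simp)
  have := L.hasFDerivAt.comp _ h.hasFDerivAt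
  exact congrArg (fun T : E →L[ℝ] W => T a) this.fderiv

theorem vectorDeriv_add_const {k : M → V} (hk : ContMDiff I 𝓘(ℝ, V) ∞ k) (c : V) (p : M)
    (a : E) : vectorDeriv I (fun x => k x + c) p a = vectorDeriv I k p a := by
  have hkc : ContMDiff I 𝓘(ℝ, V) ∞ fun x => k x + c := hk.add contMDiff_const
  rw [vectorDeriv_eq_fderiv hkc, vectorDeriv_eq_fderiv hk]
  exact congrArg (fun T : E →L[ℝ] V => T a) (fderiv_add_const c)

theorem vectorDeriv_const (c : V) (p : M) (a : E) : vectorDeriv I (fun _ => c) p a = 0 := by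
  rw [vectorDeriv_eq_fderiv contMDiff_const]
  exact congrArg (fun T : E →L[ℝ] V => T a) (fderiv_const_apply c)

variable [FiniteDimensional ℝ V] [FiniteDimensional ℝ W]

theorem functional_vectorDeriv_eq {k : M → V} {k' : M → W} (hk : ContMDiff I 𝓘(ℝ, V) ∞ k)
    (hk' : ContMDiff I 𝓘(ℝ, W) ∞ k') {φ : V →ₗ[ℝ] ℝ} {φ' : W →ₗ[ℝ] ℝ} {c : ℝ}
    (h : ∀ x, φ (k x) = φ' (k' x) + c) (p : M) (a : E) :
    φ (vectorDeriv I k p a) = φ' (vectorDeriv I k' p a) := by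
  have h1 := vectorDeriv_comp_linear φ.toContinuousLinearMap hk p a
  have h2 := vectorDeriv_comp_linear φ'.toContinuousLinearMap hk' p a
  have h3 := vectorDeriv_add_const (φ'.toContinuousLinearMap.contMDiff.comp hk') c p a
  have e : (fun x => φ.toContinuousLinearMap (k x)) =
      fun x => (φ'.toContinuousLinearMap ∘ k') x + c := funext h
  rw [e, h3] at h1
  exact h1.symm.trans h2

/-- The derivatives of two maps have the same Gram matrices if their increments do. -/
theorem form_vectorDeriv_eq {k : M → V} {k' : M → W} (hk : ContMDiff I 𝓘(ℝ, V) ∞ k)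
    (hk' : ContMDiff I 𝓘(ℝ, W) ∞ k') {B : V →ₗ[ℝ] V →ₗ[ℝ] ℝ} {B' : W →ₗ[ℝ] W →ₗ[ℝ] ℝ} (x₀ : M)
    (h : ∀ x y, B (k x - k x₀) (k y - k x₀) = B' (k' x - k' x₀) (k' y - k' x₀)) (p : M) (a b : E) :
    B (vectorDeriv I k p a) (vectorDeriv I k p b) =
      B' (vectorDeriv I k' p a) (vectorDeriv I k' p b) := by
  have h1 : ∀ y, B (vectorDeriv I k p a) (k y - k x₀) = B' (vectorDeriv I k' p a) (k' y - k' x₀) :=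
    fun y => functional_vectorDeriv_eq hk hk' (φ := B.flip (k y - k x₀))
      (φ' := B'.flip (k' y - k' x₀))
      (c := B (k x₀) (k y - k x₀) - B' (k' x₀) (k' y - k' x₀)) (fun x => by
        have := h x y
        rw [map_sub B, map_sub B', LinearMap.sub_apply, LinearMap.sub_apply] at this
        rw [LinearMap.flip_apply, LinearMap.flip_apply]
        linarith) p a
  exact functional_vectorDeriv_eq hk hk' (c := B (vectorDeriv I k p a) (k x₀) -
    B' (vectorDeriv I k' p a) (k' x₀)) (fun y => by
      have := h1 y
      rw [map_sub (B _), map_sub (B' _)] at this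
      linarith) p b

/-- Transfers the isometry property from the lift to its components, using only scalar products of
increments. -/
theorem IsIsometricImmersion.of_gram {g : SmoothMetric I M} {k : M → V} {k' : M → W}
    {B : V →ₗ[ℝ] V →ₗ[ℝ] ℝ} {B' : W →ₗ[ℝ] W →ₗ[ℝ] ℝ}
    (hk' : IsIsometricImmersion (fun x y => B' x y) g k') (hk : ContMDiff I 𝓘(ℝ, V) ∞ k) (x₀ : M)
    (h : ∀ x y, B (k x - k x₀) (k y - k x₀) = B' (k' x - k' x₀) (k' y - k' x₀)) :
    IsIsometricImmersion (fun x y => B x y) g k :=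
  ⟨hk, fun p X Y => (form_vectorDeriv_eq hk hk'.1 x₀ h p X Y).trans (hk'.2 p X Y)⟩

theorem LinearMap.contMDiff_comp (L : V →ₗ[ℝ] W) {k : M → V} (hk : ContMDiff I 𝓘(ℝ, V) ∞ k) :
    ContMDiff I 𝓘(ℝ, W) ∞ fun x => L (k x) :=
  L.toContinuousLinearMap.contMDiff.comp hk

end Gram

/-! ### Immersions into spheres. -/

section Sphere

variable {E : Type*} [NormedAddCommGroup E] [NormedSpace ℝ E] [Nontrivial E]
  {H : Type*} [TopologicalSpace H] {I : ModelWithCorners ℝ E H} [I.Boundaryless]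
  {M : Type*} [TopologicalSpace M] [ChartedSpace H M] [IsManifold I ∞ M]

theorem IsIsometricImmersion.exists_vectorDeriv_pos {V : Type*} [NormedAddCommGroup V]
    [NormedSpace ℝ V] {B : V → V → ℝ} {g : SmoothMetric I M} {f : M → V}
    (hf : IsIsometricImmersion B g f) (p : M) :
    ∃ a : E, 0 < B (vectorDeriv I f p a) (vectorDeriv I f p a) := by
  obtain ⟨a, ha⟩ := exists_ne (0 : E)
  exact ⟨a, by rw [hf.vectorDeriv_form]; exact metricAt_pos g p ha⟩

/-- An immersion into a sphere: the radius is positive and the dimension of the ambient space is at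
least two. -/
theorem IsIsometricImmersion.pos_and_two_le [Nonempty M] {d : ℕ} {g : SmoothMetric I M}
    {f : M → EuclideanSpace ℝ (Fin d)} (hf : IsIsometricImmersion (euclid d) g f) {R : ℝ}
    (hR : ∀ x, ⟪f x, f x⟫_ℝ = R) : 0 < R ∧ 2 ≤ d := by
  obtain ⟨p⟩ := ‹Nonempty M›
  obtain ⟨a, ha⟩ := hf.exists_vectorDeriv_pos (I := I) p
  set v := vectorDeriv I f p a with hv
  change 0 < ⟪v, v⟫_ℝ at ha
  -- Differentiating the constant |f|² shows that position and tangent vectors are orthogonal. Two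
  -- nonzero orthogonal vectors then force the dimension to be at least two.
  have hvf : ⟪v, f p⟫_ℝ = 0 := by
    have h0 := hf.1.contDiffAt_chart (mem_extChartAt_target (I := I) p)
    have hd := h0.differentiableAt (by simp)
    have h1 : fderiv ℝ (fun z => ⟪(f ∘ (extChartAt I p).symm) z, (f ∘ (extChartAt I p).symm) z⟫_ℝ)
        (extChartAt I p p) a = 0 := by
      have : (fun z => ⟪(f ∘ (extChartAt I p).symm) z, (f ∘ (extChartAt I p).symm) z⟫_ℝ) =
        fun _ => R := funext fun z => hR _
      rw [this, fderiv_const_apply]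
      rfl
    rw [fderiv_inner_apply ℝ hd hd, ← vectorDeriv_eq_fderiv hf.1] at h1
    simp only [Function.comp_apply, extChartAt_to_inv] at h1
    rw [real_inner_comm, ← hv] at h1
    linarith
  have hR0 : 0 ≤ R := by rw [← hR p]; exact real_inner_self_nonneg
  refine ⟨lt_of_le_of_ne hR0 ?_, ?_⟩
  · rintro rfl
    have : f = fun _ => 0 := funext fun x => inner_self_eq_zero.1 (hR x)
    have hv0 : v = 0 := by rw [hv, this, vectorDeriv_const]
    rw [hv0, inner_zero_left] at ha
    exact ha.false
  · by_contra hd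
    have hfp : f p ≠ 0 := by
      intro h
      have : f = fun _ => 0 := funext fun x => inner_self_eq_zero.1 (by
        rw [hR x, ← hR p, h, inner_zero_left])
      have hv0 : v = 0 := by rw [hv, this, vectorDeriv_const]
      rw [hv0, inner_zero_left] at ha
      exact ha.false
    have hv0 : v ≠ 0 := by rintro h; rw [h, inner_zero_left] at ha; exact ha.false
    have hli : LinearIndependent ℝ ![v, f p] := by
      rw [LinearIndependent.pair_iff]
      intro s t hst
      have h1 := congrArg (fun z => ⟪z, v⟫_ℝ) hst
      have h2 := congrArg (fun z => ⟪z, f p⟫_ℝ) hst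
      simp only [inner_add_left, real_inner_smul_left, inner_zero_left, hvf, real_inner_comm v (f p),
        mul_zero, add_zero, zero_add, mul_eq_zero, inner_self_eq_zero] at h1 h2
      exact ⟨h1.resolve_right hv0, h2.resolve_right hfp⟩
    have := hli.fintype_card_le_finrank
    simp at this
    omega

end Sphere

/-- Intermediate value theorem. It fixes the sign of conformal factors and the time orientation of
the lift. -/
theorem pos_of_forall_ne_zero {X : Type*} [TopologicalSpace X] [PreconnectedSpace X] {h : X → ℝ}
    (hh : Continuous h) (h0 : ∀ x, h x ≠ 0) (x y : X) : 0 < h x * h y := by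
  by_contra hlt
  have hlt : h x * h y < 0 := lt_of_le_of_ne (not_lt.1 hlt) (mul_ne_zero (h0 x) (h0 y))
  rcases mul_neg_iff.1 hlt with ⟨h1, h2⟩ | ⟨h1, h2⟩
  · obtain ⟨z, hz⟩ := mem_range_of_exists_le_of_exists_ge hh ⟨y, h2.le⟩ ⟨x, h1.le⟩
    exact h0 z hz
  · obtain ⟨z, hz⟩ := mem_range_of_exists_le_of_exists_ge hh ⟨x, h1.le⟩ ⟨y, h2.le⟩
    exact h0 z hz

/-- Equal Gram matrices give equal forms on formal linear combinations, so the form on the span of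
the u_i is pulled back from a positive semidefinite one. -/
theorem lorentz_self_nonneg_of_gram {ι : Type*} {m d : ℕ} {u : ι → Minkowski m}
    {v : ι → EuclideanSpace ℝ (Fin d)} (h : ∀ i j, lorentz (u i) (u j) = ⟪v i, v j⟫_ℝ)
    {x : Minkowski m} (hx : x ∈ Submodule.span ℝ (Set.range u)) : 0 ≤ lorentz x x := by
  rw [← Finsupp.range_linearCombination] at hx
  obtain ⟨c, rfl⟩ := hx
  have e : (lorentzForm m).compl₁₂ (Finsupp.linearCombination ℝ u) (Finsupp.linearCombination ℝ u) =
      (innerₗ (EuclideanSpace ℝ (Fin d))).compl₁₂ (Finsupp.linearCombination ℝ v)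
        (Finsupp.linearCombination ℝ v) := by
    ext i j
    simpa [lorentzForm_apply] using h i j
  have := congrArg (fun B => B c c) e
  simp only [LinearMap.compl₁₂_apply, lorentzForm_apply, innerₗ_apply_apply] at this
  rw [this]
  exact real_inner_self_nonneg

theorem IsIsometricImmersion.comp_linear {E : Type*} [NormedAddCommGroup E] [NormedSpace ℝ E]
    {H : Type*} [TopologicalSpace H] {I : ModelWithCorners ℝ E H} [I.Boundaryless]
    {M : Type*} [TopologicalSpace M] [ChartedSpace H M] [IsManifold I ∞ M]
    {V : Type*} [NormedAddCommGroup V] [NormedSpace ℝ V] [FiniteDimensional ℝ V]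
    {W : Type*} [NormedAddCommGroup W] [NormedSpace ℝ W] {B : V → V → ℝ} {B' : W → W → ℝ}
    {g : SmoothMetric I M} {k : M → V} (hk : IsIsometricImmersion B g k) (L : V →ₗ[ℝ] W)
    (hL : ∀ x y, B' (L x) (L y) = B x y) : IsIsometricImmersion B' g fun x => L (k x) := by
  refine ⟨L.toContinuousLinearMap.contMDiff.comp hk.1, fun p a b => ?_⟩
  have h := vectorDeriv_comp_linear L.toContinuousLinearMap hk.1 p
  refine Eq.trans ?_ (hk.2 p a b)
  exact (congrArg₂ B' (h a) (h b)).trans (hL _ _)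

/-! ### Immersions into the light cone that split as sums -/

section ConeSplitting

variable {E₁ : Type*} [NormedAddCommGroup E₁] [NormedSpace ℝ E₁]
  {H₁ : Type*} [TopologicalSpace H₁] {I₁ : ModelWithCorners ℝ E₁ H₁} [I₁.Boundaryless]
  {M₁ : Type*} [TopologicalSpace M₁] [ChartedSpace H₁ M₁] [IsManifold I₁ ∞ M₁]
  {E₂ : Type*} [NormedAddCommGroup E₂] [NormedSpace ℝ E₂]
  {H₂ : Type*} [TopologicalSpace H₂] {I₂ : ModelWithCorners ℝ E₂ H₂} [I₂.Boundaryless]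
  {M₂ : Type*} [TopologicalSpace M₂] [ChartedSpace H₂ M₂] [IsManifold I₂ ∞ M₂]
  {N : ℕ}

/-- `F` is an isometric immersion of the Riemannian product `(M₁, h₁) × (M₂, h₂)` into the light
cone, a positive multiple of the immersion `f` embedded by `T`, and a sum of functions on the
factors. -/
structure IsConeSplitting (T : ConeTriple N) (h₁ : SmoothMetric I₁ M₁) (h₂ : SmoothMetric I₂ M₂)
    (f : M₁ → M₂ → EuclideanSpace ℝ (Fin N)) (F : M₁ → M₂ → Minkowski (N + 1)) : Prop where
  smooth_fst : ∀ y, ContMDiff I₁ 𝓘(ℝ, EuclideanSpace ℝ (Fin N)) ∞ fun x => f x y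
  smooth_snd : ∀ x, ContMDiff I₂ 𝓘(ℝ, EuclideanSpace ℝ (Fin N)) ∞ (f x)
  isometric_fst : ∀ y, IsIsometricImmersion lorentz h₁ fun x => F x y
  isometric_snd : ∀ x, IsIsometricImmersion lorentz h₂ (F x)
  pos : ∀ x y, 0 < lorentz (F x y) T.w
  eq_smul : ∀ x y, F x y = lorentz (F x y) T.w • T.embed (f x y)
  add_eq_add : ∀ x x' y y', F x y + F x' y' = F x' y + F x y'

namespace IsConeSplitting

variable {T : ConeTriple N} {h₁ : SmoothMetric I₁ M₁} {h₂ : SmoothMetric I₂ M₂}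
  {f : M₁ → M₂ → EuclideanSpace ℝ (Fin N)} {F : M₁ → M₂ → Minkowski (N + 1)}

theorem symm (S : IsConeSplitting T h₁ h₂ f F) :
    IsConeSplitting T h₂ h₁ (fun y x => f x y) (fun y x => F x y) where
  smooth_fst := S.smooth_snd
  smooth_snd := S.smooth_fst
  isometric_fst := S.isometric_snd
  isometric_snd := S.isometric_fst
  pos y x := S.pos x y
  eq_smul y x := S.eq_smul x y
  add_eq_add y y' x x' := by rw [S.add_eq_add]; exact add_comm _ _

theorem lorentz_eq (S : IsConeSplitting T h₁ h₂ f F) (x x' : M₁) (y y' : M₂) :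
    lorentz (F x y) (F x' y') = lorentz (F x y) T.w * lorentz (F x' y') T.w *
      (-(1 / 2) * ‖f x y - f x' y'‖ ^ 2) := by
  conv_lhs => rw [S.eq_smul x y, S.eq_smul x' y', lorentz_smul_left, lorentz_smul_right,
    T.lorentz_embed]
  ring

theorem null (S : IsConeSplitting T h₁ h₂ f F) (x : M₁) (y : M₂) : lorentz (F x y) (F x y) = 0 := by
  rw [S.lorentz_eq, sub_self, norm_zero]; ring

theorem ne_zero (S : IsConeSplitting T h₁ h₂ f F) (x : M₁) (y : M₂) : F x y ≠ 0 := by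
  intro h
  have := S.pos x y
  rw [h, lorentz_zero_left] at this
  exact this.false

theorem snd_ne_zero (S : IsConeSplitting T h₁ h₂ f F) (x : M₁) (y : M₂) : (F x y).2 ≠ 0 :=
  fun h => S.ne_zero x y (eq_zero_of_lightlike_of_snd_eq_zero (S.null x y) h)

theorem sub_eq_sub (S : IsConeSplitting T h₁ h₂ f F) (x x' : M₁) (y y' : M₂) :
    F x y - F x' y = F x y' - F x' y' := by
  rw [sub_eq_sub_iff_add_eq_add, S.add_eq_add]; exact add_comm _ _

/-- The four points of F over a coordinate rectangle form a parallelogram with null vertices.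
Expanding the nullity of the fourth vertex in terms of the other three leaves exactly the product of
the two sides. -/
theorem lorentz_sub_sub (S : IsConeSplitting T h₁ h₂ f F) (x x' x'' : M₁) (y y' y'' : M₂) :
    lorentz (F x y'' - F x' y'') (F x'' y - F x'' y') = 0 := by
  have e : F x'' y - F x'' y' = F x y - F x y' := S.symm.sub_eq_sub y y' x'' x
  rw [S.sub_eq_sub x x' y'' y, e]
  have hn := S.null x' y'
  have e2 : F x' y' = F x' y + F x y' - F x y := by rw [← S.add_eq_add, add_sub_cancel_left]
  rw [e2] at hn
  simp only [lorentz_add_left, lorentz_add_right, lorentz_sub_left, lorentz_sub_right, S.null,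
    lorentz_comm (F x y) (F x' y), lorentz_comm (F x y') (F x' y),
    lorentz_comm (F x y') (F x y)] at hn ⊢
  linarith

theorem map (S : IsConeSplitting T h₁ h₂ f F) (R : Minkowski (N + 1) →ₗ[ℝ] Minkowski (N + 1))
    (hR : ∀ x y, lorentz (R x) (R y) = lorentz x y) :
    IsConeSplitting (T.map R hR) h₁ h₂ f (fun x y => R (F x y)) where
  smooth_fst := S.smooth_fst
  smooth_snd := S.smooth_snd
  isometric_fst y := (S.isometric_fst y).comp_linear R hR
  isometric_snd x := (S.isometric_snd x).comp_linear R hR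
  pos x y := by
    rw [show (T.map R hR).w = R T.w from rfl, hR]
    exact S.pos x y
  eq_smul x y := by
    rw [T.map_embed, show (T.map R hR).w = R T.w from rfl, hR, ← map_smul, ← S.eq_smul]
  add_eq_add x x' y y' := by rw [← map_add, S.add_eq_add, map_add]

end IsConeSplitting

end ConeSplitting

/-! ### The two hyperbolic forms exclude each other. -/

section ConeSplitting

variable {E₁ : Type*} [NormedAddCommGroup E₁] [NormedSpace ℝ E₁] [Nontrivial E₁]
  {H₁ : Type*} [TopologicalSpace H₁] {I₁ : ModelWithCorners ℝ E₁ H₁} [I₁.Boundaryless]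
  {M₁ : Type*} [TopologicalSpace M₁] [ChartedSpace H₁ M₁] [IsManifold I₁ ∞ M₁]
  {E₂ : Type*} [NormedAddCommGroup E₂] [NormedSpace ℝ E₂] [Nontrivial E₂]
  {H₂ : Type*} [TopologicalSpace H₂] {I₂ : ModelWithCorners ℝ E₂ H₂} [I₂.Boundaryless]
  {M₂ : Type*} [TopologicalSpace M₂] [ChartedSpace H₂ M₂] [IsManifold I₂ ∞ M₂]
  {N : ℕ} {T : ConeTriple N} {h₁ : SmoothMetric I₁ M₁} {h₂ : SmoothMetric I₂ M₂}
  {f : M₁ → M₂ → EuclideanSpace ℝ (Fin N)} {F : M₁ → M₂ → Minkowski (N + 1)}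

namespace IsConeSplitting

/-- If the second factor is mapped into the spherical part in a decomposition involving a hyperbolic
space, then the increments of `F` along this factor do not span time-like vectors. -/
theorem nonneg_of_isHyperbolicForm [ConnectedSpace M₂] (S : IsConeSplitting T h₁ h₂ f F)
    (hyp : IsHyperbolicForm h₁ h₂ f) (x₀ : M₁) (y₀ : M₂) {v : Minkowski (N + 1)}
    (hv : v ∈ Submodule.span ℝ (Set.range fun y => F x₀ y - F x₀ y₀)) : 0 ≤ lorentz v v := by
  obtain ⟨m, d, d₂, c, c₂, T', L, Θ, Ψ, f₁, f₂, -, -, hc, hc₂, hΘ, hΨ, hf₁, hf₁c, hf₂, hf₂c, hf⟩ := hyp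
  -- K is the lift of f(x₀, ·) provided by the hyperbolic form, and its increments are those of f₂
  -- up to isometry. It will be compared with F(x₀, ·), the lift for a possibly different cone
  -- triple.
  set K : M₂ → Minkowski (N + 1) := fun y => L.map (f₁ x₀) (Ψ.map fun _ => f₂ y) with hK
  set κ : M₂ → ℝ := fun y => lorentz (K y) T'.w with hκ
  have hmap : ∀ y, (Ψ.map fun _ => f₂ y) = Ψ.incl () (f₂ y) + Ψ.const := fun y => by
    simp [ExtrinsicProduct.map]
  have hKsub : ∀ y y', K y - K y' = L.D (Ψ.incl () (f₂ y) - Ψ.incl () (f₂ y')) := fun y y' => by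
    simp only [hK, LorentzSplitting.map, hmap, map_add, map_sub]
    abel
  have hKgram : ∀ y y', lorentz (K y - K y₀) (K y' - K y₀) =
      ⟪f₂ y - f₂ y₀, f₂ y' - f₂ y₀⟫_ℝ := fun y y' => by
    rw [hKsub, hKsub, L.D_isometry, ← map_sub, ← map_sub, LinearIsometry.inner_map_map]
  have hKsmooth : ContMDiff I₂ 𝓘(ℝ, Minkowski (N + 1)) ∞ K := by
    have e : K = fun y => (L.D ∘ₗ (Ψ.incl ()).toLinearMap) (f₂ y) + (L.C (f₁ x₀) + L.D Ψ.const) := by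
      funext y
      simp only [hK, LorentzSplitting.map, hmap, map_add, LinearMap.comp_apply]
      simp only [LinearIsometry.coe_toLinearMap]
      abel
    rw [e]
    exact (LinearMap.contMDiff_comp _ hf₂.1).add contMDiff_const
  have hKiso : IsIsometricImmersion lorentz h₂ K :=
    IsIsometricImmersion.of_gram (B := lorentzForm (N + 1))
      (B' := innerₗ (EuclideanSpace ℝ (Fin d₂))) hf₂ hKsmooth y₀ hKgram
  have hKeq : ∀ y, K y = κ y • T'.embed (f x₀ y) := fun y => by
    have hmem : (Ψ.map fun _ => f₂ y) ∈ spaceForm d c := hΨ _ fun _ => hf₂c y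
    have := hΘ (f₁ x₀) (hf₁c x₀) _ hmem (hf x₀ y).1
    rw [(hf x₀ y).2, this, smul_inv_smul₀ (hf x₀ y).1]
  have hκ0 : ∀ y, κ y ≠ 0 := fun y => (hf x₀ y).1
  have hκs : ContMDiff I₂ 𝓘(ℝ, ℝ) ∞ κ :=
    LinearMap.contMDiff_comp ((lorentzForm (N + 1)).flip T'.w) hKsmooth
  have hls : ContMDiff I₂ 𝓘(ℝ, ℝ) ∞ fun y => lorentz (F x₀ y) T.w :=
    LinearMap.contMDiff_comp ((lorentzForm (N + 1)).flip T.w) (S.isometric_snd x₀).1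
  -- Both lifts induce the metric h₂ and are multiples of cone embeddings of the same map, so the
  -- squares of their scaling factors agree.
  have hsq : ∀ y, κ y ^ 2 = lorentz (F x₀ y) T.w ^ 2 := fun y => by
    obtain ⟨a, ha⟩ := exists_ne (0 : E₂)
    have hpos := metricAt_pos h₂ y ha
    have e1 := T'.lorentz_vectorDeriv_smul_embed (S.smooth_snd x₀) hκs y a a
    have e2 := T.lorentz_vectorDeriv_smul_embed (S.smooth_snd x₀) hls y a a
    rw [← funext hKeq, hKiso.vectorDeriv_form] at e1
    rw [← funext (S.eq_smul x₀), (S.isometric_snd x₀).vectorDeriv_form] at e2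
    have hne : ⟪vectorDeriv I₂ (f x₀) y a, vectorDeriv I₂ (f x₀) y a⟫_ℝ ≠ 0 := by
      intro h
      rw [h, mul_zero] at e1
      exact hpos.ne' e1
    exact mul_right_cancel₀ hne (e1.symm.trans e2)
  -- Connectedness of M₂ makes the products of scaling factors positive on both sides. The two lifts
  -- then have equal Gram matrices, since scalar products are determined by these factors and the
  -- distances in ℝ^N.
  have hgram : ∀ y y', lorentz (K y) (K y') = lorentz (F x₀ y) (F x₀ y') := fun y y' => by
    rw [S.lorentz_eq, hKeq y, hKeq y', lorentz_smul_left, lorentz_smul_right, T'.lorentz_embed,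
      ← mul_assoc]
    congr 1
    have h1 := pos_of_forall_ne_zero hκs.continuous hκ0 y y'
    have h2 := mul_pos (S.pos x₀ y) (S.pos x₀ y')
    have h3 : (κ y * κ y') ^ 2 = (lorentz (F x₀ y) T.w * lorentz (F x₀ y') T.w) ^ 2 := by
      rw [mul_pow, mul_pow, hsq, hsq]
    exact (pow_left_inj₀ h1.le h2.le two_ne_zero).1 h3
  refine lorentz_self_nonneg_of_gram (v := fun y => f₂ y - f₂ y₀) (fun y y' => ?_) hv
  rw [← hKgram]
  simp only [lorentz_sub_left, lorentz_sub_right, hgram]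

end IsConeSplitting

end ConeSplitting

/-- Orthonormal coordinates on a subspace, needed because the factors of extrinsic products and of
Lorentz splittings are coordinate spaces. -/
theorem exists_linearIsometry_comp_eq_starProjection {K : ℕ}
    (W : Submodule ℝ (EuclideanSpace ℝ (Fin K))) :
    ∃ (d : ℕ) (ι : EuclideanSpace ℝ (Fin d) →ₗᵢ[ℝ] EuclideanSpace ℝ (Fin K))
      (p : EuclideanSpace ℝ (Fin K) →ₗ[ℝ] EuclideanSpace ℝ (Fin d)),
      d = Module.finrank ℝ W ∧ (∀ x, ι x ∈ W) ∧ ∀ z, ι (p z) = W.starProjection z := by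
  let b := stdOrthonormalBasis ℝ W
  refine ⟨_, W.subtypeₗᵢ.comp b.repr.symm.toLinearIsometry,
    b.repr.toLinearEquiv.toLinearMap ∘ₗ W.orthogonalProjectionOnto.toLinearMap, rfl, fun x => ?_, fun z => ?_⟩
  · exact (b.repr.symm x).2
  · change ((b.repr.symm (b.repr (W.orthogonalProjectionOnto z)) : W) : EuclideanSpace ℝ (Fin K)) = _
    rw [LinearIsometryEquiv.symm_apply_apply]
    rfl

/-! ### The hyperbolic form. -/

section ConeSplitting

variable {E₁ : Type*} [NormedAddCommGroup E₁] [NormedSpace ℝ E₁] [Nontrivial E₁]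
  {H₁ : Type*} [TopologicalSpace H₁] {I₁ : ModelWithCorners ℝ E₁ H₁} [I₁.Boundaryless]
  {M₁ : Type*} [TopologicalSpace M₁] [ChartedSpace H₁ M₁] [IsManifold I₁ ∞ M₁]
  {E₂ : Type*} [NormedAddCommGroup E₂] [NormedSpace ℝ E₂] [Nontrivial E₂]
  {H₂ : Type*} [TopologicalSpace H₂] {I₂ : ModelWithCorners ℝ E₂ H₂} [I₂.Boundaryless]
  {M₂ : Type*} [TopologicalSpace M₂] [ChartedSpace H₂ M₂] [IsManifold I₂ ∞ M₂]
  {N : ℕ} {T : ConeTriple N} {h₁ : SmoothMetric I₁ M₁} {h₂ : SmoothMetric I₂ M₂}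
  {f : M₁ → M₂ → EuclideanSpace ℝ (Fin N)} {F : M₁ → M₂ → Minkowski (N + 1)}

theorem one_le_of_isIsometricImmersion_lorentz [Nonempty M₁] {m : ℕ} {k : M₁ → Minkowski m}
    (hk : IsIsometricImmersion lorentz h₁ k) : 1 ≤ m := by
  obtain ⟨p⟩ := ‹Nonempty M₁›
  obtain ⟨a, ha⟩ := hk.exists_vectorDeriv_pos (I := I₁) p
  rcases Nat.eq_zero_or_pos m with rfl | h
  · rw [lorentz, Subsingleton.elim (vectorDeriv I₁ k p a).1 0, inner_zero_left] at ha
    nlinarith [mul_self_nonneg (vectorDeriv I₁ k p a).2]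
  · exact h

namespace IsConeSplitting

theorem snd_pos [PreconnectedSpace M₁] [PreconnectedSpace M₂] (S : IsConeSplitting T h₁ h₂ f F)
    {x₀ : M₁} {y₀ : M₂} (h : 0 < (F x₀ y₀).2) (x : M₁) (y : M₂) : 0 < (F x y).2 := by
  have c1 : Continuous fun x => (F x y₀).2 :=
    continuous_snd.comp (S.isometric_fst y₀).1.continuous
  have c2 : Continuous fun y => (F x y).2 := continuous_snd.comp (S.isometric_snd x).1.continuous
  have h1 := pos_of_forall_ne_zero c1 (fun x => S.snd_ne_zero x y₀) x₀ x
  have h2 := pos_of_forall_ne_zero c2 (fun y => S.snd_ne_zero x y) y₀ y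
  exact (mul_pos_iff_of_pos_left ((mul_pos_iff_of_pos_left h).1 h1)).1 h2

theorem lorentz_sub_eq_zero (S : IsConeSplitting T h₁ h₂ f F) {x₀ : M₁} {y₀ : M₂}
    {v : Minkowski (N + 1)} (hv : v ∈ Submodule.span ℝ (Set.range fun x => F x y₀ - F x₀ y₀))
    (x : M₁) (y y' : M₂) : lorentz v (F x y - F x y') = 0 := by
  induction hv using Submodule.span_induction with
  | mem v hv =>
    obtain ⟨x', rfl⟩ := hv
    exact S.lorentz_sub_sub _ _ _ _ _ _
  | zero => exact lorentz_zero_left _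
  | add v w _ _ hv hw => rw [lorentz_add_left, hv, hw, add_zero]
  | smul c v _ hv => rw [lorentz_smul_left, hv, mul_zero]

/-- Let W be the spatial projection of the span V of the increments along M₁. As V contains the time
axis, orthogonality of the increments makes the time coordinate and the W-component of F independent
of y, while the W^⊥-component is independent of x. So F is a sum f₁(x) + f₂(y) in a Lorentzian and a
Euclidean summand. Nullity says ⟨f₁, f₁⟩ = -|f₂|², where both sides must be constant: f₁ lies on a
hyperboloid and f₂ on a sphere. -/
theorem isHyperbolicForm_of_time_axis_mem [ConnectedSpace M₁] [ConnectedSpace M₂]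
    (S : IsConeSplitting T h₁ h₂ f F) {x₀ : M₁} {y₀ : M₂} (hpos : 0 < (F x₀ y₀).2)
    (hτ : ((0, 1) : Minkowski (N + 1)) ∈ Submodule.span ℝ (Set.range fun x => F x y₀ - F x₀ y₀)) :
    IsHyperbolicForm h₁ h₂ f := by
  set V := Submodule.span ℝ (Set.range fun x => F x y₀ - F x₀ y₀) with hV
  set W : Submodule ℝ (EuclideanSpace ℝ (Fin (N + 1))) := V.map (LinearMap.fst ℝ _ _) with hW
  obtain ⟨m, ι, p, hm, hι, hιp⟩ := exists_linearIsometry_comp_eq_starProjection W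
  obtain ⟨d, j, q, hd, hj, hjq⟩ := exists_linearIsometry_comp_eq_starProjection Wᗮ
  have hadd : ∀ z, ι (p z) + j (q z) = z := fun z => by
    rw [hιp, hjq, Submodule.starProjection_add_starProjection_orthogonal]
  have hij : ∀ x y, ⟪ι x, j y⟫_ℝ = 0 := fun x y => (hj y) _ (hι x)
  have hsnd : ∀ x y y', (F x y).2 = (F x y').2 := fun x y y' => by
    have := S.lorentz_sub_eq_zero hτ x y y'
    simp only [lorentz, inner_zero_left, Prod.snd_sub] at this
    linarith
  have hp : ∀ x y, p (F x y).1 = p (F x y₀).1 := fun x y => by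
    rw [← sub_eq_zero, ← map_sub]
    apply ι.injective
    rw [map_zero, hιp, Submodule.starProjection_apply_eq_zero_iff]
    rintro _ ⟨v, hv, rfl⟩
    have := S.lorentz_sub_eq_zero hv x y y₀
    simp only [lorentz, Prod.snd_sub, hsnd x y y₀, sub_self, mul_zero, sub_zero] at this
    exact this
  have hq : ∀ x y, q (F x y).1 = q (F x₀ y).1 := fun x y => by
    rw [← sub_eq_zero, ← map_sub]
    apply j.injective
    rw [map_zero, hjq, Submodule.starProjection_apply_eq_zero_iff]
    refine Submodule.le_orthogonal_orthogonal _ ?_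
    refine ⟨F x y₀ - F x₀ y₀, Submodule.subset_span ⟨x, rfl⟩, ?_⟩
    rw [← S.sub_eq_sub x x₀ y y₀]
    rfl
  have hdim : m + d = N + 1 := by
    have := Submodule.finrank_add_finrank_orthogonal W
    rw [hm, hd, this]
    simp
  let f₁ : M₁ → Minkowski m := fun x => (p (F x y₀).1, (F x y₀).2)
  let f₂ : M₂ → EuclideanSpace ℝ (Fin d) := fun y => q (F x₀ y).1
  let L : LorentzSplitting m d N :=
    { dim := by omega
      C := LinearMap.prodMap ι.toLinearMap LinearMap.id
      D := LinearMap.inl ℝ _ ℝ ∘ₗ j.toLinearMap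
      C_isometry := fun X Y => by simp [lorentz]
      D_isometry := fun X Y => by simp [lorentz]
      orthogonal := fun X Y => by simp [lorentz, hij] }
  have hF : ∀ x y, F x y = L.map (f₁ x) (f₂ y) := fun x y => by
    have h1 := hadd (F x y).1
    rw [hp, hq] at h1
    refine Prod.ext ?_ ?_
    · simpa [L, LorentzSplitting.map, f₁, f₂] using h1.symm
    · simpa [L, LorentzSplitting.map, f₁, f₂] using hsnd x y y₀
  have hnorm : ∀ x y, lorentz (f₁ x) (f₁ x) + ⟪f₂ y, f₂ y⟫_ℝ = 0 := fun x y => by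
    have := S.null x y
    simp only [hF, LorentzSplitting.map, lorentz_add_left, lorentz_add_right, L.C_isometry,
      L.D_isometry, L.orthogonal, lorentz_comm (L.D _) (L.C _)] at this
    linarith
  have hs₁ : ContMDiff I₁ 𝓘(ℝ, Minkowski m) ∞ f₁ :=
    LinearMap.contMDiff_comp (LinearMap.prodMap p LinearMap.id) (S.isometric_fst y₀).1
  have hs₂ : ContMDiff I₂ 𝓘(ℝ, EuclideanSpace ℝ (Fin d)) ∞ f₂ :=
    LinearMap.contMDiff_comp (q ∘ₗ LinearMap.fst ℝ _ ℝ) (S.isometric_snd x₀).1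
  have hf₁ : IsIsometricImmersion lorentz h₁ f₁ :=
    IsIsometricImmersion.of_gram (B := lorentzForm m) (B' := lorentzForm (N + 1))
      (S.isometric_fst y₀) hs₁ x₀ fun x x' => by
        simp only [lorentzForm_apply, hF, LorentzSplitting.map, add_sub_add_right_eq_sub, ← map_sub,
          L.C_isometry]
  have hf₂ : IsIsometricImmersion (euclid d) h₂ f₂ :=
    IsIsometricImmersion.of_gram (B := innerₗ (EuclideanSpace ℝ (Fin d)))
      (B' := lorentzForm (N + 1)) (S.isometric_snd x₀) hs₂ y₀ fun y y' => by
        simp only [lorentzForm_apply, hF, LorentzSplitting.map, add_sub_add_left_eq_sub, ← map_sub,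
          L.D_isometry, innerₗ_apply_apply]
  have hR : ∀ y, ⟪f₂ y, f₂ y⟫_ℝ = ⟪f₂ y₀, f₂ y₀⟫_ℝ := fun y => by
    linarith [hnorm x₀ y, hnorm x₀ y₀]
  -- R is the squared radius of the sphere, so c = 1/R. It is positive because f₂ is an immersion of
  -- a manifold of positive dimension.
  obtain ⟨hRpos, hd2⟩ := hf₂.pos_and_two_le hR
  set R := ⟪f₂ y₀, f₂ y₀⟫_ℝ with hRdef
  have hm1 := one_le_of_isIsometricImmersion_lorentz hf₁
  classical
  let Θ : Minkowski m → EuclideanSpace ℝ (Fin d) → EuclideanSpace ℝ (Fin N) := fun X Y =>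
    if h : ∃ z, T.embed z = (lorentz (L.map X Y) T.w)⁻¹ • L.map X Y then h.choose else 0
  have hΘ : IsTheta (1 / R) T L Θ := by
    intro X hX Y hY hne
    have hex : ∃ z, T.embed z = (lorentz (L.map X Y) T.w)⁻¹ • L.map X Y := by
      refine T.exists_embed_eq ?_ ?_
      · have : lorentz (L.map X Y) (L.map X Y) = 0 := by
          rw [LorentzSplitting.map, lorentz_add_left, lorentz_add_right, lorentz_add_right,
            L.C_isometry, L.D_isometry, lorentz_comm (L.D _), L.orthogonal, hX.1,
            hY (by positivity)]
          ring
        rw [lorentz_smul_left, lorentz_smul_right, this, mul_zero, mul_zero]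
      · rw [lorentz_smul_left, inv_mul_cancel₀ hne]
    simp only [Θ, dif_pos hex]
    exact hex.choose_spec
  have hmem₁ : ∀ x, f₁ x ∈ hyperbolicSpace m (1 / R) := fun x =>
    ⟨by rw [one_div_one_div]; linarith [hnorm x y₀], S.snd_pos hpos x y₀⟩
  have hmem₂ : ∀ y, f₂ y ∈ spaceForm d (1 / R) := fun y _ => by rw [one_div_one_div, hR]
  -- The spherical part already lies in the sphere of the splitting, so the one-factor extrinsic
  -- product can be taken to be the identity.
  let Ψ : ExtrinsicProduct (fun _ : Unit => d) (fun _ => 1 / R) d :=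
    { nonneg := fun _ => by positivity
      two_le := fun _ _ => hd2
      incl := fun _ => LinearIsometry.id
      incl_orthogonal := fun i j hij => absurd (Subsingleton.elim i j) hij
      const := 0
      const_orthogonal := fun _ _ => inner_zero_right _ }
  have hΨ : ∀ x : ∀ _ : Unit, EuclideanSpace ℝ (Fin d), Ψ.map x = x () := fun x => by
    simp [Ψ, ExtrinsicProduct.map]
  refine ⟨m, d, d, 1 / R, 1 / R, T, L, Θ, Ψ, f₁, f₂, hm1, hd2, by positivity, by positivity, hΘ,
    fun x hx => by rw [hΨ]; exact hx (), hf₁, hmem₁, hf₂, hmem₂, fun x y => ?_⟩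
  rw [hΨ, ← hF]
  refine ⟨(S.pos x y).ne', T.embed_injective ?_⟩
  rw [hΘ _ (hmem₁ x) _ (hmem₂ y) (by rw [← hF]; exact (S.pos x y).ne'), ← hF]
  conv_rhs => rw [S.eq_smul x y]
  rw [lorentz_smul_left, T.lorentz_embed_w, mul_one, inv_smul_smul₀ (S.pos x y).ne']

/-- A linear isometry moves τ to the time axis and makes F future directed. The cone triple is moved
along with F, which leaves f unchanged. -/
theorem isHyperbolicForm_of_timelike_mem [ConnectedSpace M₁] [ConnectedSpace M₂]
    (S : IsConeSplitting T h₁ h₂ f F) {x₀ : M₁} {y₀ : M₂} {τ : Minkowski (N + 1)}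
    (hτ : lorentz τ τ < 0) (hmem : τ ∈ Submodule.span ℝ (Set.range fun x => F x y₀ - F x₀ y₀)) :
    IsHyperbolicForm h₁ h₂ f := by
  obtain ⟨R, hR, ⟨r, hr, hRτ⟩, hpos⟩ := exists_lorentz_isometry hτ (S.null x₀ y₀) (S.ne_zero x₀ y₀)
  refine (S.map R hR).isHyperbolicForm_of_time_axis_mem (x₀ := x₀) (y₀ := y₀) hpos ?_
  have h1 := Submodule.mem_map_of_mem (f := R) hmem
  rw [Submodule.map_span, ← Set.range_comp, hRτ] at h1
  have h2 := Submodule.smul_mem _ r⁻¹ h1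
  have e : r⁻¹ • ((0, r) : Minkowski (N + 1)) = (0, 1) := by
    ext <;> simp [hr]
  rw [e] at h2
  convert h2 using 3
  funext x
  simp

end IsConeSplitting

end ConeSplitting

/-! ### Extrinsic products in Euclidean space. -/

section ExtrinsicProducts

variable {E₁ : Type*} [NormedAddCommGroup E₁] [NormedSpace ℝ E₁] [Nontrivial E₁]
  {H₁ : Type*} [TopologicalSpace H₁] {I₁ : ModelWithCorners ℝ E₁ H₁} [I₁.Boundaryless]
  {M₁ : Type*} [TopologicalSpace M₁] [ChartedSpace H₁ M₁] [IsManifold I₁ ∞ M₁]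
  {E₂ : Type*} [NormedAddCommGroup E₂] [NormedSpace ℝ E₂] [Nontrivial E₂]
  {H₂ : Type*} [TopologicalSpace H₂] {I₂ : ModelWithCorners ℝ E₂ H₂} [I₂.Boundaryless]
  {M₂ : Type*} [TopologicalSpace M₂] [ChartedSpace H₂ M₂] [IsManifold I₂ ∞ M₂]
  {K : ℕ} {h₁ : SmoothMetric I₁ M₁} {h₂ : SmoothMetric I₂ M₂}

theorem isExtrinsicProductImmersion_of_eq_add {d₁ d₂ : ℕ} {a c₁ c₂ : ℝ}
    {F : M₁ → M₂ → EuclideanSpace ℝ (Fin K)}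
    {ι₁ : EuclideanSpace ℝ (Fin d₁) →ₗᵢ[ℝ] EuclideanSpace ℝ (Fin K)}
    {ι₂ : EuclideanSpace ℝ (Fin d₂) →ₗᵢ[ℝ] EuclideanSpace ℝ (Fin K)}
    {v : EuclideanSpace ℝ (Fin K)} {f₁ : M₁ → EuclideanSpace ℝ (Fin d₁)}
    {f₂ : M₂ → EuclideanSpace ℝ (Fin d₂)} (hι : ∀ x y, ⟪ι₁ x, ι₂ y⟫_ℝ = 0)
    (hv₁ : ∀ x, ⟪ι₁ x, v⟫_ℝ = 0) (hv₂ : ∀ y, ⟪ι₂ y, v⟫_ℝ = 0)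
    (hf₁ : IsIsometricImmersion (euclid d₁) h₁ f₁) (hf₂ : IsIsometricImmersion (euclid d₂) h₂ f₂)
    (hF : ∀ x y, F x y = ι₁ (f₁ x) + ι₂ (f₂ y) + v) (hc₁ : 0 ≤ c₁) (hc₂ : 0 ≤ c₂)
    (hd₁ : c₁ ≠ 0 → 2 ≤ d₁) (hd₂ : c₂ ≠ 0 → 2 ≤ d₂)
    (hmem₁ : ∀ x, f₁ x ∈ spaceForm d₁ c₁) (hmem₂ : ∀ y, f₂ y ∈ spaceForm d₂ c₂)
    (ha : ∀ x ∈ spaceForm d₁ c₁, ∀ y ∈ spaceForm d₂ c₂, ι₁ x + ι₂ y + v ∈ spaceForm K a) :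
    IsExtrinsicProductImmersion a h₁ h₂ fun p => F p.1 p.2 := by
  let d : Fin 2 → ℕ := Fin.cons d₁ fun _ => d₂
  let c : Fin 2 → ℝ := Fin.cons c₁ fun _ => c₂
  let incl : ∀ i, EuclideanSpace ℝ (Fin (d i)) →ₗᵢ[ℝ] EuclideanSpace ℝ (Fin K) :=
    Fin.cases ι₁ fun _ => ι₂
  let Ψ : ExtrinsicProduct d c K :=
    { nonneg := Fin.cases hc₁ fun _ => hc₂
      two_le := Fin.cases hd₁ fun _ => hd₂
      incl := incl
      incl_orthogonal := by
        refine Fin.cases (Fin.cases (fun h => absurd rfl h) fun _ _ => hι) fun i => Fin.cases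
          (fun _ x y => ?_) fun j h => absurd (congrArg Fin.succ (Subsingleton.elim i j)) h
        rw [real_inner_comm]
        exact hι y x
      const := v
      const_orthogonal := Fin.cases hv₁ fun _ => hv₂ }
  have hΨ : ∀ x, Ψ.map x = ι₁ (x 0) + ι₂ (x 1) + v := fun x => by
    rw [ExtrinsicProduct.map, Fin.sum_univ_two]
    rfl
  refine ⟨d, c, Ψ, f₁, f₂, fun x hx => ?_, hf₁, hmem₁, hf₂, hmem₂, fun p => ?_⟩
  · rw [hΨ]
    exact ha _ (hx 0) _ (hx 1)
  · rw [hΨ]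
    exact hF _ _

/-- Immersions of a product which split orthogonally as sums are extrinsic products. -/
theorem exists_eq_add_of_isOrtho {F : M₁ → M₂ → EuclideanSpace ℝ (Fin K)} (x₀ : M₁) (y₀ : M₂)
    (hF₁ : IsIsometricImmersion (euclid K) h₁ fun x => F x y₀)
    (hF₂ : IsIsometricImmersion (euclid K) h₂ (F x₀))
    (hadd : ∀ x y, F x y + F x₀ y₀ = F x y₀ + F x₀ y)
    (horth : ∀ x y, ⟪F x y₀ - F x₀ y₀, F x₀ y - F x₀ y₀⟫_ℝ = 0) :
    ∃ (d₁ d₂ : ℕ) (ι₁ : EuclideanSpace ℝ (Fin d₁) →ₗᵢ[ℝ] EuclideanSpace ℝ (Fin K))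
      (ι₂ : EuclideanSpace ℝ (Fin d₂) →ₗᵢ[ℝ] EuclideanSpace ℝ (Fin K))
      (v : EuclideanSpace ℝ (Fin K)) (f₁ : M₁ → EuclideanSpace ℝ (Fin d₁))
      (f₂ : M₂ → EuclideanSpace ℝ (Fin d₂)), (∀ x y, ⟪ι₁ x, ι₂ y⟫_ℝ = 0) ∧
      (∀ x, ⟪ι₁ x, v⟫_ℝ = 0) ∧ (∀ y, ⟪ι₂ y, v⟫_ℝ = 0) ∧
      IsIsometricImmersion (euclid d₁) h₁ f₁ ∧ IsIsometricImmersion (euclid d₂) h₂ f₂ ∧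
      ∀ x y, F x y = ι₁ (f₁ x) + ι₂ (f₂ y) + v := by
  set W₁ := Submodule.span ℝ (Set.range fun x => F x y₀ - F x₀ y₀) with hW₁
  set W₂ := Submodule.span ℝ (Set.range fun y => F x₀ y - F x₀ y₀) with hW₂
  have hW : W₁ ⟂ W₂ := by
    rw [hW₁, hW₂, Submodule.isOrtho_span]
    rintro _ ⟨x, rfl⟩ _ ⟨y, rfl⟩
    exact horth x y
  obtain ⟨d₁, ι₁, p₁, -, hι₁, hp₁⟩ := exists_linearIsometry_comp_eq_starProjection W₁
  obtain ⟨d₂, ι₂, p₂, -, hι₂, hp₂⟩ := exists_linearIsometry_comp_eq_starProjection W₂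
  have hm₁ : ∀ x, F x y₀ - F x₀ y₀ ∈ W₁ := fun x => Submodule.subset_span ⟨x, rfl⟩
  have hm₂ : ∀ y, F x₀ y - F x₀ y₀ ∈ W₂ := fun y => Submodule.subset_span ⟨y, rfl⟩
  have hs₁ : ∀ u ∈ W₁, ι₁ (p₁ u) = u := fun u hu => by
    rw [hp₁, Submodule.starProjection_eq_self_iff.2 hu]
  have hs₂ : ∀ u ∈ W₂, ι₂ (p₂ u) = u := fun u hu => by
    rw [hp₂, Submodule.starProjection_eq_self_iff.2 hu]
  set z := F x₀ y₀ with hz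
  -- The constant is the component of the base point orthogonal to both spans, and f₁, f₂ are the
  -- coordinates of the projections of F along the two slices.
  refine ⟨d₁, d₂, ι₁, ι₂, z - ι₁ (p₁ z) - ι₂ (p₂ z), fun x => p₁ (F x y₀), fun y => p₂ (F x₀ y),
    fun x y => hW.inner_eq (hι₁ x) (hι₂ y), fun x => ?_, fun y => ?_, ?_, ?_, fun x y => ?_⟩
  · rw [inner_sub_right, hW.inner_eq (hι₁ x) (hι₂ _), sub_zero, hp₁, real_inner_comm]
    exact Submodule.starProjection_inner_eq_zero z _ (hι₁ x)
  · rw [sub_right_comm, inner_sub_right, hW.symm.inner_eq (hι₂ y) (hι₁ _), sub_zero, hp₂,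
      real_inner_comm]
    exact Submodule.starProjection_inner_eq_zero z _ (hι₂ y)
  · refine IsIsometricImmersion.of_gram (B := innerₗ (EuclideanSpace ℝ (Fin d₁)))
      (B' := innerₗ (EuclideanSpace ℝ (Fin K))) hF₁ (LinearMap.contMDiff_comp p₁ hF₁.1) x₀
      fun x x' => ?_
    simp only [innerₗ_apply_apply]
    rw [← map_sub, ← map_sub, ← ι₁.inner_map_map, hs₁ _ (hm₁ x), hs₁ _ (hm₁ x')]
  · refine IsIsometricImmersion.of_gram (B := innerₗ (EuclideanSpace ℝ (Fin d₂)))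
      (B' := innerₗ (EuclideanSpace ℝ (Fin K))) hF₂ (LinearMap.contMDiff_comp p₂ hF₂.1) y₀
      fun y y' => ?_
    simp only [innerₗ_apply_apply]
    rw [← map_sub, ← map_sub, ← ι₂.inner_map_map, hs₂ _ (hm₂ y), hs₂ _ (hm₂ y')]
  · have e₁ := hs₁ _ (hm₁ x)
    have e₂ := hs₂ _ (hm₂ y)
    rw [map_sub, map_sub] at e₁ e₂
    rw [eq_add_of_sub_eq e₁, eq_add_of_sub_eq e₂, eq_sub_of_add_eq (hadd x y)]
    abel

theorem isExtrinsicProductImmersion_zero {F : M₁ → M₂ → EuclideanSpace ℝ (Fin K)} (x₀ : M₁)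
    (y₀ : M₂) (hF₁ : IsIsometricImmersion (euclid K) h₁ fun x => F x y₀)
    (hF₂ : IsIsometricImmersion (euclid K) h₂ (F x₀))
    (hadd : ∀ x y, F x y + F x₀ y₀ = F x y₀ + F x₀ y)
    (horth : ∀ x y, ⟪F x y₀ - F x₀ y₀, F x₀ y - F x₀ y₀⟫_ℝ = 0) :
    IsExtrinsicProductImmersion 0 h₁ h₂ fun p => F p.1 p.2 := by
  obtain ⟨d₁, d₂, ι₁, ι₂, v, f₁, f₂, hι, hv₁, hv₂, hf₁, hf₂, hF⟩ :=
    exists_eq_add_of_isOrtho x₀ y₀ hF₁ hF₂ hadd horth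
  exact isExtrinsicProductImmersion_of_eq_add hι hv₁ hv₂ hf₁ hf₂ hF le_rfl le_rfl
    (fun h => absurd rfl h) (fun h => absurd rfl h) (fun _ h => absurd rfl h)
    (fun _ h => absurd rfl h) fun _ _ _ _ h => absurd rfl h

/-- By orthogonality |F|² = |f₁|² + |f₂|² + |v|². A sum of functions of x and of y is constant only
if both are, so each f_i lies in a sphere, whose radius is positive because f_i is an immersion. -/
theorem isExtrinsicProductImmersion_of_mem_sphere {F : M₁ → M₂ → EuclideanSpace ℝ (Fin K)}
    (x₀ : M₁) (y₀ : M₂) (hF₁ : IsIsometricImmersion (euclid K) h₁ fun x => F x y₀)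
    (hF₂ : IsIsometricImmersion (euclid K) h₂ (F x₀))
    (hadd : ∀ x y, F x y + F x₀ y₀ = F x y₀ + F x₀ y)
    (horth : ∀ x y, ⟪F x y₀ - F x₀ y₀, F x₀ y - F x₀ y₀⟫_ℝ = 0) {a : ℝ}
    (ha : ∀ x y, ⟪F x y, F x y⟫_ℝ = 1 / a) :
    IsExtrinsicProductImmersion a h₁ h₂ fun p => F p.1 p.2 := by
  obtain ⟨d₁, d₂, ι₁, ι₂, v, f₁, f₂, hι, hv₁, hv₂, hf₁, hf₂, hF⟩ :=
    exists_eq_add_of_isOrtho x₀ y₀ hF₁ hF₂ hadd horth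
  have hnorm : ∀ x y, ⟪ι₁ x + ι₂ y + v, ι₁ x + ι₂ y + v⟫_ℝ = ⟪x, x⟫_ℝ + ⟪y, y⟫_ℝ + ⟪v, v⟫_ℝ :=
    fun x y => by
      simp only [inner_add_left, inner_add_right, LinearIsometry.inner_map_map, hι, hv₁, hv₂,
        real_inner_comm (ι₁ _) (ι₂ _), real_inner_comm (ι₁ _) v, real_inner_comm (ι₂ _) v]
      ring
  have hsum : ∀ x y, ⟪f₁ x, f₁ x⟫_ℝ + ⟪f₂ y, f₂ y⟫_ℝ + ⟪v, v⟫_ℝ = 1 / a := fun x y => by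
    rw [← hnorm, ← hF, ha]
  have hR₁ : ∀ x, ⟪f₁ x, f₁ x⟫_ℝ = ⟪f₁ x₀, f₁ x₀⟫_ℝ := fun x => by
    linarith [hsum x y₀, hsum x₀ y₀]
  have hR₂ : ∀ y, ⟪f₂ y, f₂ y⟫_ℝ = ⟪f₂ y₀, f₂ y₀⟫_ℝ := fun y => by
    linarith [hsum x₀ y, hsum x₀ y₀]
  have : Nonempty M₁ := ⟨x₀⟩
  have : Nonempty M₂ := ⟨y₀⟩
  obtain ⟨hpos₁, hd₁⟩ := hf₁.pos_and_two_le hR₁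
  obtain ⟨hpos₂, hd₂⟩ := hf₂.pos_and_two_le hR₂
  refine isExtrinsicProductImmersion_of_eq_add (c₁ := 1 / ⟪f₁ x₀, f₁ x₀⟫_ℝ)
    (c₂ := 1 / ⟪f₂ y₀, f₂ y₀⟫_ℝ) hι hv₁ hv₂ hf₁ hf₂ hF (by positivity) (by positivity)
    (fun _ => hd₁) (fun _ => hd₂) (fun x _ => by rw [one_div_one_div, hR₁])
    (fun y _ => by rw [one_div_one_div, hR₂]) fun x hx y hy _ => ?_
  rw [hnorm, hx (by positivity), hy (by positivity), one_div_one_div, one_div_one_div, hsum]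

end ExtrinsicProducts

/-! ### Null vectors and stereographic projections. -/

theorem exists_eq_smul_of_lightlike {m : ℕ} {x n : Minkowski m} (hx : lorentz x x = 0)
    (hn : lorentz n n = 0) (hn0 : n ≠ 0) (hxn : lorentz x n = 0) : ∃ t : ℝ, x = t • n := by
  have h2 : n.2 ≠ 0 := fun h => hn0 (eq_zero_of_lightlike_of_snd_eq_zero hn h)
  -- Subtracting the multiple of n with the same time coordinate leaves a null vector without time
  -- component, which is zero.
  refine ⟨x.2 / n.2, sub_eq_zero.1 (eq_zero_of_lightlike_of_snd_eq_zero ?_ ?_)⟩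
  · simp only [lorentz_sub_left, lorentz_sub_right, lorentz_smul_left, lorentz_smul_right, hx, hn,
      hxn, lorentz_comm n x]
    ring
  · rw [Prod.snd_sub, Prod.smul_snd, smul_eq_mul, div_mul_cancel₀ _ h2, sub_self]

/-- The points `(z, 1)` of the light cone are parametrized by a stereographic projection. -/
theorem ConeTriple.exists_isStereographicProjection {N : ℕ} (T : ConeTriple N) :
    ∃ (e : EuclideanSpace ℝ (Fin (N + 1)))
      (P : EuclideanSpace ℝ (Fin (N + 1)) → EuclideanSpace ℝ (Fin N)),
      IsStereographicProjection e P ∧ ∀ (z : EuclideanSpace ℝ (Fin (N + 1)))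
        (x : EuclideanSpace ℝ (Fin N)) (l : ℝ), ‖z‖ = 1 → ((z, 1) : Minkowski (N + 1)) = l • T.embed x →
        z ≠ e ∧ x = P z := by
  set b := T.w.2 with hb
  have hw0 : b ≠ 0 := fun h => by
    have h1 := T.p₀_w
    rw [eq_zero_of_lightlike_of_snd_eq_zero T.w_lightlike h, lorentz_zero_right] at h1
    exact zero_ne_one h1
  -- The ray of w meets the slice of time coordinate 1 in (e, 1). This is the pole: the only point
  -- (z, 1) of the cone orthogonal to w.
  set e := b⁻¹ • T.w.1 with he
  have hw1 : T.w.1 = b • e := by rw [he, smul_inv_smul₀ hw0]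
  have hlw : ∀ u : Minkowski (N + 1), lorentz u T.w = b * (⟪e, u.1⟫_ℝ - u.2) := fun u => by
    rw [lorentz, hw1, real_inner_smul_right, real_inner_comm, ← hb]; ring
  have hee : ⟪e, e⟫_ℝ = 1 := by
    have h := T.w_lightlike
    rw [hlw, hw1, real_inner_smul_right, ← hb] at h
    have h3 : b * b * (⟪e, e⟫_ℝ - 1) = 0 := by linarith
    have := (mul_eq_zero.1 h3).resolve_left (mul_ne_zero hw0 hw0)
    linarith
  have hnorm : ‖e‖ = 1 := by
    rw [real_inner_self_eq_norm_sq] at hee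
    exact (pow_eq_one_iff_of_nonneg (norm_nonneg e) two_ne_zero).1 hee
  -- the linear part of the affine isometry
  let p : Minkowski (N + 1) →ₗ[ℝ] EuclideanSpace ℝ (Fin (N + 1)) :=
    LinearMap.fst ℝ _ ℝ - (LinearMap.snd ℝ (EuclideanSpace ℝ (Fin (N + 1))) ℝ).smulRight e
  have hp : ∀ u, p u = u.1 - u.2 • e := fun u => rfl
  have hpw : p T.w = 0 := by rw [hp, hw1, ← hb, sub_self]
  have hpp : ∀ u, ‖p u‖ ^ 2 = lorentz u u - 2 * u.2 * (⟪e, u.1⟫_ℝ - u.2) := fun u => by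
    rw [← real_inner_self_eq_norm_sq, hp]
    simp only [inner_sub_left, inner_sub_right, real_inner_smul_left, real_inner_smul_right, hee,
      real_inner_comm e u.1, lorentz]
    ring
  have hAp : ∀ x, ‖p (T.A x)‖ = ‖x‖ := fun x => by
    have h1 := T.A_w x
    rw [hlw] at h1
    have h2 := hpp (T.A x)
    rw [(mul_eq_zero.1 h1).resolve_left hw0, mul_zero, sub_zero, T.A_isometry,
      real_inner_self_eq_norm_sq] at h2
    exact (pow_left_inj₀ (norm_nonneg _) (norm_nonneg _) two_ne_zero).1 h2
  let L₀ : EuclideanSpace ℝ (Fin N) →ₗᵢ[ℝ] EuclideanSpace ℝ (Fin (N + 1)) :=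
    { toLinearMap := p ∘ₗ T.A, norm_map' := hAp }
  let L : EuclideanSpace ℝ (Fin N) →ᵃⁱ[ℝ] EuclideanSpace ℝ (Fin (N + 1)) :=
    (AffineIsometryEquiv.vaddConst ℝ (e + p T.p₀)).toAffineIsometry.comp L₀.toAffineIsometry
  -- The map p kills w, so the quadratic term of the embedding disappears and L is affine; on w^⊥ it
  -- preserves squares, so L is isometric.
  have hL : ∀ x, L x = e + p (T.embed x) := fun x => by
    have h : L x = p (T.A x) + (e + p T.p₀) := rfl
    rw [h, ConeTriple.embed, map_sub, map_add, map_smul, hpw, smul_zero, sub_zero]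
    abel
  have hform : ∀ (x : EuclideanSpace ℝ (Fin N)) (z : EuclideanSpace ℝ (Fin (N + 1))) (t : ℝ),
      T.embed x = t • ((z, 1) : Minkowski (N + 1)) →
      z ≠ e ∧ L x = e + ((1 - (1 + b⁻¹)) / (1 - ⟪e, z⟫_ℝ)) • (z - e) := fun x z t h => by
    have h1 := T.lorentz_embed_w x
    rw [h, lorentz_smul_left, hlw] at h1
    have hne : ⟪e, z⟫_ℝ - 1 ≠ 0 := fun h0 => by
      simp [h0] at h1
    refine ⟨?_, ?_⟩
    · rintro rfl
      rw [hee, sub_self] at hne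
      exact hne rfl
    · have ht : t = (1 - (1 + b⁻¹)) / (1 - ⟪e, z⟫_ℝ) := by
        have hne' : 1 - ⟪e, z⟫_ℝ ≠ 0 := fun h0 => hne (by linarith)
        rw [eq_div_iff hne']
        field_simp
        simp only at h1
        linarith
      rw [hL, h, map_smul, hp, ht, one_smul]
  classical
  let P : EuclideanSpace ℝ (Fin (N + 1)) → EuclideanSpace ℝ (Fin N) := fun z =>
    if h : ∃ (x : EuclideanSpace ℝ (Fin N)) (t : ℝ), T.embed x = t • ((z, 1) : Minkowski (N + 1))
    then h.choose else 0
  have hP : ∀ z, ‖z‖ = 1 → z ≠ e → ∃ t : ℝ, T.embed (P z) = t • ((z, 1) : Minkowski (N + 1)) := by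
    intro z hz hze
    have hne : ⟪e, z⟫_ℝ - 1 ≠ 0 := fun h0 =>
      hze ((inner_eq_one_iff_of_norm_eq_one (𝕜 := ℝ) hnorm hz).1 (by linarith)).symm
    have hex : ∃ (x : EuclideanSpace ℝ (Fin N)) (t : ℝ),
        T.embed x = t • ((z, 1) : Minkowski (N + 1)) := by
      obtain ⟨x, hx⟩ := T.exists_embed_eq (n := (b * (⟪e, z⟫_ℝ - 1))⁻¹ • ((z, 1) : Minkowski (N + 1)))
        (by
          have : lorentz ((z, 1) : Minkowski (N + 1)) (z, 1) = 0 := by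
            rw [lorentz, real_inner_self_eq_norm_sq, hz]; norm_num
          rw [lorentz_smul_left, lorentz_smul_right, this, mul_zero, mul_zero])
        (by rw [lorentz_smul_left, hlw, inv_mul_cancel₀ (mul_ne_zero hw0 hne)])
      exact ⟨x, _, hx⟩
    simp only [P, dif_pos hex]
    exact hex.choose_spec
  -- The height 1 + b⁻¹ of the image hyperplane comes from the normalization ⟨T.embed x, w⟩ = 1.
  refine ⟨e, P, ⟨hnorm, 1 + b⁻¹, L, by simpa using hw0, fun x => ?_, fun z hz hze => ?_⟩,
    fun z x l hz h => ?_⟩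
  · have h1 := T.lorentz_embed_w x
    rw [hlw] at h1
    rw [hL, inner_add_right, hee, hp, inner_sub_right, real_inner_smul_right, hee, mul_one,
      eq_inv_of_mul_eq_one_right h1]
  · obtain ⟨t, ht⟩ := hP z hz hze
    exact (hform _ z t ht).2
  · have hl : l ≠ 0 := by
      rintro rfl
      rw [zero_smul] at h
      exact one_ne_zero (congrArg Prod.snd h)
    have h' : T.embed x = l⁻¹ • ((z, 1) : Minkowski (N + 1)) := by rw [h, inv_smul_smul₀ hl]
    obtain ⟨hze, hx⟩ := hform x z _ h'
    obtain ⟨t, ht⟩ := hP z hz hze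
    exact ⟨hze, L.injective (hx.trans (hform _ z t ht).2.symm)⟩

/-! ### The product forms and the case distinction. -/

section ProductForms

variable {E₁ : Type*} [NormedAddCommGroup E₁] [NormedSpace ℝ E₁] [Nontrivial E₁]
  {H₁ : Type*} [TopologicalSpace H₁] {I₁ : ModelWithCorners ℝ E₁ H₁} [I₁.Boundaryless]
  {M₁ : Type*} [TopologicalSpace M₁] [ChartedSpace H₁ M₁] [IsManifold I₁ ∞ M₁]
  {E₂ : Type*} [NormedAddCommGroup E₂] [NormedSpace ℝ E₂] [Nontrivial E₂]
  {H₂ : Type*} [TopologicalSpace H₂] {I₂ : ModelWithCorners ℝ E₂ H₂} [I₂.Boundaryless]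
  {M₂ : Type*} [TopologicalSpace M₂] [ChartedSpace H₂ M₂] [IsManifold I₂ ∞ M₂]
  {N : ℕ} {T : ConeTriple N} {h₁ : SmoothMetric I₁ M₁} {h₂ : SmoothMetric I₂ M₂}
  {f : M₁ → M₂ → EuclideanSpace ℝ (Fin N)} {F : M₁ → M₂ → Minkowski (N + 1)}

namespace IsConeSplitting

/-- With constant time coordinate s, the spatial part of F has the same increments as F and lies in
the sphere of radius s. Hence it is an extrinsic product in that sphere, and after division by s the
cone triple recovers f by a stereographic projection. -/
theorem isProductForm_of_snd_eq (S : IsConeSplitting T h₁ h₂ f F) (x₀ : M₁) (y₀ : M₂) {s : ℝ}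
    (hs : 0 < s) (h : ∀ x y, (F x y).2 = s) : IsProductForm h₁ h₂ fun p => f p.1 p.2 := by
  have hsub : ∀ x x' y y' x₁ x₂ y₁ y₂, ⟪(F x y).1 - (F x' y').1, (F x₁ y₁).1 - (F x₂ y₂).1⟫_ℝ =
      lorentz (F x y - F x' y') (F x₁ y₁ - F x₂ y₂) := fun x x' y y' x₁ x₂ y₁ y₂ => by
    simp only [lorentz, Prod.fst_sub, Prod.snd_sub, h, sub_self, mul_zero, sub_zero]
  have hself : ∀ x y, ⟪(F x y).1, (F x y).1⟫_ℝ = s ^ 2 := fun x y => by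
    have := S.null x y
    rw [lorentz, h] at this
    linarith
  have hF : IsExtrinsicProductImmersion (1 / s ^ 2) h₁ h₂ fun p : M₁ × M₂ => (F p.1 p.2).1 := by
    refine isExtrinsicProductImmersion_of_mem_sphere (F := fun x y => (F x y).1) x₀ y₀ ?_ ?_
      (fun x y => congrArg Prod.fst ((S.add_eq_add x x₀ y y₀).trans (add_comm _ _)))
      (fun x y => ?_) fun x y => ?_
    · exact IsIsometricImmersion.of_gram (B := innerₗ (EuclideanSpace ℝ (Fin (N + 1))))
        (B' := lorentzForm (N + 1)) (S.isometric_fst y₀)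
        (LinearMap.contMDiff_comp (LinearMap.fst ℝ _ ℝ) (S.isometric_fst y₀).1) x₀
        fun x x' => hsub x x₀ y₀ y₀ x' x₀ y₀ y₀
    · exact IsIsometricImmersion.of_gram (B := innerₗ (EuclideanSpace ℝ (Fin (N + 1))))
        (B' := lorentzForm (N + 1)) (S.isometric_snd x₀)
        (LinearMap.contMDiff_comp (LinearMap.fst ℝ _ ℝ) (S.isometric_snd x₀).1) y₀
        fun y y' => hsub x₀ x₀ y y₀ x₀ x₀ y' y₀
    · rw [hsub]
      have := S.lorentz_sub_sub x x₀ x₀ y y₀ y₀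
      exact this
    · rw [hself, one_div_one_div]
  obtain ⟨e, P, heP, hP⟩ := T.exists_isStereographicProjection
  refine Or.inr ⟨1 / s ^ 2, _, s⁻¹, e, P, by positivity, hF, inv_pos.2 hs, by rw [inv_pow, one_div],
    heP, fun p => hP _ _ (s⁻¹ * lorentz (F p.1 p.2) T.w) ?_ ?_⟩
  · rw [norm_smul, norm_inv, Real.norm_of_nonneg hs.le, ← Real.sqrt_sq hs.le, ← hself p.1 p.2,
      ← norm_eq_sqrt_real_inner, inv_mul_cancel₀]
    rw [norm_ne_zero_iff, ← inner_self_ne_zero (𝕜 := ℝ), hself]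
    positivity
  · rw [mul_smul, ← S.eq_smul]
    ext1
    · rfl
    · rw [Prod.smul_snd, h, smul_eq_mul, inv_mul_cancel₀ hs.ne']

/-- If the chords of `G` have the same lengths as those of the immersion `F` into the light cone,
then `G` is an extrinsic product. -/
theorem isExtrinsicProductImmersion_of_norm_sub_sq (S : IsConeSplitting T h₁ h₂ f F) (x₀ : M₁)
    (y₀ : M₂) {K : ℕ} {G : M₁ → M₂ → EuclideanSpace ℝ (Fin K)}
    (hG₁ : ContMDiff I₁ 𝓘(ℝ, EuclideanSpace ℝ (Fin K)) ∞ fun x => G x y₀)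
    (hG₂ : ContMDiff I₂ 𝓘(ℝ, EuclideanSpace ℝ (Fin K)) ∞ (G x₀))
    (hG : ∀ x x' y y', ‖G x y - G x' y'‖ ^ 2 = -2 * lorentz (F x y) (F x' y')) :
    IsExtrinsicProductImmersion 0 h₁ h₂ fun p => G p.1 p.2 := by
  have polar : ∀ a b c d : EuclideanSpace ℝ (Fin K), 2 * ⟪a - b, c - d⟫_ℝ =
      ‖a - d‖ ^ 2 + ‖b - c‖ ^ 2 - ‖a - c‖ ^ 2 - ‖b - d‖ ^ 2 := fun a b c d => by
    simp only [← real_inner_self_eq_norm_sq, inner_sub_left, inner_sub_right, real_inner_comm a,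
      real_inner_comm b]
    ring
  have hsub : ∀ x x' y y' x₁ x₂ y₁ y₂, ⟪G x y - G x' y', G x₁ y₁ - G x₂ y₂⟫_ℝ =
      lorentz (F x y - F x' y') (F x₁ y₁ - F x₂ y₂) := fun x x' y y' x₁ x₂ y₁ y₂ => by
    have := polar (G x y) (G x' y') (G x₁ y₁) (G x₂ y₂)
    rw [hG, hG, hG, hG] at this
    simp only [lorentz_sub_left, lorentz_sub_right]
    linarith
  refine isExtrinsicProductImmersion_zero x₀ y₀ ?_ ?_ (fun x y => ?_) fun x y => ?_
  · exact IsIsometricImmersion.of_gram (B := innerₗ (EuclideanSpace ℝ (Fin K)))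
      (B' := lorentzForm (N + 1)) (S.isometric_fst y₀) hG₁ x₀
      fun x x' => hsub x x₀ y₀ y₀ x' x₀ y₀ y₀
  · exact IsIsometricImmersion.of_gram (B := innerₗ (EuclideanSpace ℝ (Fin K)))
      (B' := lorentzForm (N + 1)) (S.isometric_snd x₀) hG₂ y₀
      fun y y' => hsub x₀ x₀ y y₀ x₀ x₀ y' y₀
  · rw [← sub_eq_sub_iff_add_eq_add, ← sub_eq_zero, ← inner_self_eq_zero (𝕜 := ℝ)]
    have hF := S.sub_eq_sub x x₀ y y₀
    rw [inner_sub_left, inner_sub_right (G x y - G x₀ y), inner_sub_right (G x y₀ - G x₀ y₀), hsub,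
      hsub, hsub, hsub, hF]
    ring
  · rw [hsub]
    exact S.lorentz_sub_sub x x₀ x₀ y y₀ y₀

/-- The slice ⟨·, n⟩ = κ of the cone is a flat copy of ℝ^N. If n is proportional to w, the conformal
factor is constant and f is itself a product up to scale. Otherwise the ray of n represents a point
q of ℝ^N, and inversion at q turns f into such a product. -/
theorem isProductForm_of_lightlike (S : IsConeSplitting T h₁ h₂ f F) (x₀ : M₁) (y₀ : M₂)
    {n : Minkowski (N + 1)} {κ : ℝ} (hn : lorentz n n = 0) (hn0 : n ≠ 0) (hκ : κ ≠ 0)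
    (h : ∀ x y, lorentz (F x y) n = κ) : IsProductForm h₁ h₂ fun p => f p.1 p.2 := by
  have hchord : ∀ x x' y y', -2 * lorentz (F x y) (F x' y') =
      lorentz (F x y) T.w * lorentz (F x' y') T.w * ‖f x y - f x' y'‖ ^ 2 := fun x x' y y' => by
    rw [S.lorentz_eq]; ring
  refine Or.inl ?_
  by_cases hnw : lorentz n T.w = 0
  · obtain ⟨t, ht⟩ := exists_eq_smul_of_lightlike hn T.w_lightlike (fun h0 => by
      have := T.p₀_w
      rw [h0, lorentz_zero_right] at this
      exact zero_ne_one this) hnw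
    have hl : ∀ x y, lorentz (F x y) T.w = lorentz (F x₀ y₀) T.w := fun x y => by
      have ht0 : t ≠ 0 := fun h0 => hn0 (by rw [ht, h0, zero_smul])
      refine mul_left_cancel₀ ht0 ?_
      rw [← lorentz_smul_right, ← lorentz_smul_right, ← ht, h, h]
    set l := lorentz (F x₀ y₀) T.w with hldef
    have hl0 : 0 < l := S.pos x₀ y₀
    refine ⟨fun p => l • f p.1 p.2, l⁻¹, S.isExtrinsicProductImmersion_of_norm_sub_sq x₀ y₀
      (G := fun x y => l • f x y) (LinearMap.contMDiff_comp (l • LinearMap.id) (S.smooth_fst y₀))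
      (LinearMap.contMDiff_comp (l • LinearMap.id) (S.smooth_snd x₀)) (fun x x' y y' => ?_), inv_pos.2 hl0,
      Or.inl fun p => (inv_smul_smul₀ hl0.ne' _).symm⟩
    rw [hchord, hl, hl x' y', ← smul_sub, norm_smul, mul_pow, Real.norm_of_nonneg hl0.le, pow_two l]
  · set a := (lorentz n T.w)⁻¹ with ha
    obtain ⟨q, hq⟩ := T.exists_embed_eq (n := a • n)
      (by rw [lorentz_smul_left, lorentz_smul_right, hn, mul_zero, mul_zero])
      (by rw [lorentz_smul_left, inv_mul_cancel₀ hnw])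
    -- This is the constant value of ⟨F, w⟩ |f - q|². Scaling the inverted map by μ gives it the
    -- chord lengths of F.
    set μ := -2 * a * κ with hμ
    have hdist : ∀ x y, lorentz (F x y) T.w * ‖f x y - q‖ ^ 2 = μ := fun x y => by
      have h1 := h x y
      have h2 := T.lorentz_embed (f x y) q
      rw [S.eq_smul, lorentz_smul_left] at h1
      rw [hq, lorentz_smul_right] at h2
      rw [hμ, ← h1]
      linear_combination (2 * lorentz (F x y) T.w) * h2
    have hμ0 : μ ≠ 0 := by
      rw [hμ]
      exact mul_ne_zero (mul_ne_zero (by norm_num) (inv_ne_zero hnw)) hκ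
    have hne : ∀ x y, f x y ≠ q := fun x y h0 => hμ0 (by
      rw [← hdist x y, h0, sub_self, norm_zero]; ring)
    have hpos : ∀ x y, 0 < ‖f x y - q‖ := fun x y => norm_pos_iff.2 (sub_ne_zero.2 (hne x y))
    have hμpos : 0 < μ := by
      rw [← hdist x₀ y₀]
      exact mul_pos (S.pos x₀ y₀) (pow_pos (hpos x₀ y₀) 2)
    have hinv : ∀ z, z ≠ q → ContDiffAt ℝ ∞ (EuclideanGeometry.inversion q 1) z := fun z hz =>
      ContDiffAt.inversion contDiffAt_const contDiffAt_const contDiffAt_id hz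
    refine ⟨fun p => μ • EuclideanGeometry.inversion q 1 (f p.1 p.2), μ⁻¹,
      S.isExtrinsicProductImmersion_of_norm_sub_sq x₀ y₀
      (G := fun x y => μ • EuclideanGeometry.inversion q 1 (f x y))
      (LinearMap.contMDiff_comp (μ • LinearMap.id) (k := fun x =>
        EuclideanGeometry.inversion q 1 (f x y₀)) fun x => ?_)
      (LinearMap.contMDiff_comp (μ • LinearMap.id) (k := fun y =>
        EuclideanGeometry.inversion q 1 (f x₀ y)) fun y => ?_) (fun x x' y y' => ?_),
      inv_pos.2 hμpos, Or.inr ⟨q, fun p => ?_⟩⟩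
    · exact ContMDiffAt.comp (g := EuclideanGeometry.inversion q 1) x
        (hinv _ (hne x y₀)).contMDiffAt (S.smooth_fst y₀ x)
    · exact ContMDiffAt.comp (g := EuclideanGeometry.inversion q 1) y
        (hinv _ (hne x₀ y)).contMDiffAt (S.smooth_snd x₀ y)
    · rw [hchord, ← smul_sub, norm_smul, ← dist_eq_norm (EuclideanGeometry.inversion q 1 _),
        EuclideanGeometry.dist_inversion_inversion (hne x y) (hne x' y'), dist_eq_norm, dist_eq_norm,
        dist_eq_norm, Real.norm_of_nonneg hμpos.le]
      have e : (μ * (1 ^ 2 / (‖f x y - q‖ * ‖f x' y' - q‖) * ‖f x y - f x' y'‖)) ^ 2 =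
          μ * μ * ‖f x y - f x' y'‖ ^ 2 / (‖f x y - q‖ ^ 2 * ‖f x' y' - q‖ ^ 2) := by ring
      rw [e, div_eq_iff (mul_pos (pow_pos (hpos x y) 2) (pow_pos (hpos x' y') 2)).ne']
      linear_combination (-‖f x y - f x' y'‖ ^ 2 * (lorentz (F x' y') T.w * ‖f x' y' - q‖ ^ 2)) *
        hdist x y - ‖f x y - f x' y'‖ ^ 2 * μ * hdist x' y'
    · rw [inv_smul_smul₀ hμ0]
      exact ⟨fun h0 => hne _ _ ((EuclideanGeometry.inversion_eq_center one_ne_zero).1 h0),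
        (EuclideanGeometry.inversion_inversion q one_ne_zero _).symm⟩

/-- Otherwise the whole slice F(·, y₀) would lie on the line of n, where the form vanishes, whereas
the slice induces a Riemannian metric. -/
theorem lorentz_ne_zero_of_lightlike (S : IsConeSplitting T h₁ h₂ f F) (x₀ : M₁) (y₀ : M₂)
    {n : Minkowski (N + 1)} (hn : lorentz n n = 0) (hn0 : n ≠ 0) : ∃ x, lorentz (F x y₀) n ≠ 0 := by
  by_contra! h
  have hpar : ∀ x, ∃ t : ℝ, F x y₀ = t • n := fun x =>
    exists_eq_smul_of_lightlike (S.null x y₀) hn hn0 (h x)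
  have hiso := S.isometric_fst y₀
  obtain ⟨a, ha⟩ := hiso.exists_vectorDeriv_pos (I := I₁) x₀
  have := form_vectorDeriv_eq hiso.1 hiso.1 (B := lorentzForm (N + 1)) (B' := 0) x₀
    (fun x x' => by
      obtain ⟨t, ht⟩ := hpar x
      obtain ⟨t', ht'⟩ := hpar x'
      obtain ⟨t₀, ht₀⟩ := hpar x₀
      simp only [ht, ht', ht₀, ← sub_smul, lorentzForm_apply, lorentz_smul_left, lorentz_smul_right,
        hn, mul_zero]
      rfl) x₀ a a
  rw [lorentzForm_apply] at this
  rw [this] at ha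
  exact lt_irrefl _ ha

theorem sub_mem_sup (S : IsConeSplitting T h₁ h₂ f F) (x₀ : M₁) (y₀ : M₂) (x : M₁) (y : M₂) :
    F x y - F x₀ y₀ ∈ Submodule.span ℝ (Set.range fun x => F x y₀ - F x₀ y₀) ⊔
      Submodule.span ℝ (Set.range fun y => F x₀ y - F x₀ y₀) := by
  have e : F x y - F x₀ y₀ = (F x y₀ - F x₀ y₀) + (F x₀ y - F x₀ y₀) := by
    rw [← S.sub_eq_sub x x₀ y y₀]
    abel
  rw [e]
  exact Submodule.add_mem_sup (Submodule.subset_span ⟨x, rfl⟩) (Submodule.subset_span ⟨y, rfl⟩)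

theorem lorentz_mem_mem (S : IsConeSplitting T h₁ h₂ f F) {x₀ : M₁} {y₀ : M₂}
    {v w : Minkowski (N + 1)} (hv : v ∈ Submodule.span ℝ (Set.range fun x => F x y₀ - F x₀ y₀))
    (hw : w ∈ Submodule.span ℝ (Set.range fun y => F x₀ y - F x₀ y₀)) : lorentz v w = 0 := by
  induction hw using Submodule.span_induction with
  | mem w hw =>
    obtain ⟨y, rfl⟩ := hw
    exact S.lorentz_sub_eq_zero hv x₀ y y₀
  | zero => exact lorentz_zero_right _
  | add w w' _ _ hw hw' => rw [lorentz_add_right, hw, hw', add_zero]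
  | smul c w _ hw => rw [lorentz_smul_right, hw, mul_zero]

/-- The causal character of V₁, V₂ and V₁ + V₂ decides the form of f. A time-like vector in one of
the spans gives the hyperbolic form and, by semidefiniteness of the increments of a spherical
factor, rules out the form with the roles exchanged. -/
theorem isDecomposable [ConnectedSpace M₁] [ConnectedSpace M₂]
    (S : IsConeSplitting T h₁ h₂ f F) : IsDecomposable h₁ h₂ fun p => f p.1 p.2 := by
  obtain ⟨x₀⟩ : Nonempty M₁ := inferInstance
  obtain ⟨y₀⟩ : Nonempty M₂ := inferInstance
  set V₁ := Submodule.span ℝ (Set.range fun x => F x y₀ - F x₀ y₀) with hV₁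
  set V₂ := Submodule.span ℝ (Set.range fun y => F x₀ y - F x₀ y₀) with hV₂
  by_cases t₁ : ∃ τ ∈ V₁, lorentz τ τ < 0
  · obtain ⟨τ, hmem, hτ⟩ := t₁
    exact Or.inr (Or.inl ⟨S.isHyperbolicForm_of_timelike_mem hτ hmem, fun hyp =>
      (S.symm.nonneg_of_isHyperbolicForm hyp y₀ x₀ hmem).not_gt hτ⟩)
  by_cases t₂ : ∃ τ ∈ V₂, lorentz τ τ < 0
  · obtain ⟨τ, hmem, hτ⟩ := t₂
    exact Or.inr (Or.inr ⟨S.symm.isHyperbolicForm_of_timelike_mem hτ hmem, fun hyp =>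
      (S.nonneg_of_isHyperbolicForm hyp x₀ y₀ hmem).not_gt hτ⟩)
  push Not at t₁ t₂
  refine Or.inl ?_
  rcases timelike_trichotomy (V₁ ⊔ V₂) with ⟨τ, hmem, hτ⟩ | ⟨τ, hτ, horth⟩ | ⟨n, -, hn0, hn, horth⟩
  -- V₁ and V₂ are orthogonal and both semidefinite, so their sum contains no time-like vector.
  · obtain ⟨v, hv, w, hw, rfl⟩ := Submodule.mem_sup.1 hmem
    rw [lorentz_add_left, lorentz_add_right, lorentz_add_right, lorentz_comm w v,
      S.lorentz_mem_mem hv hw] at hτ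
    linarith [t₁ v hv, t₂ w hw]
  · obtain ⟨R, hR, ⟨r, hr, hRτ⟩, hpos⟩ :=
      exists_lorentz_isometry hτ (S.null x₀ y₀) (S.ne_zero x₀ y₀)
    refine (S.map R hR).isProductForm_of_snd_eq x₀ y₀ hpos fun x y => ?_
    have := horth _ (S.sub_mem_sup x₀ y₀ x y)
    rw [← hR, hRτ, map_sub] at this
    simp only [lorentz, inner_zero_left, Prod.snd_sub, zero_sub, neg_eq_zero, mul_eq_zero, hr,
      false_or] at this
    linarith
  · have hconst : ∀ x y, lorentz (F x y) n = lorentz (F x₀ y₀) n := fun x y => by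
      have := horth _ (S.sub_mem_sup x₀ y₀ x y)
      rw [lorentz_comm, lorentz_sub_left] at this
      linarith
    obtain ⟨x, hx⟩ := S.lorentz_ne_zero_of_lightlike x₀ y₀ hn hn0
    exact S.isProductForm_of_lightlike x₀ y₀ hn hn0 (by rwa [hconst] at hx) hconst

end IsConeSplitting

end ProductForms

/-! ### From conformal immersions to the light cone. -/

section Lift

variable {E₁ : Type*} [NormedAddCommGroup E₁] [NormedSpace ℝ E₁]
  {H₁ : Type*} [TopologicalSpace H₁] {I₁ : ModelWithCorners ℝ E₁ H₁} [I₁.Boundaryless]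
  {M₁ : Type*} [TopologicalSpace M₁] [ChartedSpace H₁ M₁] [IsManifold I₁ ∞ M₁]
  {E₂ : Type*} [NormedAddCommGroup E₂] [NormedSpace ℝ E₂]
  {H₂ : Type*} [TopologicalSpace H₂] {I₂ : ModelWithCorners ℝ E₂ H₂} [I₂.Boundaryless]
  {M₂ : Type*} [TopologicalSpace M₂] [ChartedSpace H₂ M₂] [IsManifold I₂ ∞ M₂]
  {N : ℕ}

/-- A conformal immersion of a Riemannian product lifts to an isometric immersion of the product
into the light cone. -/
theorem IsConformalToProduct.isConeSplitting {g : SmoothMetric (I₁.prod I₂) (M₁ × M₂)}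
    {φ : M₁ × M₂ → ℝ} {h₁ : SmoothMetric I₁ M₁} {h₂ : SmoothMetric I₂ M₂}
    (hφ : IsConformalToProduct g φ h₁ h₂) (T : ConeTriple N)
    {f : M₁ × M₂ → EuclideanSpace ℝ (Fin N)} (hf : IsIsometricImmersion (euclid N) g f)
    (hsplit : ∀ (x x' : M₁) (y y' : M₂),
      (φ (x, y))⁻¹ • T.embed (f (x, y)) + (φ (x', y'))⁻¹ • T.embed (f (x', y')) =
      (φ (x', y))⁻¹ • T.embed (f (x', y)) + (φ (x, y'))⁻¹ • T.embed (f (x, y'))) :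
    IsConeSplitting T h₁ h₂ (fun x y => f (x, y)) fun x y => (φ (x, y))⁻¹ • T.embed (f (x, y)) := by
  obtain ⟨hφs, hφpos, hg⟩ := hφ
  have hls : ContMDiff (I₁.prod I₂) 𝓘(ℝ, ℝ) ∞ fun p => (φ p)⁻¹ := fun p =>
    (contDiffAt_inv ℝ (hφpos p).ne').contMDiffAt.comp p (hφs p)
  have hF := T.contMDiff_smul_embed hf.1 hls
  have hinner : ∀ p a b, lorentz (vectorDeriv (I₁.prod I₂) (fun p => (φ p)⁻¹ • T.embed (f p)) p a)
      (vectorDeriv (I₁.prod I₂) (fun p => (φ p)⁻¹ • T.embed (f p)) p b) =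
      metricAt h₁ p.1 a.1 b.1 + metricAt h₂ p.2 a.2 b.2 := fun p a b => by
    have e : (⟪vectorDeriv (I₁.prod I₂) f p a, vectorDeriv (I₁.prod I₂) f p b⟫_ℝ : ℝ) =
        φ p ^ 2 * (pullbackFst h₁ p a b + pullbackSnd h₂ p a b) :=
      (hf.vectorDeriv_form p a b).trans (hg p a b)
    rw [T.lorentz_vectorDeriv_smul_embed hf.1 hls, e, pullbackFst_eq, pullbackSnd_eq, ← mul_assoc,
      ← mul_pow, inv_mul_cancel₀ (hφpos p).ne', one_pow, one_mul]
  have hw : ∀ x y, lorentz ((φ (x, y))⁻¹ • T.embed (f (x, y))) T.w = (φ (x, y))⁻¹ := fun x y => by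
    rw [lorentz_smul_left, T.lorentz_embed_w, mul_one]
  have hfst : ∀ x y a b,
      lorentz (vectorDeriv I₁ (fun x => (φ (x, y))⁻¹ • T.embed (f (x, y))) x a)
        (vectorDeriv I₁ (fun x => (φ (x, y))⁻¹ • T.embed (f (x, y))) x b) = metricAt h₁ x a b :=
    fun x y a b => by
      have h := hinner (x, y) (a, 0) (b, 0)
      rw [← vectorDeriv_fst_slice hF, ← vectorDeriv_fst_slice hF, map_zero,
        add_zero] at h
      exact h
  have hsnd : ∀ x y a b,
      lorentz (vectorDeriv I₂ (fun y => (φ (x, y))⁻¹ • T.embed (f (x, y))) y a)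
        (vectorDeriv I₂ (fun y => (φ (x, y))⁻¹ • T.embed (f (x, y))) y b) = metricAt h₂ y a b :=
    fun x y a b => by
      have h := hinner (x, y) (0, a) (0, b)
      rw [← vectorDeriv_snd_slice hF, ← vectorDeriv_snd_slice hF, map_zero,
        zero_add] at h
      exact h
  refine ⟨fun y => hf.1.fst_slice y, fun x => hf.1.snd_slice x,
    fun y => ⟨hF.fst_slice y, fun x a b => hfst x y a b⟩,
    fun x => ⟨hF.snd_slice x, fun y a b => hsnd x y a b⟩, fun x y => ?_, fun x y => ?_, hsplit⟩
  · rw [hw]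
    exact inv_pos.2 (hφpos _)
  · rw [hw]

end Lift

/-! ### The decomposition theorem. -/

theorem corollary4p5 {n₁ n₂ N : ℕ} (hn₁ : 1 ≤ n₁) (hn₂ : 1 ≤ n₂)
    {M₁ : Type*} [TopologicalSpace M₁] [ChartedSpace (EuclideanSpace ℝ (Fin n₁)) M₁]
    [IsManifold (𝓡 n₁) ∞ M₁] [T2Space M₁] [SecondCountableTopology M₁]
    {M₂ : Type*} [TopologicalSpace M₂] [ChartedSpace (EuclideanSpace ℝ (Fin n₂)) M₂]
    [IsManifold (𝓡 n₂) ∞ M₂] [T2Space M₂] [SecondCountableTopology M₂]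
    [SimplyConnectedSpace (M₁ × M₂)]
    (g : SmoothMetric ((𝓡 n₁).prod (𝓡 n₂)) (M₁ × M₂)) (hg : IsTwistedProductMetric g)
    (f : M₁ × M₂ → EuclideanSpace ℝ (Fin N)) (hf : IsIsometricImmersion (euclid N) g f)
    (hadapted₁ : IsShapeInvariant g f (productNetFst (𝓡 n₁) (𝓡 n₂)))
    (hadapted₂ : IsShapeInvariant g f (productNetSnd (𝓡 n₁) (𝓡 n₂)))
    (hspherical₁ : n₁ = 1 → IsSpherical g (productNetFst (𝓡 n₁) (𝓡 n₂)))
    (hspherical₂ : n₂ = 1 → IsSpherical g (productNetSnd (𝓡 n₁) (𝓡 n₂))) :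
    ∃ (φ : M₁ × M₂ → ℝ) (h₁ : SmoothMetric (𝓡 n₁) M₁) (h₂ : SmoothMetric (𝓡 n₂) M₂),
      IsConformalToProduct g φ h₁ h₂ ∧ IsDecomposable h₁ h₂ f := by
  have : Nontrivial (EuclideanSpace ℝ (Fin n₁)) :=
    Module.nontrivial_of_finrank_pos (R := ℝ) (by rwa [finrank_euclideanSpace_fin])
  have : Nontrivial (EuclideanSpace ℝ (Fin n₂)) :=
    Module.nontrivial_of_finrank_pos (R := ℝ) (by rwa [finrank_euclideanSpace_fin])
  obtain ⟨p₀⟩ : Nonempty (M₁ × M₂) := inferInstance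
  have : Nonempty M₁ := ⟨p₀.1⟩
  have : Nonempty M₂ := ⟨p₀.2⟩
  have : ConnectedSpace M₁ := (Prod.fst_surjective (β := M₂)).connectedSpace continuous_fst
  have : ConnectedSpace M₂ := (Prod.snd_surjective (α := M₁)).connectedSpace continuous_snd
  have hs₁ : 2 ≤ Module.finrank ℝ (EuclideanSpace ℝ (Fin n₁)) ∨
      IsSpherical g (productNetFst (𝓡 n₁) (𝓡 n₂)) := by
    rw [finrank_euclideanSpace_fin]
    rcases hn₁.eq_or_lt with h | h
    · exact Or.inr (hspherical₁ h.symm)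
    · exact Or.inl h
  have hs₂ : 2 ≤ Module.finrank ℝ (EuclideanSpace ℝ (Fin n₂)) ∨
      IsSpherical g (productNetSnd (𝓡 n₁) (𝓡 n₂)) := by
    rw [finrank_euclideanSpace_fin]
    rcases hn₂.eq_or_lt with h | h
    · exact Or.inr (hspherical₂ h.symm)
    · exact Or.inl h
  obtain ⟨φ, h₁, h₂, hφ, hsplit⟩ := exists_conformal_splitting hg hf hadapted₁ hs₁ hs₂
  obtain ⟨T⟩ := exists_coneTriple N
  exact ⟨φ, h₁, h₂, hφ, (hφ.isConeSplitting T hf (hsplit T)).isDecomposable⟩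

end
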